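/- **Turing machines.** A Turing machine has finite sets $Q$ of states and $\Gamma$ of tape symbols, a start state, a blank symbol and a partial transition function $\delta: Q\times\Gamma\rightharpoonup Q\times\Gamma\times\{L,R\}$; it halts when $\delta$ is undefined. A machine is an $(m,n)$-UTM if it has $m$ states and $n$ symbols and simulates every Turing machine $M$: there are computable total functions $e,d$ such that, for every Turing machine $M$ and input word $w$, started from the initial configuration $e(M,w)$ it halts if and only if $M$ halts on $w$, and in that case $d$ maps its final configuration to the final configuration of $M$. **The game.** We consider one-player Civ:VI with infinitely many turns on an infinite hexagonal map, with the following rules. One Citizen of a City works the City Center, the others work distinct tiles owned by the City; the player may reassign the latter at will, and newborn Citizens are first placed on an unworked tile of highest yield. Grassland yields $2$ Food, floodplains $3$, a Farm $1$ more, a City Center $2$ more than its terrain; each Citizen eats $2$ Food per turn. A City with $p$ Citizens and enough stored Food (an arbitrary given number $G(p)$) gains a Citizen, unless the player caps its growth; a City that cannot feed its Citizens loses one. A City yields one Production per turn; training a Settler needs $15\cdot 2k+50$ Production, where $k$ is the number of the player's Cities, and costs the City a Citizen (it must have at least two). The Worker and the Settlers move up to two hexes per turn. A Settler can found a City at least four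 hexes away from every other City; it owns the six surrounding hexes and starts with two Citizens. A worked Monastery yields $2$ Faith, plus $1$ for every two adjacent districts. **Setup.** The map contains an infinite straight strip of grassland tiles with floodplains above and below, unimproved. On the strip the player owns exactly one City, which has at most four Citizens and owns the six surrounding hexes, and the Worker stands on the strip. In addition the player owns Cities at distance at least $4$ from the strip, whose tiles are disjoint from the strip and from the two neighbouring rows and are grassland or floodplains; they hold in total $23$ Monasteries and $23$ Farms, none of which has an adjacent district. Each of these Cities has enough Citizens to work all its Monasteries, and enough other tiles (such as Farms) for all its Citizens to work elsewhere. Let $F_*$ be the constant base Faith yield per turn. **The machine.** Let $Q=\{0n,\dots,23n\}\cup\{0b,\dots,23b\}$ and $\Gamma=\{0=\text{Is Not Being Worked},\ 1=\text{Is Being Worked}\}$, with blank symbol $0$. In both states $kn$ and $kb$ the machine follows the instructions for $q_{k+1}$ in this table of Rogozhin's $(24,2)$-machine (read; write, move, new state): $q_10;0Rq_5$, $q_11;1Rq_2$, $q_20;1Rq_1$, $q_21;1Lq_3$, $q_30;0Lq_4$, $q_31;0Lq_2$, $q_40;1Lq_{12}$, $q_41;0Lq_9$, $q_50;1Rq_1$,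 $q_51;0Lq_6$, $q_60;0Lq_7$, $q_61;1Lq_7$, $q_70;0Lq_8$, $q_71;0Lq_6$, $q_80;0Lq_7$, $q_81;1Rq_2$, $q_90;0Rq_{19}$, $q_91;1Lq_4$, $q_{10}0;1Lq_4$, $q_{10}1;0Rq_{13}$, $q_{11}0;0Lq_4$, $q_{11}1;\text{HALT}$, $q_{12}0;0Rq_{19}$, $q_{12}1;1Lq_{14}$, $q_{13}0;0Rq_{10}$, $q_{13}1;1Rq_{24}$, $q_{14}0;0Lq_{15}$, $q_{14}1;1Lq_{11}$, $q_{15}0;0Rq_{16}$, $q_{15}1;1Rq_{17}$, $q_{16}0;0Rq_{15}$, $q_{16}1;1Rq_{10}$, $q_{17}0;0Rq_{16}$, $q_{17}1;1Rq_{21}$, $q_{18}0;0Rq_{19}$, $q_{18}1;1Rq_{20}$, $q_{19}0;1Lq_3$, $q_{19}1;1Rq_{18}$, $q_{20}0;1Rq_{18}$, $q_{20}1;0Rq_{18}$, $q_{21}0;0Rq_{22}$, $q_{21}1;1Rq_{23}$, $q_{22}0;1Lq_{10}$, $q_{22}1;1Rq_{21}$, $q_{23}0;1Rq_{21}$, $q_{23}1;0Rq_{21}$,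 $q_{24}0;0Rq_{13}$, $q_{24}1;0Lq_3$. The tape is finite, of even length, and is extended on demand. The flag is $n$ exactly when the next instruction moves the head beyond an end of the tape; such an instruction first appends two blank cells there. With flag $b$ the tape is not extended. The start state is $q_1$ (with the flag that the initial tape requires). **Theorem.** This machine is a $(48,2)$-UTM, and, if there are no natural disasters, Civ:VI carries it. Precisely, say that the game *displays* a configuration at the beginning of a turn if the following holds: the Cities on the strip stand in a row with consecutive centers four hexes apart, the first and the last with four Citizens and the others with three; the tape cells are, in order, the two grassland hexes beside each of these Cities, and a cell holds the symbol $1$ exactly if it is being worked; the Worker stands on the scanned cell with its full movement; the Faith yield $F_t$ satisfies $(F_t-F_*)/2=k$, where $kn$ or $kb$ is the state; and the flag is $n$ exactly if the next instruction orders the Worker to a tile that no City owns. Then there is a number $C$ depending only on the growth rule $G$ such that from every setup the following holds. 1. For every configuration of the machine (even tape length, correct flag) the player can reach a state of the game that displays it and in which the state tiles are still as in the setup. 2. Whenever the player has reached a state of the game that displays a configuration, with the state tiles still as in the setup, and the machine moves from this configuration to another one in one step, the player can reach a state of the game that displays the new configuration, again with the state tiles as in the setup. This takes exactly one turn if the flag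 is $b$, and at most $C+S+3$ turns if the flag is $n$, where $S=15L+50+30s$, $L$ is the length of the tape before the step and $s$ is the number of Cities off the strip. So the slowdown is linear in the length of the tape. -/

import Mathlib

/-! ## Turing machines -/

namespace CivVI

/-- Direction of a head move. -/
inductive Dir where
  | left
  | right
  deriving DecidableEq

/-- A deterministic Turing machine: `δ` is a partial function, and the machine halts when it is
undefined (in particular in every final state). -/
structure TM (Q Γ : Type) where
  start : Q
  blank : Γ
  δ : Q → Γ → Option (Q × Γ × Dir)

/-- State, cells to the left of the head (nearest first), scanned cell, cells to the right of the
head (nearest first). -/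
abbrev Config (Q Γ : Type) : Type := Q × List Γ × Γ × List Γ

namespace TM

variable {Q Γ : Type}

/-- One step on the two-way infinite tape: all cells that are not listed are blank. -/
def step (M : TM Q Γ) : Config Q Γ → Option (Config Q Γ)
  | (q, l, a, r) =>
    match M.δ q a with
    | none => none
    | some (q', a', .right) => some (q', a' :: l, r.headD M.blank, r.tail)
    | some (q', a', .left) => some (q', l.tail, l.headD M.blank, a' :: r)

/-- Initial configuration on the word `w`: the head scans the first letter. -/
def init (M : TM Q Γ) (w : List Γ) : Config Q Γ :=
  (M.start, [], w.headD M.blank, w.tail)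

end TM

/-- The direction as a Boolean. -/
def Dir.isRight : Dir → Bool
  | .left => false
  | .right => true

/-- A finite description of a Turing machine: start state, blank symbol, list of quintuples
`(state, read, new state, written, is the move to the right?)`. -/
abbrev Description : Type := ℕ × ℕ × List (ℕ × ℕ × ℕ × ℕ × Bool)

/-- The description of a Turing machine with states `Fin m` and symbols `Fin n`. -/
def TM.describe {m n : ℕ} (M : TM (Fin m) (Fin n)) : Description :=
  (M.start, M.blank,
    (List.finRange m).flatMap fun q => (List.finRange n).filterMap fun a =>
      (M.δ q a).map fun o => ((q : ℕ), (a : ℕ), (o.1 : ℕ), (o.2.1 : ℕ), o.2.2.isRight))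

/-- A configuration written with natural numbers. -/
def Config.toNat {m n : ℕ} : Config (Fin m) (Fin n) → Config ℕ ℕ
  | (q, l, a, r) => (q, l.map Fin.val, a, r.map Fin.val)

/-- `IsUTM m n Q Γ step initial`: the machine with states `Q`, tape symbols `Γ`, transition map
`step` and admissible initial configurations `initial` is an `(m, n)`-universal Turing machine.
It has `m` states and `n` symbols, and it simulates every Turing machine `M`: the description of
`M` and an input `w` are encoded computably in an initial configuration, from which the machine
halts exactly if `M` halts on `w`; then the final configuration of `M` (state, tape contents,
head position) is decoded computably from that of the machine. -/
def IsUTM (m n : ℕ) (Q Γ : Type) [Fintype Q] [Fintype Γ] [Primcodable Q] [Primcodable Γ]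
    (step : Config Q Γ → Option (Config Q Γ)) (initial : Set (Config Q Γ)) : Prop :=
  Fintype.card Q = m ∧ Fintype.card Γ = n ∧
    ∃ (enc : Description × List ℕ → Config Q Γ) (dec : Config Q Γ → Config ℕ ℕ),
      Computable enc ∧ Computable dec ∧
      ∀ (a b : ℕ) (M : TM (Fin a) (Fin b)) (w : List (Fin b)),
        enc (M.describe, w.map Fin.val) ∈ initial ∧
        (StateTransition.eval step (enc (M.describe, w.map Fin.val))).map dec =
          (StateTransition.eval M.step (M.init w)).map Config.toNat

/-! ## Machines on a finite tape that is extended on demand -/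

/-- `n`: a new Settler is needed before the next move; `b`: none is needed. -/
inductive Flag where
  | n
  | b
  deriving DecidableEq

namespace TM

variable {Q Γ : Type}

/-- The flag of a configuration with state `q` on the finite tape `l`, `a`, `r`: it is `n` if the
next instruction moves the head beyond an end of the tape, and `b` otherwise. -/
def flag (M : TM Q Γ) (q : Q) (l : List Γ) (a : Γ) (r : List Γ) : Flag :=
  match M.δ q a with
  | some (_, _, .right) => if r.isEmpty then .n else .b
  | some (_, _, .left) => if l.isEmpty then .n else .b
  | none => .b

/-- Supply the state `q` with its flag. -/
def withFlag (M : TM Q Γ) (q : Q) (l : List Γ) (a : Γ) (r : List Γ) : Config (Q × Flag) Γ :=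
  ((q, M.flag q l a r), l, a, r)

/-- One step of the machine with the flagged states `Q × Flag`. The tape consists of the listed
cells only. Both copies of a state follow the table `M.δ`, but an instruction carried out with
flag `n` first appends two blank cells (one new City) to the tape, at the end at which the head
would leave it. The flag of the new state is the outcome of the test for the end of the tape. -/
def flaggedStep (M : TM Q Γ) : Config (Q × Flag) Γ → Option (Config (Q × Flag) Γ)
  | ((q, x), l, a, r) =>
    match M.δ q a with
    | none => none
    | some (q', a', .right) =>
      match (if x = .n then r ++ [M.blank, M.blank] else r) with
      | [] => none
      | c :: r' => some (M.withFlag q' (a' :: l) c r')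
    | some (q', a', .left) =>
      match (if x = .n then l ++ [M.blank, M.blank] else l) with
      | [] => none
      | c :: l' => some (M.withFlag q' l' c (a' :: r))

/-- Legitimate configurations: the tape fills whole Cities (two cells each), and the flag is
correct. -/
def FlaggedValid (M : TM Q Γ) : Config (Q × Flag) Γ → Prop
  | ((q, x), l, a, r) => Even (l.length + 1 + r.length) ∧ x = M.flag q l a r

/-- Initial configurations: legitimate ones in the start state. -/
def flaggedInitial (M : TM Q Γ) : Set (Config (Q × Flag) Γ) :=
  {κ | M.FlaggedValid κ ∧ κ.1.1 = M.start}

end TM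

/-! ## The machine -/

/-- Tape symbols: a grassland tile is not being worked (`0`) or is being worked (`1`). -/
inductive Symbol where
  | idle
  | worked
  deriving DecidableEq

/-- Flags as Booleans. -/
def Flag.equivBool : Flag ≃ Bool where
  toFun := fun x => match x with | .n => true | .b => false
  invFun := fun x => match x with | true => .n | false => .b
  left_inv := by intro x; cases x <;> rfl
  right_inv := by intro x; cases x <;> rfl

/-- Symbols as Booleans. -/
def Symbol.equivBool : Symbol ≃ Bool where
  toFun := fun x => match x with | .worked => true | .idle => false
  invFun := fun x => match x with | true => .worked | false => .idle
  left_inv := by intro x; cases x <;> rfl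
  right_inv := by intro x; cases x <;> rfl

instance : Fintype Flag := Fintype.ofEquiv Bool Flag.equivBool.symm

instance : Fintype Symbol := Fintype.ofEquiv Bool Symbol.equivBool.symm

instance : Primcodable Flag := Primcodable.ofEquiv Bool Flag.equivBool

instance : Primcodable Symbol := Primcodable.ofEquiv Bool Symbol.equivBool

section Table

open CivVI.Symbol CivVI.Dir

/-- The instruction table; state `k` is the state `q_{k+1}` of Rogozhin's machine. -/
def table (q : Fin 24) (a : Symbol) : Option (Fin 24 × Symbol × Dir) :=
  match q.val, a with
  | 0, idle => some (4, idle, right)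
  | 0, worked => some (1, worked, right)
  | 1, idle => some (0, worked, right)
  | 1, worked => some (2, worked, left)
  | 2, idle => some (3, idle, left)
  | 2, worked => some (1, idle, left)
  | 3, idle => some (11, worked, left)
  | 3, worked => some (8, idle, left)
  | 4, idle => some (0, worked, right)
  | 4, worked => some (5, idle, left)
  | 5, idle => some (6, idle, left)
  | 5, worked => some (6, worked, left)
  | 6, idle => some (7, idle, left)
  | 6, worked => some (5, idle, left)
  | 7, idle => some (6, idle, left)
  | 7, worked => some (1, worked, right)
  | 8, idle => some (18, idle, right)
  | 8, worked => some (3, worked, left)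
  | 9, idle => some (3, worked, left)
  | 9, worked => some (12, idle, right)
  | 10, idle => some (3, idle, left)
  | 10, worked => none
  | 11, idle => some (18, idle, right)
  | 11, worked => some (13, worked, left)
  | 12, idle => some (9, idle, right)
  | 12, worked => some (23, worked, right)
  | 13, idle => some (14, idle, left)
  | 13, worked => some (10, worked, left)
  | 14, idle => some (15, idle, right)
  | 14, worked => some (16, worked, right)
  | 15, idle => some (14, idle, right)
  | 15, worked => some (9, worked, right)
  | 16, idle => some (15, idle, right)
  | 16, worked => some (20, worked, right)
  | 17, idle => some (18, idle, right)
  | 17, worked => some (19, worked, right)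
  | 18, idle => some (2, worked, left)
  | 18, worked => some (17, worked, right)
  | 19, idle => some (17, worked, right)
  | 19, worked => some (17, idle, right)
  | 20, idle => some (21, idle, right)
  | 20, worked => some (22, worked, right)
  | 21, idle => some (9, worked, left)
  | 21, worked => some (20, worked, right)
  | 22, idle => some (20, worked, right)
  | 22, worked => some (20, idle, right)
  | 23, idle => some (12, idle, right)
  | 23, worked => some (2, idle, left)
  | _, _ => none

end Table

/-- The table as a Turing machine with 24 states and 2 symbols. -/
def rogozhin : TM (Fin 24) Symbol where
  start := 0
  blank := .idle
  δ := table

/-- The 48 states `0n, …, 23n, 0b, …, 23b`. -/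
abbrev State : Type := Fin 24 × Flag

/-! ## The game -/

/-- Hexes in axial coordinates `(x, y)`; the tiles with the same `y` form a straight row. The
map is infinite. -/
abbrev Hex : Type := ℤ × ℤ

/-- The six neighbours of a hex. -/
def ring (h : Hex) : List Hex :=
  [(h.1 + 1, h.2), (h.1 - 1, h.2), (h.1, h.2 + 1), (h.1, h.2 - 1),
    (h.1 + 1, h.2 - 1), (h.1 - 1, h.2 + 1)]

/-- Distance on the hexagonal grid. -/
def hexDist (h k : Hex) : ℕ :=
  max (max (h.1 - k.1).natAbs (h.2 - k.2).natAbs) (h.1 + h.2 - (k.1 + k.2)).natAbs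

/-- Terrain; `other` stands for anything that is not flat grassland or flat floodplains, and is
not used for movement. -/
inductive Terrain where
  | grassland
  | floodplains
  | other
  deriving DecidableEq

/-- Food of the bare terrain. -/
def Terrain.food : Terrain → ℕ
  | .grassland => 2
  | .floodplains => 3
  | .other => 0

/-- Tile improvements. -/
inductive Improvement where
  | monastery
  | farm
  deriving DecidableEq

/-- The data that never change: terrain, districts other than City Centers, the stock of Food
`growth p` that a City with `p` Citizens needs for a new Citizen, and the base Faith yield. -/
structure World where
  terrain : Hex → Terrain
  districts : Finset Hex
  growth : ℕ → ℕ
  baseFaith : ℕ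

/-- A City. One of the `pop` Citizens always works the City Center; the others work the owned
tiles in `worked`, one each. `food` and `production` are the stored amounts, `cap` is the size at
which the player stops its growth, `training` says whether it is training a Settler. -/
structure City where
  pop : ℕ
  tiles : List Hex
  worked : Finset Hex
  food : ℕ
  production : ℕ
  cap : ℕ
  training : Bool

/-- A state of the (one-player) game. `city h` is meaningful only if `h ∈ centers`. The Worker and
the Settlers come with the movement points that are left to them in this turn. -/
structure Game where
  turn : ℕ
  centers : Finset Hex
  city : Hex → City
  improvement : Hex → Option Improvement
  worker : Hex
  workerMoves : ℕ
  settlers : Multiset (Hex × ℕ)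

namespace Game

variable (w : World) (g : Game)

/-- Food of a worked tile; a Farm adds one. -/
def tileFood (h : Hex) : ℕ :=
  (w.terrain h).food + if g.improvement h = some .farm then 1 else 0

/-- Faith of a worked tile: two for a Monastery, and one more for every two adjacent districts
(City Centers included). -/
def tileFaith (h : Hex) : ℕ :=
  if g.improvement h = some .monastery then
    2 + ((ring h).filter fun k => k ∈ w.districts ∪ g.centers).length / 2
  else 0

/-- Combined yield of a tile, by which the game places Citizens automatically. -/
def tileYield (h : Hex) : ℕ := g.tileFood w h + g.tileFaith w h

/-- Faith per turn of the player. -/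
def faith : ℕ := w.baseFaith + ∑ c ∈ g.centers, ∑ h ∈ (g.city c).worked, g.tileFaith w h

/-- Food per turn of the City at `c`; its center yields two more than the bare terrain. -/
def cityFood (c : Hex) : ℕ :=
  2 + (w.terrain c).food + ∑ h ∈ (g.city c).worked, g.tileFood w h

/-- Production needed for a Settler: `15 L + 50`, where `L` is twice the number of Cities. -/
def settlerCost : ℕ := 15 * (2 * g.centers.card) + 50

/-- A new Citizen is put to work on an unworked owned tile with the highest yield. -/
def hire (C : City) : Finset Hex :=
  match (C.tiles.filter fun h => h ∉ C.worked).argmax (g.tileYield w) with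
  | some h => insert h C.worked
  | none => C.worked

/-- When a Citizen is lost and none is without a tile, the tile with the lowest yield is
vacated. -/
def layOff (C : City) : Finset Hex :=
  if C.worked.card + 1 < C.pop then C.worked
  else
    match (C.tiles.filter fun h => h ∈ C.worked).argmin (g.tileYield w) with
    | some h => C.worked.erase h
    | none => C.worked

/-- Food and growth of the City at `c` at the end of a turn: every Citizen eats two Food; a City
that cannot feed its Citizens loses one; a City below its cap with enough stored Food gains
one. -/
def feed (c : Hex) : City :=
  let C := g.city c
  let total := C.food + g.cityFood w c
  if total < 2 * C.pop then
    { C with pop := C.pop - 1, food := 0, worked := g.layOff w C }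
  else if C.pop < C.cap ∧ w.growth C.pop ≤ total - 2 * C.pop then
    { C with
      pop := C.pop + 1
      food := total - 2 * C.pop - w.growth C.pop
      worked := g.hire w C }
  else { C with food := min (total - 2 * C.pop) (w.growth C.pop) }

/-- Does the City finish a Settler in this turn? A City makes one Production per turn (that of its
center; grassland, floodplains, Monasteries and Farms give none), and it trains no Settler while
it has only one Citizen. -/
def Finishes (C : City) : Prop :=
  C.training = true ∧ 2 ≤ C.pop ∧ g.settlerCost ≤ C.production + 1

instance (C : City) : Decidable (g.Finishes C) := by
  unfold Finishes; infer_instance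

/-- Production of a City at the end of a turn; a finished Settler costs the City a Citizen. -/
def produce (C : City) : City :=
  if g.Finishes C then
    { C with pop := C.pop - 1, worked := g.layOff w C, production := 0, training := false }
  else if C.training = true ∧ 2 ≤ C.pop then { C with production := C.production + 1 }
  else C

/-- A natural disaster on the tiles in `hit`: improvements there are destroyed, and the Citizens
who work there die. -/
def strike (hit : Finset Hex) : Game :=
  { g with
    improvement := fun h => if h ∈ hit then none else g.improvement h
    city := fun c =>
      { g.city c with
        pop := (g.city c).pop - ((g.city c).worked ∩ hit).card
        worked := (g.city c).worked \ hit } }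

/-- The end of a turn without disasters. -/
def advance : Game :=
  { g with
    turn := g.turn + 1
    city := fun c => if c ∈ g.centers then g.produce w (g.feed w c) else g.city c
    workerMoves := 2
    settlers := (g.settlers.map fun s => (s.1, 2)) +
      (g.centers.filter fun c => g.Finishes (g.feed w c)).val.map fun c => (c, 2) }

/-- The end of a turn in which a disaster strikes the tiles in `hit`. -/
def endTurn (hit : Finset Hex) : Game := (g.strike hit).advance w

/-- Replace the City at `c`. -/
def setCity (c : Hex) (C : City) : Game := { g with city := Function.update g.city c C }

/-- No City owns the tile. -/
def Unowned (h : Hex) : Prop := ∀ c ∈ g.centers, h ∉ (g.city c).tiles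

instance (h : Hex) : Decidable (g.Unowned h) := by
  unfold Unowned; infer_instance

/-- A City founded at `h`: it owns the surrounding hexes (unless another City does) and has two
Citizens, one in the center and one on the best tile. The player chooses the cap. -/
def newCity (h : Hex) (cap : ℕ) : City :=
  let C : City :=
    { pop := 2, tiles := (ring h).filter fun k => g.Unowned k, worked := ∅, food := 0,
      production := 0, cap := cap, training := false }
  { C with worked := g.hire w C }

/-- Land on which units move and Cities are founded. -/
def Passable (h : Hex) : Prop := w.terrain h ≠ .other

/-- The single actions of the player within a turn. -/
inductive Act (w : World) : Game → Game → Prop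
  /-- Put the Citizens of a City, except the one in the center, to work on owned tiles. -/
  | assign (g : Game) (c : Hex) (W : Finset Hex) (hc : c ∈ g.centers)
      (hW : ∀ h ∈ W, h ∈ (g.city c).tiles) (hcard : W.card + 1 = (g.city c).pop) :
      Act w g (g.setCity c { g.city c with worked := W })
  /-- Choose the size at which the growth of a City stops. -/
  | setCap (g : Game) (c : Hex) (k : ℕ) (hc : c ∈ g.centers) :
      Act w g (g.setCity c { g.city c with cap := k })
  /-- Let a City train a Settler, or stop doing so. -/
  | train (g : Game) (c : Hex) (b : Bool) (hc : c ∈ g.centers) :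
      Act w g (g.setCity c { g.city c with training := b })
  /-- Move the Worker to an adjacent hex. -/
  | moveWorker (g : Game) (h : Hex) (k : ℕ) (hk : g.workerMoves = k + 1)
      (hadj : h ∈ ring g.worker) (hh : Passable w h) :
      Act w g { g with worker := h, workerMoves := k }
  /-- Move a Settler to an adjacent hex. -/
  | moveSettler (g : Game) (h h' : Hex) (k : ℕ) (s : Multiset (Hex × ℕ))
      (hs : g.settlers = (h, k + 1) ::ₘ s) (hadj : h' ∈ ring h) (hh : Passable w h') :
      Act w g { g with settlers := (h', k) ::ₘ s }
  /-- Found a City at least four hexes away from every other City; the Settler is consumed, and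
  must have movement points left. -/
  | found (g : Game) (h : Hex) (k cap : ℕ) (s : Multiset (Hex × ℕ))
      (hs : g.settlers = (h, k + 1) ::ₘ s) (hh : Passable w h)
      (hfar : ∀ c ∈ g.centers, 4 ≤ hexDist c h) :
      Act w g { g with
        centers := insert h g.centers
        city := Function.update g.city h (g.newCity w h cap)
        settlers := s }

/-- `Play w disasters g t g'`: from `g`, the player can bring the game to `g'` with exactly `t`
ends of turns, if in turn `i` disasters strike the tiles in `disasters i`. -/
inductive Play (w : World) (disasters : ℕ → Finset Hex) : Game → ℕ → Game → Prop
  | refl (g : Game) : Play w disasters g 0 g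
  | act {g g' g'' : Game} {t : ℕ} : Act w g g' → Play w disasters g' t g'' →
      Play w disasters g t g''
  | turn {g g'' : Game} {t : ℕ} : Play w disasters (g.endTurn w (disasters g.turn)) t g'' →
      Play w disasters g (t + 1) g''

/-! ### The setup -/

/-- An infinite strip of grassland (the row `y = 0`) with floodplains above and below. -/
def _root_.CivVI.World.HasStrip (w : World) : Prop :=
  ∀ x : ℤ, w.terrain (x, 0) = .grassland ∧
    w.terrain (x, 1) = .floodplains ∧ w.terrain (x, -1) = .floodplains

/-- The Cities off the strip. -/
def stateCities : Finset Hex := g.centers.filter fun c => c.2 ≠ 0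

/-- Number of tiles of the City at `c` with the given improvement. -/
def count (i : Improvement) (c : Hex) : ℕ :=
  ((g.city c).tiles.filter fun h => g.improvement h = some i).length

/-- Every Citizen has a place: one in the center, the others on distinct owned tiles. -/
def Staffed (c : Hex) : Prop :=
  (∀ h ∈ (g.city c).worked, h ∈ (g.city c).tiles) ∧ (g.city c).worked.card + 1 = (g.city c).pop

/-- The section of the map that holds the state of the machine. -/
structure HasStateTiles : Prop where
  /-- The Cities there are no obstacle to Cities on the strip. -/
  far : ∀ c ∈ g.stateCities, ∀ x : ℤ, 4 ≤ hexDist c (x, 0)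
  /-- Their tiles are disjoint from the strip and the floodplains next to it, and fertile. -/
  off : ∀ c ∈ g.stateCities, ∀ h ∈ (g.city c).tiles, 2 ≤ |h.2| ∧ w.terrain h ≠ .other
  nodup : ∀ c ∈ g.stateCities, (g.city c).tiles.Nodup
  disjoint : ∀ c ∈ g.stateCities, ∀ d ∈ g.stateCities, c ≠ d →
    (g.city c).tiles.Disjoint (g.city d).tiles
  monasteries : ∑ c ∈ g.stateCities, g.count .monastery c = 23
  farms : ∑ c ∈ g.stateCities, g.count .farm c = 23
  /-- No Monastery or Farm has an adjacent district. -/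
  noDistrict : ∀ c ∈ g.stateCities, ∀ h ∈ (g.city c).tiles, g.improvement h ≠ none →
    ∀ k ∈ ring h, k ∉ w.districts ∧ k ∉ g.centers
  staffed : ∀ c ∈ g.stateCities, g.Staffed c
  /-- There are enough Citizens to work all Monasteries, and enough other tiles for all these
  Citizens to work elsewhere. -/
  citizens : ∀ c ∈ g.stateCities, g.count .monastery c + 1 ≤ (g.city c).pop ∧
    (g.city c).pop - 1 + g.count .monastery c ≤ (g.city c).tiles.length
  /-- The strip and the floodplains next to it are unimproved. -/
  bare : ∀ h : Hex, |h.2| ≤ 1 → g.improvement h = none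

/-- The situation from which the player starts: the state tiles are there, and on the strip there
are the Worker and one City, with at most four Citizens and the six surrounding hexes. -/
structure Setup : Prop where
  stateTiles : g.HasStateTiles w
  oneCity : ∀ h : Hex, h.2 = 0 → (h ∈ g.centers ↔ h = (0, 0))
  tiles : (g.city (0, 0)).tiles = ring (0, 0)
  pop : (g.city (0, 0)).pop ≤ 4
  staffed : g.Staffed (0, 0)
  worker : g.worker.2 = 0

/-! ### Reading the machine off the game -/

/-- The places of the Cities on the strip. -/
def cityHex (i : ℤ) : Hex := (4 * i, 0)

/-- The tape cells: the cells `2 * i` and `2 * i + 1` are the grassland hexes to the left and to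
the right of `cityHex i`. -/
def cellHex (j : ℤ) : Hex := (2 * j - 1, 0)

/-- The cell next to the hex `h` on the strip. -/
def nextCell (h : Hex) : Dir → Hex
  | .left => (h.1 - 2, h.2)
  | .right => (h.1 + 2, h.2)

/-- In state `q`, reading `a`, the Worker is ordered to a cell that no City owns. -/
def NeedsSettler (q : Fin 24) (a : Symbol) : Prop :=
  ∃ q' a' d, table q a = some (q', a', d) ∧ g.Unowned (nextCell g.worker d)

/-- The game displays the configuration `κ` of the machine, at the beginning of a turn. The tape
cells are the grassland hexes beside the `n` consecutive Cities on the strip, of which the first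
and the last have four Citizens and the others three; a cell holds the symbol `worked` if a
Citizen works it; the Worker stands on the scanned cell; the Faith yield exceeds the base yield by
twice (the yield of a Monastery) the number of the state; the flag tells whether a new Settler is
needed. -/
def Displays : Config State Symbol → Prop
  | ((q, x), l, a, r) =>
    ∃ (lo : ℤ) (n : ℕ), (l.reverse ++ a :: r).length = 2 * n ∧
      (∀ h : Hex, h.2 = 0 → (h ∈ g.centers ↔ ∃ i : ℕ, i < n ∧ h = cityHex (lo + i))) ∧
      (∀ i : ℕ, i < n →
        (g.city (cityHex (lo + i))).tiles = ring (cityHex (lo + i)) ∧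
        (g.city (cityHex (lo + i))).pop = (if i = 0 ∨ i + 1 = n then 4 else 3) ∧
        g.Staffed (cityHex (lo + i))) ∧
      (∀ (j : ℕ) (s : Symbol), (l.reverse ++ a :: r)[j]? = some s →
        (s = .worked ↔
          cellHex (2 * lo + j) ∈ (g.city (cityHex (lo + (j / 2 : ℕ)))).worked)) ∧
      g.worker = cellHex (2 * lo + l.length) ∧ g.workerMoves = 2 ∧
      g.faith w = w.baseFaith + 2 * (q : ℕ) ∧
      (x = .n ↔ g.NeedsSettler q a)

end Game

/-- Length of the tape. -/
def tapeLength {Q Γ : Type} : Config Q Γ → ℕ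
  | (_, l, _, r) => l.length + 1 + r.length

end CivVI

/-! The theorem has two independent halves: universality of the flagged machine, and the game as a
device that executes it.

Universality goes through a chain of simulations, each an instance of `Simulates`, which transports
halting in both directions and relates the final configurations. The interpreter for descriptions of
Turing machines is partial recursive. Mathlib turns a partial recursive function into a one-tape
machine. Its two half-tapes are numbers to a base that is a power of two, so that a head move is a
push (multiply and add) on one number and a pop (repeated halving, with a branch on the parity) on
the other. A 2-tag system runs such a machine with two numbers: `M` and `N` are lengths of blocks in
the word, every letter is written twice so that one pass reads every place once, and a block is
halved by writing its letters only once. The parity of the length then decides whether the next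
passes read the letters at even or at odd places, and this is the branch
(`NumberMachine.transGen_tagStep`).

Rogozhin's machine runs any such tag system (`wordConfig_step`). The program lies to the left of the
head, the word to the right, in cells of two symbols. The unary code of the first letter says how
many markers of the program to pass. The units of the code mark these markers one by one, which
brings the machine to the right production. This is copied to the far end of the word, and then the
auxiliary marks are cleared. The halting letter leads past all productions to the two ones at the
left end, where the machine stops. The number of separators that remain on the tape determines the
output. Finally, a finite tape that grows by two blank cells when the head would leave it represents
the infinite tape up to blanks (`TM.simulates_flaggedStep`).

For the game, the invariant is `Strip`: consecutive Cities on the strip with all their tiles, and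
intact state tiles. Yields are high enough that no City starves, so with growth capped and training
off only stocks of Food change when a turn ends. A City on the strip with three or four Citizens can
show any two symbols, since its four floodplains absorb the Citizens that are not needed, and the
Monasteries can show any number up to 23. Assignments take no time and the next cell is two hexes
away, so an instruction within the tape takes one turn (`Strip.exists_displays_of_step`).

If the head would leave the tape, the City at that end trains a Settler, falls from four Citizens to
three and becomes an inner City; the Settler walks four hexes and the new City grows to four
(`Strip.exists_extension`). The time is the price of the Settler, linear in the number of Cities,
plus a constant for the walk and the growth. -/

open StateTransition Relation

namespace CivVI

/-! ## Simulations between transition systems -/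

/-- `Simulates f₁ f₂ tr fin`: every step of `f₁` is matched, along the relation `tr`, by at least
one step of `f₂`, and when `f₁` halts, so does `f₂`, in a configuration related by `fin`. -/
def Simulates {α β : Type*} (f₁ : α → Option α) (f₂ : β → Option β)
    (tr fin : α → β → Prop) : Prop :=
  ∀ a₁ a₂, tr a₁ a₂ →
    (∀ b₁, f₁ a₁ = some b₁ → ∃ b₂, tr b₁ b₂ ∧ Reaches₁ f₂ a₂ b₂) ∧
    (f₁ a₁ = none → ∃ b₂, fin a₁ b₂ ∧ b₂ ∈ eval f₂ a₂)

namespace Simulates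

variable {α β : Type*} {f₁ : α → Option α} {f₂ : β → Option β} {tr fin : α → β → Prop}

theorem exists_mem_eval (H : Simulates f₁ f₂ tr fin) {a₁ : α} {a₂ : β} (h : tr a₁ a₂) {b₁ : α}
    (hb : b₁ ∈ eval f₁ a₁) : ∃ b₂, fin b₁ b₂ ∧ b₂ ∈ eval f₂ a₂ := by
  obtain ⟨hr, hn⟩ := mem_eval.1 hb
  clear hb
  induction hr using ReflTransGen.head_induction_on generalizing a₂ with
  | refl => exact (H _ _ h).2 hn
  | head hac _ ih =>
    obtain ⟨c₂, hc, hr⟩ := (H _ _ h).1 _ hac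
    obtain ⟨b₂, hf, hb⟩ := ih hc
    exact ⟨b₂, hf, by rwa [reaches_eval hr.to_reflTransGen]⟩

/-- Every step of `f₁` costs at least one step of `f₂`, so an infinite run of `f₁` would give one of
`f₂`. The induction runs along the terminating run of `f₂`; as only some of its points are related
to a configuration of `f₁`, the claim is about the related points that lie ahead. -/
theorem dom_of_dom (H : Simulates f₁ f₂ tr fin) {a₁ : α} {a₂ : β} (h : tr a₁ a₂)
    (hd : (eval f₂ a₂).Dom) : (eval f₁ a₁).Dom := by
  have key : ∀ b, b ∈ eval f₂ a₂ → ∀ a₁ a', tr a₁ a' → Reaches f₂ a₂ a' → (eval f₁ a₁).Dom := by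
    intro b hb
    refine evalInduction (C := fun a => ∀ a₁ a', tr a₁ a' → Reaches f₂ a a' → (eval f₁ a₁).Dom)
      hb ?_
    intro a _ ih a₁ a' ht hr
    rcases ReflTransGen.cases_head hr with rfl | ⟨c, hac, hc⟩
    · cases hf : f₁ a₁ with
      | none => exact Part.dom_iff_mem.2 ⟨a₁, mem_eval.2 ⟨ReflTransGen.refl, hf⟩⟩
      | some b₁ =>
        obtain ⟨b₂, hb₂, hr₂⟩ := (H _ _ ht).1 _ hf
        obtain ⟨c, hac, hc⟩ := TransGen.head'_iff.1 hr₂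
        have := ih c hac b₁ b₂ hb₂ hc
        rwa [reaches_eval (ReflTransGen.single hf)]
    · exact ih c hac a₁ a' ht hc
  obtain ⟨b, hb⟩ := Part.dom_iff_mem.1 hd
  exact key b hb a₁ a₂ h ReflTransGen.refl

theorem dom_iff (H : Simulates f₁ f₂ tr fin) {a₁ : α} {a₂ : β} (h : tr a₁ a₂) :
    (eval f₂ a₂).Dom ↔ (eval f₁ a₁).Dom := by
  refine ⟨H.dom_of_dom h, fun hd => ?_⟩
  obtain ⟨b, hb⟩ := Part.dom_iff_mem.1 hd
  obtain ⟨b₂, _, hb₂⟩ := H.exists_mem_eval h hb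
  exact Part.dom_iff_mem.2 ⟨b₂, hb₂⟩

end Simulates

/-! ## The infinite tape and the finite tape that is extended on demand -/

namespace TM

variable {Q Γ : Type}

/-- A configuration on the finite tape represents one on the infinite tape: it may list more blank
cells. -/
def FlaggedRel (M : TM Q Γ) (κ : Config Q Γ) (κ' : Config (Q × Flag) Γ) : Prop :=
  ∃ i j, κ' = M.withFlag κ.1 (κ.2.1 ++ List.replicate i M.blank) κ.2.2.1
      (κ.2.2.2 ++ List.replicate j M.blank)

theorem flaggedStep_right (M : TM Q Γ) {q q' : Q} {a a' c : Γ} {x : Flag} {l r r' : List Γ}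
    (hδ : M.δ q a = some (q', a', .right))
    (h : (if x = .n then r ++ [M.blank, M.blank] else r) = c :: r') :
    M.flaggedStep ((q, x), l, a, r) = some (M.withFlag q' (a' :: l) c r') := by
  simp only [flaggedStep, hδ]
  rw [h]

theorem flaggedStep_left (M : TM Q Γ) {q q' : Q} {a a' c : Γ} {x : Flag} {l r l' : List Γ}
    (hδ : M.δ q a = some (q', a', .left))
    (h : (if x = .n then l ++ [M.blank, M.blank] else l) = c :: l') :
    M.flaggedStep ((q, x), l, a, r) = some (M.withFlag q' l' c (a' :: r)) := by
  simp only [flaggedStep, hδ]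
  rw [h]

/-- The finite tape may list superfluous blanks at both ends, which reading off the end of a list
cannot distinguish from missing cells. Only the numbers of these blanks change. -/
theorem simulates_flaggedStep (M : TM Q Γ) :
    Simulates M.step M.flaggedStep M.FlaggedRel M.FlaggedRel := by
  have tail_aux : ∀ (r : List Γ) (j : ℕ) (c : Γ) (r' : List Γ),
      r ++ List.replicate j M.blank = c :: r' →
      c = r.headD M.blank ∧ ∃ j', r' = r.tail ++ List.replicate j' M.blank := by
    intro r j c r' h
    cases r with
    | nil =>
      cases j with
      | zero => simp at h
      | succ j =>
        simp [List.replicate_succ] at h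
        exact ⟨h.1.symm, j, by simp [h.2]⟩
    | cons x r =>
      simp at h
      exact ⟨h.1.symm, j, by simp [h.2]⟩
  rintro ⟨q, l, a, r⟩ κ' ⟨i, j, rfl⟩
  cases hδ : M.δ q a with
  | none =>
    refine ⟨fun b hb => by simp [step, hδ] at hb, fun _ => ?_⟩
    refine ⟨_, ⟨i, j, rfl⟩, mem_eval.2 ⟨ReflTransGen.refl, ?_⟩⟩
    simp [withFlag, flaggedStep, hδ]
  | some o =>
    obtain ⟨q', a', d⟩ := o
    refine ⟨fun b hb => ?_, fun h => by cases d <;> simp [step, hδ] at h⟩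
    cases d with
    | right =>
      simp only [step, hδ, Option.some.injEq] at hb
      subst hb
      obtain ⟨k, hk, hne⟩ : ∃ k, (if M.flag q (l ++ List.replicate i M.blank) a
          (r ++ List.replicate j M.blank) = .n then
            (r ++ List.replicate j M.blank) ++ [M.blank, M.blank]
          else r ++ List.replicate j M.blank) = r ++ List.replicate k M.blank ∧
          r ++ List.replicate k M.blank ≠ [] := by
        by_cases he : (r ++ List.replicate j M.blank).isEmpty
        -- Nothing is left in the direction of the move: the flag is `n`, and two blanks are
        -- appended.
        · refine ⟨j + 2, ?_, by simp⟩
          simp only [flag, hδ, he, if_true]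
          rw [List.replicate_add, List.append_assoc]; rfl
        · refine ⟨j, ?_, by simpa using he⟩
          simp [flag, hδ, he]
      obtain ⟨c, r', hc⟩ := List.exists_cons_of_ne_nil hne
      obtain ⟨rfl, j'', rfl⟩ := tail_aux _ _ _ _ hc
      refine ⟨_, ⟨i, j'', rfl⟩, TransGen.single ?_⟩
      exact M.flaggedStep_right hδ (hk.trans hc)
    | left =>
      simp only [step, hδ, Option.some.injEq] at hb
      subst hb
      obtain ⟨k, hk, hne⟩ : ∃ k, (if M.flag q (l ++ List.replicate i M.blank) a
          (r ++ List.replicate j M.blank) = .n then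
            (l ++ List.replicate i M.blank) ++ [M.blank, M.blank]
          else l ++ List.replicate i M.blank) = l ++ List.replicate k M.blank ∧
          l ++ List.replicate k M.blank ≠ [] := by
        by_cases he : (l ++ List.replicate i M.blank).isEmpty
        · refine ⟨i + 2, ?_, by simp⟩
          simp only [flag, hδ, he, if_true]
          rw [List.replicate_add, List.append_assoc]; rfl
        · refine ⟨i, ?_, by simpa using he⟩
          simp [flag, hδ, he]
      obtain ⟨c, l', hc⟩ := List.exists_cons_of_ne_nil hne
      obtain ⟨rfl, i'', rfl⟩ := tail_aux _ _ _ _ hc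
      refine ⟨_, ⟨i'', j, rfl⟩, TransGen.single ?_⟩
      exact M.flaggedStep_left hδ (hk.trans hc)

end TM

end CivVI

namespace CivVI

/-! ## Sweeps of Rogozhin's machine

The machine works on cells that consist of two adjacent symbols. -/

namespace Rogozhin

open CivVI.Symbol

/-- Two adjacent symbols of the tape. -/
abbrev Cell : Type := Symbol × Symbol

/-- The symbols of cells to the right of the head, nearest first. -/
def rightOf (V : List Cell) : List Symbol := V.flatMap fun c => [c.1, c.2]

/-- The symbols of cells to the left of the head, nearest first. -/
def leftOf (V : List Cell) : List Symbol := V.flatMap fun c => [c.2, c.1]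

@[simp] theorem rightOf_nil : rightOf [] = [] := rfl
@[simp] theorem leftOf_nil : leftOf [] = [] := rfl
@[simp] theorem rightOf_cons (c : Cell) (V : List Cell) :
    rightOf (c :: V) = c.1 :: c.2 :: rightOf V := rfl
@[simp] theorem leftOf_cons (c : Cell) (V : List Cell) :
    leftOf (c :: V) = c.2 :: c.1 :: leftOf V := rfl
@[simp] theorem rightOf_append (V W : List Cell) : rightOf (V ++ W) = rightOf V ++ rightOf W := by
  simp [rightOf]
@[simp] theorem leftOf_append (V W : List Cell) : leftOf (V ++ W) = leftOf V ++ leftOf W := by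
  simp [leftOf]

/-- The head scans the first symbol of `R`. -/
def headRight (q : Fin 24) (L R : List Symbol) : Config (Fin 24) Symbol :=
  (q, L, R.headD idle, R.tail)

/-- The head scans the first symbol of `L`. -/
def headLeft (q : Fin 24) (L R : List Symbol) : Config (Fin 24) Symbol :=
  (q, L.tail, L.headD idle, R)

/-- `n` steps of the machine. -/
def run : ℕ → Config (Fin 24) Symbol → Option (Config (Fin 24) Symbol)
  | 0, c => some c
  | n + 1, c => (rogozhin.step c).bind (run n)

theorem reaches₁_of_run (n : ℕ) {c d : Config (Fin 24) Symbol} (h : run (n + 1) c = some d) :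
    Reaches₁ rogozhin.step c d := by
  induction n generalizing c with
  | zero =>
    obtain ⟨e, he, hd⟩ := Option.bind_eq_some_iff.1 h
    cases hd
    exact TransGen.single he
  | succ n ih =>
    obtain ⟨e, he, hd⟩ := Option.bind_eq_some_iff.1 h
    exact TransGen.head he (ih hd)

theorem reaches_of_run (n : ℕ) {c d : Config (Fin 24) Symbol} (h : run (n + 1) c = some d) :
    Reaches rogozhin.step c d :=
  (reaches₁_of_run n h).to_reflTransGen

/-- Mark a cell. -/
def mark (c : Cell) : Cell := (c.1, worked)

/-- Clear the mark of a cell. -/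
def clear (c : Cell) : Cell := (c.1, idle)

/-- The effect of a sweep during the copying stage. -/
def toggle : Cell → Cell
  | (idle, s) => (idle, s)
  | (worked, idle) => (worked, worked)
  | (worked, worked) => (worked, idle)

@[simp] theorem toggle_toggle (c : Cell) : toggle (toggle c) = c := by
  rcases c with ⟨_ | _, _ | _⟩ <;> rfl

/-- This sweep looks for the nearest unmarked marker `(worked, idle)` of the program, which is why
that cell is excluded. The marks erased on the way are put back by `sweep_mark_right`. -/
theorem sweep_clear_left (V : List Cell) (hV : ∀ c ∈ V, c ≠ (worked, idle)) (L R : List Symbol) :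
    Reaches rogozhin.step (headLeft 6 (leftOf V ++ L) R)
      (headLeft 6 L (rightOf (V.map clear).reverse ++ R)) := by
  induction V generalizing R with
  | nil => exact ReflTransGen.refl
  | cons c V ih =>
    have h := ih (fun d hd => hV d (List.mem_cons_of_mem _ hd)) (c.1 :: idle :: R)
    simp only [List.map_cons, List.reverse_cons, rightOf_append, List.append_assoc]
    refine ReflTransGen.trans ?_ h
    rcases c with ⟨_ | _, _ | _⟩
    · exact reaches_of_run 1 rfl
    · exact reaches_of_run 1 rfl
    · exact absurd rfl (hV _ List.mem_cons_self)
    · exact reaches_of_run 1 rfl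

theorem sweep_mark_right (V : List Cell) (hV : ∀ c ∈ V, c.2 = idle) (L R : List Symbol) :
    Reaches rogozhin.step (headRight 0 L (rightOf V ++ R))
      (headRight 0 (leftOf (V.map mark).reverse ++ L) R) := by
  induction V generalizing L with
  | nil => exact ReflTransGen.refl
  | cons c V ih =>
    have h := ih (fun d hd => hV d (List.mem_cons_of_mem _ hd)) (worked :: c.1 :: L)
    simp only [List.map_cons, List.reverse_cons, leftOf_append, List.append_assoc]
    refine ReflTransGen.trans ?_ h
    have := hV c List.mem_cons_self
    rcases c with ⟨_ | _, _ | _⟩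
    · exact reaches_of_run 1 rfl
    · exact absurd this (by simp)
    · exact reaches_of_run 1 rfl
    · exact absurd this (by simp)

/-- This sweep ends at the first blank cell `(idle, idle)`, the end of the word. It coincides with
the next one except for the state, which remembers what to append: a unit here, a separator in state
`20`. -/
theorem sweep_toggle_right₁ (V : List Cell) (hV : ∀ c ∈ V, c ≠ (idle, idle))
    (L R : List Symbol) :
    Reaches rogozhin.step (headRight 17 L (rightOf V ++ R))
      (headRight 17 (leftOf (V.map toggle).reverse ++ L) R) := by
  induction V generalizing L with
  | nil => exact ReflTransGen.refl
  | cons c V ih =>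
    have h := ih (fun d hd => hV d (List.mem_cons_of_mem _ hd)) ((toggle c).2 :: c.1 :: L)
    simp only [List.map_cons, List.reverse_cons, leftOf_append, List.append_assoc]
    rcases c with ⟨_ | _, _ | _⟩
    · exact absurd rfl (hV _ List.mem_cons_self)
    all_goals exact ReflTransGen.trans (reaches_of_run 1 rfl) h

theorem sweep_toggle_right₂ (V : List Cell) (hV : ∀ c ∈ V, c ≠ (idle, idle))
    (L R : List Symbol) :
    Reaches rogozhin.step (headRight 20 L (rightOf V ++ R))
      (headRight 20 (leftOf (V.map toggle).reverse ++ L) R) := by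
  induction V generalizing L with
  | nil => exact ReflTransGen.refl
  | cons c V ih =>
    have h := ih (fun d hd => hV d (List.mem_cons_of_mem _ hd)) ((toggle c).2 :: c.1 :: L)
    simp only [List.map_cons, List.reverse_cons, leftOf_append, List.append_assoc]
    rcases c with ⟨_ | _, _ | _⟩
    · exact absurd rfl (hV _ List.mem_cons_self)
    all_goals exact ReflTransGen.trans (reaches_of_run 1 rfl) h

theorem sweep_clear_right (V : List Cell)
    (hV : ∀ c ∈ V, c = (idle, worked) ∨ c = (worked, idle)) (L R : List Symbol) :
    Reaches rogozhin.step (headRight 12 L (rightOf V ++ R))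
      (headRight 12 (leftOf (V.map clear).reverse ++ L) R) := by
  induction V generalizing L with
  | nil => exact ReflTransGen.refl
  | cons c V ih =>
    have h := ih (fun d hd => hV d (List.mem_cons_of_mem _ hd)) (idle :: c.1 :: L)
    simp only [List.map_cons, List.reverse_cons, leftOf_append, List.append_assoc]
    rcases hV c List.mem_cons_self with rfl | rfl
    all_goals exact ReflTransGen.trans (reaches_of_run 1 rfl) h

/-- The cells (nearest first) over which the head passes to the left in the copying stage. -/
inductive LeftSweepable : List Cell → Prop
  | nil : LeftSweepable []
  | marked (b : Symbol) {V : List Cell} : LeftSweepable V → LeftSweepable ((b, worked) :: V)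
  | toggled {V : List Cell} :
      LeftSweepable V → LeftSweepable ((worked, idle) :: (idle, worked) :: V)

theorem LeftSweepable.append {V W : List Cell} (hV : LeftSweepable V) (hW : LeftSweepable W) :
    LeftSweepable (V ++ W) := by
  induction hV with
  | nil => exact hW
  | marked b _ ih => exact .marked b ih
  | toggled _ ih => exact .toggled ih

theorem leftSweepable_map_mark (V : List Cell) : LeftSweepable (V.map mark) := by
  induction V with
  | nil => exact .nil
  | cons c V ih => exact .marked c.1 ih

/-- A toggled separator looks like a marker of the program, `(worked, idle)`; the next cell to the
left tells what it is. A unit `(idle, worked)` there means a separator, and the sweep goes on;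
`(idle, idle)` means a letter to be copied (`copy_marker`), a second marker the end of the
production (`end_copy`), and `(worked, worked)` the halt (`halt_copy`). -/
theorem sweep_toggle_left {V : List Cell} (hV : LeftSweepable V) (L R : List Symbol) :
    Reaches rogozhin.step (headLeft 3 (leftOf V ++ L) R)
      (headLeft 3 L (rightOf (V.map toggle).reverse ++ R)) := by
  induction hV generalizing R with
  | nil => exact ReflTransGen.refl
  | @marked b V _ ih =>
    have h := ih (b :: (toggle (b, worked)).2 :: R)
    simp only [List.map_cons, List.reverse_cons, rightOf_append, List.append_assoc]
    cases b
    · exact ReflTransGen.trans (reaches_of_run 3 rfl) h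
    · exact ReflTransGen.trans (reaches_of_run 1 rfl) h
  | @toggled V _ ih =>
    have h := ih (idle :: worked :: worked :: worked :: R)
    simp only [List.map_cons, List.reverse_cons, rightOf_append, List.append_assoc]
    exact ReflTransGen.trans (reaches_of_run 3 rfl) h

/-! ### The counting stage -/

/-- One unit of a code marks one more marker of the program. -/
theorem count_one (V : List Cell) (hV : ∀ c ∈ V, c ≠ (worked, idle)) (L R : List Symbol) :
    Reaches₁ rogozhin.step (headRight 0 (leftOf V ++ idle :: worked :: L) (idle :: worked :: R))
      (headRight 0 (leftOf ((idle, worked) :: V.map mark) ++ worked :: worked :: L) R) := by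
  have h₁ := sweep_clear_left V hV (idle :: worked :: L) (idle :: idle :: R)
  have h₂ := sweep_mark_right ((V.map clear).reverse ++ [(idle, idle)]) (by
    intro c hc
    simp only [List.mem_append, List.mem_reverse, List.mem_map, List.mem_singleton] at hc
    rcases hc with ⟨d, _, rfl⟩ | rfl <;> rfl) (worked :: worked :: L) R
  refine TransGen.trans_left (reaches₁_of_run 2 rfl) (h₁.trans ?_)
  have e : (List.map mark ((V.map clear).reverse ++ [(idle, idle)])).reverse
      = (idle, worked) :: V.map mark := by
    simp [List.map_reverse, mark, clear, Function.comp_def]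
  rw [e] at h₂
  rw [rightOf_append, List.append_assoc] at h₂
  refine ReflTransGen.trans (reaches_of_run 2 ?_) h₂
  rfl

/-- The program cells that belong to a list of numbers: each number in unary, followed by a
marker. -/
def segments (ks : List ℕ) : List Cell :=
  ks.flatMap fun k => List.replicate k (idle, idle) ++ [(worked, idle)]

@[simp] theorem segments_nil : segments [] = [] := rfl

@[simp] theorem segments_cons (k : ℕ) (ks : List ℕ) : segments (k :: ks) =
    List.replicate k (idle, idle) ++ (worked, idle) :: segments ks := by
  simp [segments]

@[simp] theorem segments_append (ks ls : List ℕ) :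
    segments (ks ++ ls) = segments ks ++ segments ls := by
  simp [segments]

/-- Each unit marks one marker, so as many units as there are numbers in `ks` mark exactly the
markers of `ks`. A round also marks all cells that it passes; the alternative in `h` covers the case
of no round at all. -/
theorem count_all (ks : List ℕ) (V : List Cell) (hV : ∀ c ∈ V, c ≠ (worked, idle))
    (h : ks ≠ [] ∨ V.map mark = V) (L R : List Symbol) :
    Reaches rogozhin.step
      (headRight 0 (leftOf (V ++ segments ks) ++ L)
        (rightOf (List.replicate ks.length (idle, worked)) ++ R))
      (headRight 0 (leftOf (List.replicate ks.length (idle, worked) ++ V.map mark ++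
        (segments ks).map mark) ++ L) R) := by
  induction ks generalizing V with
  | nil =>
    have hV : V.map mark = V := by simpa using h
    simp only [hV, segments_nil, List.append_nil, List.length_nil, List.replicate_zero,
      rightOf_nil, List.nil_append, List.map_nil]
    exact ReflTransGen.refl
  | cons k ks ih =>
    have h₁ := count_one (V ++ List.replicate k (idle, idle)) (by
      intro c hc
      rcases List.mem_append.1 hc with hc | hc
      · exact hV c hc
      · rw [List.eq_of_mem_replicate hc]; simp)
      (leftOf (segments ks) ++ L)
      (rightOf (List.replicate ks.length (idle, worked)) ++ R)
    have hmark : ∀ V : List Cell, (V.map mark).map mark = V.map mark := by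
      intro V; simp [mark, Function.comp_def]
    have h₂ := ih (((idle, worked) :: (V ++ List.replicate k (idle, idle)).map mark) ++
      [(worked, worked)]) (by
        intro c hc
        simp only [List.mem_append, List.mem_cons, List.mem_map, List.not_mem_nil, or_false] at hc
        rcases hc with (rfl | ⟨d, _, rfl⟩) | rfl <;> simp [mark]) (Or.inr (by
        rw [List.map_append, List.map_cons, hmark]; rfl))
    refine ReflTransGen.trans ?_ (ReflTransGen.trans h₁.to_reflTransGen
      (ReflTransGen.trans ?_ (ReflTransGen.trans h₂ ?_)))
    · simp only [segments_cons, leftOf_append, leftOf_cons, List.append_assoc, List.length_cons,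
        List.replicate_succ, rightOf_cons, List.cons_append]
      exact ReflTransGen.refl
    · simp only [leftOf_append, leftOf_cons, List.append_assoc, List.cons_append,
        List.nil_append]
      exact ReflTransGen.refl
    · rw [List.map_append, List.map_cons, hmark]
      have e : ∀ (n : ℕ) (X : List Cell), List.replicate n (idle, worked) ++ (idle, worked) :: X
          = List.replicate (n + 1) (idle, worked) ++ X := by
        intro n X
        rw [List.replicate_succ']; simp
      simp only [segments_cons, List.map_append, List.map_cons, List.cons_append,
        List.append_assoc, List.nil_append, List.map_nil, mark, e, List.length_cons]
      exact ReflTransGen.refl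

/-- At the end of a code the machine turns to the copying stage. -/
theorem end_count (Y : List Cell) (L R : List Symbol) :
    Reaches₁ rogozhin.step
      (headRight 0 (leftOf ((idle, worked) :: Y) ++ L) (worked :: worked :: R))
      (headLeft 3 (leftOf Y ++ L) (idle :: worked :: idle :: worked :: R)) :=
  reaches₁_of_run 4 rfl

/-! ### The copying stage -/

/-- The cells on the right during the copying stage. -/
def Copying (V : List Cell) : Prop :=
  (∀ c ∈ V, c ≠ (idle, idle)) ∧ LeftSweepable (V.map toggle).reverse

theorem map_toggle_toggle (V : List Cell) : (V.map toggle).map toggle = V := by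
  simp [Function.comp_def]

/-- The two sweeps of a round toggle `V` twice and so restore it. The copied program cell is toggled
once, from its marked form, and from then on belongs to the right part. -/
theorem sweep_back {V : List Cell} (hV : Copying V) (c : Cell) (L R : List Symbol) :
    Reaches rogozhin.step (headLeft 3 (leftOf ((V.map toggle).reverse ++ [mark c]) ++ L) R)
      (headLeft 3 L (rightOf (toggle (mark c) :: V) ++ R)) := by
  have h := sweep_toggle_left (V := (V.map toggle).reverse ++ [mark c])
    (hV.2.append (.marked c.1 .nil)) L R
  have e : (((V.map toggle).reverse ++ [mark c]).map toggle).reverse = toggle (mark c) :: V := by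
    rw [List.map_append, List.map_reverse, map_toggle_toggle]
    simp
  rwa [e] at h

/-- Copy one unit of a code. -/
theorem copy_unit {V : List Cell} (hV : Copying V) (L : List Symbol) :
    Reaches rogozhin.step (headLeft 3 (idle :: idle :: L) (rightOf V))
      (headLeft 3 L (rightOf ((idle, worked) :: V ++ [(idle, worked)]))) := by
  have h₁ := sweep_toggle_right₁ V hV.1 (worked :: idle :: L) []
  have h₂ := sweep_back hV (idle, idle) L [idle, worked]
  rw [List.append_nil] at h₁
  refine ReflTransGen.trans (reaches_of_run 2 rfl) (h₁.trans ?_)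
  rw [rightOf_append]
  refine ReflTransGen.trans (reaches_of_run 2 ?_) h₂
  simp only [leftOf_append, List.append_assoc]
  rfl

/-- Copy the marker in front of a code. -/
theorem copy_marker {V : List Cell} (hV : Copying V) (L : List Symbol) :
    Reaches rogozhin.step (headLeft 3 (idle :: worked :: idle :: idle :: L) (rightOf V))
      (headLeft 3 (idle :: idle :: L) (rightOf ((worked, idle) :: V ++ [(worked, worked)]))) := by
  have h₁ := sweep_toggle_right₂ V hV.1 (worked :: worked :: idle :: idle :: L) []
  have h₂ := sweep_back hV (worked, idle) (idle :: idle :: L) [worked, worked]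
  rw [List.append_nil] at h₁
  refine ReflTransGen.trans (reaches_of_run 6 rfl) (h₁.trans ?_)
  rw [rightOf_append]
  refine ReflTransGen.trans (reaches_of_run 2 ?_) h₂
  simp only [leftOf_append, List.append_assoc]
  rfl

theorem Copying.cons_unit {V : List Cell} (hV : Copying V) :
    Copying ((idle, worked) :: V ++ [(idle, worked)]) := by
  refine ⟨?_, ?_⟩
  · intro c hc
    simp only [List.cons_append, List.mem_cons, List.mem_append, List.not_mem_nil, or_false] at hc
    rcases hc with rfl | hc | rfl
    · simp
    · exact hV.1 c hc
    · simp
  · have e : (((idle, worked) :: V ++ [(idle, worked)]).map toggle).reverse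
        = (idle, worked) :: ((V.map toggle).reverse ++ [(idle, worked)]) := by
      simp [toggle]
    rw [e]
    exact .marked _ (hV.2.append (.marked _ .nil))

/-- On the way back the new separator is passed in its toggled form, which requires a unit just
before it. Hence the right part has to end with a unit. -/
theorem Copying.cons_marker {V : List Cell} (hV : Copying (V ++ [(idle, worked)])) :
    Copying ((worked, idle) :: (V ++ [(idle, worked)]) ++ [(worked, worked)]) := by
  refine ⟨?_, ?_⟩
  · intro c hc
    rw [List.cons_append, List.mem_cons, List.mem_append, List.mem_singleton] at hc
    rcases hc with rfl | hc | rfl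
    · simp
    · exact hV.1 c hc
    · simp
  · have h := hV.2
    have e₀ : ((V ++ [(idle, worked)]).map toggle).reverse
        = (idle, worked) :: (V.map toggle).reverse := by
      simp [toggle]
    have e : (((worked, idle) :: (V ++ [(idle, worked)]) ++ [(worked, worked)]).map toggle).reverse
        = (worked, idle) :: (idle, worked) :: ((V.map toggle).reverse ++ [(worked, worked)]) := by
      simp [toggle]
    rw [e₀] at h
    rw [e]
    cases h with
    | marked _ h => exact .toggled (h.append (.marked _ .nil))

/-- The cells of a code. -/
def unary (k : ℕ) : List Cell := List.replicate k (idle, worked)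

theorem copy_units {V : List Cell} (hV : Copying V) (k : ℕ) (L : List Symbol) :
    Reaches rogozhin.step
      (headLeft 3 (leftOf (List.replicate k (idle, idle)) ++ L) (rightOf V))
      (headLeft 3 L (rightOf (unary k ++ V ++ unary k))) ∧ Copying (unary k ++ V ++ unary k) := by
  induction k generalizing V with
  | zero => simpa [unary] using ⟨ReflTransGen.refl, hV⟩
  | succ k ih =>
    obtain ⟨h₁, h₂⟩ := ih hV.cons_unit
    have e : unary k ++ ((idle, worked) :: V ++ [(idle, worked)]) ++ unary k
        = unary (k + 1) ++ V ++ unary (k + 1) := by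
      have e₁ : ∀ X, unary k ++ (idle, worked) :: X = unary (k + 1) ++ X := by
        intro X
        rw [show unary (k + 1) = unary k ++ [(idle, worked)] from List.replicate_succ']
        simp
      have e₂ : (idle, worked) :: unary k = unary (k + 1) := List.replicate_succ.symm
      rw [List.cons_append, List.append_assoc, List.cons_append, e₁, List.append_assoc,
        List.append_assoc, List.singleton_append, e₂]
    rw [e] at h₁ h₂
    refine ⟨ReflTransGen.trans ?_ h₁, h₂⟩
    rw [List.replicate_succ]
    exact copy_unit hV _

/-- Copy a marker and a code. -/
theorem copy_letter {V : List Cell} (hV : Copying (V ++ [(idle, worked)])) (k : ℕ)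
    (L : List Symbol) :
    ∃ W, unary (k + 1) ++ (worked, idle) :: (V ++ [(idle, worked)]) ++
        (worked, worked) :: unary (k + 1) = W ++ [(idle, worked)] ∧
      Copying (W ++ [(idle, worked)]) ∧ Reaches rogozhin.step
        (headLeft 3 (leftOf ((worked, idle) :: List.replicate (k + 1) (idle, idle)) ++ L)
          (rightOf (V ++ [(idle, worked)])))
        (headLeft 3 L (rightOf (W ++ [(idle, worked)]))) := by
  obtain ⟨h₁, h₂⟩ := copy_units hV.cons_marker (k + 1) L
  have e : unary (k + 1) ++ ((worked, idle) :: (V ++ [(idle, worked)]) ++ [(worked, worked)]) ++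
      unary (k + 1) = (unary (k + 1) ++ (worked, idle) :: (V ++ [(idle, worked)]) ++
        (worked, worked) :: unary k) ++ [(idle, worked)] := by
    have e₁ : unary (k + 1) = unary k ++ [(idle, worked)] := List.replicate_succ'
    conv_lhs => rhs; rw [e₁]
    simp
  refine ⟨unary (k + 1) ++ (worked, idle) :: (V ++ [(idle, worked)]) ++
        (worked, worked) :: unary k, ?_, e ▸ h₂, ?_⟩
  · rw [← e]; simp
  · rw [e] at h₁
    refine ReflTransGen.trans ?_ h₁
    have := copy_marker hV (leftOf (List.replicate k (idle, idle)) ++ L)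
    rw [List.replicate_succ]
    exact this

/-- The end of a production: two adjacent markers. -/
theorem end_copy (V : List Cell) (hV : ∀ c ∈ V, c = (idle, worked) ∨ c = (worked, idle))
    (L R : List Symbol) :
    Reaches₁ rogozhin.step
      (headLeft 3 (leftOf [(worked, idle), (worked, idle)] ++ L)
        (rightOf (V ++ [(idle, worked)]) ++ worked :: worked :: R))
      (headRight 0 (leftOf ([(idle, worked), (idle, worked)] ++ (V.map clear).reverse ++
        [(worked, idle), (worked, idle)]) ++ L) R) := by
  have h := sweep_clear_right (V ++ [(idle, worked)]) (by
    intro c hc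
    rcases List.mem_append.1 hc with hc | hc
    · exact hV c hc
    · simp at hc; exact Or.inl hc) (leftOf [(worked, idle), (worked, idle)] ++ L)
    (worked :: worked :: R)
  refine TransGen.trans_left (reaches₁_of_run 6 rfl) (h.trans ?_)
  have e : ((V ++ [(idle, worked)]).map clear).reverse = (idle, idle) :: (V.map clear).reverse := by
    simp [clear]
  rw [e]
  simp only [leftOf_append, List.append_assoc]
  exact reaches_of_run 5 rfl

/-- A marker next to the cell of two ones makes the machine halt. -/
theorem halt_copy (R : List Symbol) :
    (10, [], worked, worked :: worked :: worked :: R) ∈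
      eval rogozhin.step (headLeft 3 (leftOf [(worked, idle)] ++ [worked, worked]) R) :=
  mem_eval.2 ⟨reaches_of_run 2 rfl, rfl⟩

end Rogozhin

end CivVI

namespace CivVI

/-! ## Rogozhin's machine simulates 2-tag systems -/

/-- One step of the 2-tag system with productions `P` and the halting letter `h`. -/
inductive TagStep {α : Type*} (P : α → List α) (h : α) : List α → List α → Prop
  | intro (a b : α) (w : List α) (ha : a ≠ h) (hne : w ++ P a ≠ []) :
      TagStep P h (a :: b :: w) (w ++ P a)

/-! ### Layout of program and word, and one step of the tag system -/

namespace Rogozhin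

open CivVI.Symbol

variable (prods : List (List ℕ))

/-- The code of a letter is `codePred + 1`. -/
def codePred (i : ℕ) : ℕ := ((prods.take i).map fun p => p.length + 1).sum

/-- The code of a letter: one more than the number of markers in the preceding productions. -/
def code (i : ℕ) : ℕ := codePred prods i + 1

/-- The numbers that make up the program for some productions. -/
def numbers (ps : List (List ℕ)) : List ℕ := ps.flatMap fun p => 0 :: p.map (code prods)

/-- The numbers that make up the whole program. -/
def program : List ℕ := 0 :: numbers prods prods ++ [0]

theorem length_numbers (ps : List (List ℕ)) :
    (numbers prods ps).length = (ps.map fun p => p.length + 1).sum := by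
  simp [numbers, List.length_flatMap]

/-- The cells of a word, with a separator in front of every letter. -/
def separated (w : List ℕ) : List Cell :=
  w.flatMap fun x => (worked, worked) :: unary (code prods x)

/-- The cells of a word. -/
def wordCells : List ℕ → List Cell
  | [] => []
  | a :: w => unary (code prods a) ++ separated prods w

theorem separated_cons (a : ℕ) (w : List ℕ) :
    separated prods (a :: w) = (worked, worked) :: wordCells prods (a :: w) := by
  simp [separated, wordCells]

theorem separated_append (v w : List ℕ) :
    separated prods (v ++ w) = separated prods v ++ separated prods w := by
  simp [separated]

/-- The cells to the left of the head between two steps of the tag system. -/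
def leftCells (k : ℕ) : List Cell :=
  (idle, worked) :: (idle, worked) :: List.replicate k (idle, idle) ++ segments (program prods)

/-- The configuration that represents a word; `k` counts used cells. -/
def wordConfig (k : ℕ) (w : List ℕ) : Config (Fin 24) Symbol :=
  headRight 0 (leftOf (leftCells prods k) ++ [worked, worked]) (rightOf (wordCells prods w))

theorem unary_succ (k : ℕ) : unary (k + 1) = unary k ++ [(idle, worked)] := List.replicate_succ'

@[simp] theorem map_mark_mark (V : List Cell) : (V.map mark).map mark = V.map mark := by
  rw [List.map_map]; rfl

@[simp] theorem map_mark_unary (k : ℕ) : (unary k).map mark = unary k := by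
  simp [unary, mark]

@[simp] theorem map_clear_mark (V : List Cell) : (V.map mark).map clear = V.map clear := by
  rw [List.map_map]; rfl

@[simp] theorem map_clear_unary (k : ℕ) :
    (unary k).map clear = List.replicate k (idle, idle) := by
  simp [unary, clear]

@[simp] theorem map_clear_segments (ks : List ℕ) : (segments ks).map clear = segments ks := by
  simp [segments, clear, List.map_flatMap]

/-- Cells that are cleared by the last sweep. -/
def Clearable (V : List Cell) : Prop := ∀ c ∈ V, c = (idle, worked) ∨ c = (worked, idle)

theorem Clearable.append {V W : List Cell} (hV : Clearable V) (hW : Clearable W) :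
    Clearable (V ++ W) := by
  intro c hc
  rcases List.mem_append.1 hc with h | h
  exacts [hV c h, hW c h]

theorem clearable_unary (k : ℕ) : Clearable (unary k) := by
  intro c hc
  exact Or.inl (List.eq_of_mem_replicate hc)

/-- Toggling turns both kinds of cells into marked ones, which the left sweep always passes. -/
theorem Clearable.copying {V : List Cell} (hV : Clearable V) : Copying V := by
  refine ⟨fun c hc => by rcases hV c hc with rfl | rfl <;> simp, ?_⟩
  have : (V.map toggle).reverse = V.reverse.map mark := by
    rw [← List.map_reverse]
    refine List.map_congr_left fun c hc => ?_
    rcases hV c (List.mem_reverse.1 hc) with rfl | rfl <;> rfl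
  rw [this]
  exact leftSweepable_map_mark _

theorem Copying.append_chunk {V : List Cell} (hV : Copying (V ++ [(idle, worked)])) (k : ℕ) :
    Copying (V ++ [(idle, worked)] ++ (worked, worked) :: unary (k + 1)) := by
  refine ⟨?_, ?_⟩
  · intro c hc
    rw [List.mem_append, List.mem_cons] at hc
    rcases hc with hc | rfl | hc
    · exact hV.1 c hc
    · simp
    · rw [List.eq_of_mem_replicate hc]; simp
  · have h := hV.2
    have e₀ : ((V ++ [(idle, worked)]).map toggle).reverse
        = (idle, worked) :: (V.map toggle).reverse := by
      simp [toggle]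
    have e₁ : ((unary (k + 1)).map toggle).reverse = unary (k + 1) := by
      simp [unary, toggle]
    have e : ((V ++ [(idle, worked)] ++ (worked, worked) :: unary (k + 1)).map toggle).reverse
        = unary (k + 1) ++ (worked, idle) :: (idle, worked) :: (V.map toggle).reverse := by
      rw [List.map_append, List.reverse_append, e₀, List.map_cons, List.reverse_cons, e₁]
      simp [toggle]
    rw [e₀] at h
    rw [e]
    have hu : LeftSweepable (unary (k + 1)) := by
      have := leftSweepable_map_mark (unary (k + 1))
      simpa [unary, mark] using this
    cases h with
    | marked _ h => exact hu.append (.toggled h)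

theorem Copying.append_separated {V : List Cell} (hV : Copying (V ++ [(idle, worked)]))
    (w : List ℕ) : ∃ V', V ++ [(idle, worked)] ++ separated prods w = V' ++ [(idle, worked)] ∧
      Copying (V' ++ [(idle, worked)]) := by
  induction w generalizing V with
  | nil => exact ⟨V, by simp [separated], hV⟩
  | cons a w ih =>
    have h := hV.append_chunk (codePred prods a)
    have e : V ++ [(idle, worked)] ++ (worked, worked) :: unary (codePred prods a + 1)
        = (V ++ [(idle, worked)] ++ (worked, worked) :: unary (codePred prods a)) ++
          [(idle, worked)] := by
      rw [unary_succ]; simp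
    rw [e] at h
    obtain ⟨V', h₁, h₂⟩ := ih h
    refine ⟨V', ?_, h₂⟩
    rw [← h₁, ← e, separated_cons, wordCells]
    simp [code]

/-- The counting stage marks the part `ks` of the program; `k'` counts used cells. -/
theorem counting (k a b : ℕ) (w ks ls : List ℕ) (h : program prods = ks ++ ls)
    (hks : ks.length = code prods a) :
    ∃ V k', Clearable V ∧
      (V.map clear).reverse = List.replicate k' (idle, idle) ++ segments ks ∧
      Reaches₁ rogozhin.step (wordConfig prods k (a :: b :: w))
        (headLeft 3 (leftOf (segments ls) ++ [worked, worked])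
          (rightOf (V ++ [(idle, worked)] ++ separated prods w))) := by
  set V₀ : List Cell := (idle, worked) :: (idle, worked) :: List.replicate k (idle, idle) with hV₀
  have hne : ks ≠ [] := by
    rintro rfl
    simp [code] at hks
  have hc := count_all ks V₀ (by
    intro c hc
    simp only [hV₀, List.mem_cons, List.mem_replicate] at hc
    rcases hc with rfl | rfl | ⟨_, rfl⟩ <;> simp) (Or.inl hne)
    (leftOf (segments ls) ++ [worked, worked]) (rightOf (separated prods (b :: w)))
  set Y : List Cell := unary (codePred prods a) ++ V₀.map mark ++ (segments ks).map mark with hY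
  have hYm : Y.map mark = Y := by
    rw [hY, List.map_append, List.map_append, map_mark_mark, map_mark_mark, map_mark_unary]
  have he := end_count Y (leftOf (segments ls) ++ [worked, worked])
    (rightOf (wordCells prods (b :: w)))
  have hs := sweep_toggle_left (V := Y) (hYm ▸ leftSweepable_map_mark Y)
    (leftOf (segments ls) ++ [worked, worked])
    (idle :: worked :: idle :: worked :: rightOf (wordCells prods (b :: w)))
  have hone : ∀ c ∈ Y, c.2 = worked := by
    intro c hc
    rw [← hYm] at hc
    obtain ⟨d, _, rfl⟩ := List.mem_map.1 hc
    rfl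
  -- The second letter `b` is absorbed here, which deletes it from the word. Its units are joined by
  -- the separator in front of it, now a unit, and by the last cell of the counting; one unit is
  -- split off as the required last cell.
  refine ⟨(Y.map toggle).reverse ++ unary (2 + codePred prods b),
    2 + codePred prods b + codePred prods a + (2 + k), ?_, ?_, ?_⟩
  · refine Clearable.append ?_ (clearable_unary _)
    intro c hc
    obtain ⟨d, hd, rfl⟩ := List.mem_map.1 (List.mem_reverse.1 hc)
    have := hone d hd
    obtain ⟨x, y⟩ := d
    subst this
    cases x
    · exact Or.inl rfl
    · exact Or.inr rfl
  · have h₁ : (Y.map toggle).map clear = Y.map clear := by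
      rw [List.map_map]
      refine List.map_congr_left fun c _ => ?_
      rcases c with ⟨_ | _, _ | _⟩ <;> rfl
    have h₂ : V₀.map clear = List.replicate (2 + k) (idle, idle) := by
      rw [Nat.add_comm]
      simp [hV₀, clear, List.replicate_succ]
    rw [List.map_append, List.map_reverse, h₁, hY, List.map_append, List.map_append,
      map_clear_mark, map_clear_mark, map_clear_segments, map_clear_unary, map_clear_unary, h₂,
      List.reverse_append, List.reverse_reverse, List.reverse_replicate]
    simp only [← List.append_assoc, ← List.replicate_add, Nat.add_assoc]
  · have e₁ : wordConfig prods k (a :: b :: w) =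
        headRight 0 (leftOf (V₀ ++ segments ks) ++ (leftOf (segments ls) ++ [worked, worked]))
          (rightOf (List.replicate ks.length (idle, worked)) ++
            rightOf (separated prods (b :: w))) := by
      rw [wordConfig, leftCells, h, segments_append, wordCells, hks, rightOf_append,
        ← List.append_assoc, leftOf_append, List.append_assoc]
      rfl
    have e₂ : List.replicate ks.length (idle, worked) ++ V₀.map mark ++ (segments ks).map mark =
        (idle, worked) :: Y := by
      rw [hks, code, List.replicate_succ, hY]; rfl
    have e₃ : (Y.map toggle).reverse ++ unary (2 + codePred prods b) ++ [(idle, worked)] ++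
        separated prods w = (Y.map toggle).reverse ++
          (idle, worked) :: (idle, worked) :: wordCells prods (b :: w) := by
      rw [List.append_assoc _ _ [(idle, worked)], ← unary_succ, wordCells, code,
        show 2 + codePred prods b + 1 = codePred prods b + 1 + 1 + 1 by omega, unary,
        List.replicate_succ, List.replicate_succ, List.append_assoc]
      rfl
    rw [e₁, e₃]
    rw [e₂, separated_cons] at hc
    refine TransGen.trans_right hc (TransGen.trans_left he ?_)
    rw [rightOf_append]
    exact hs

/-- The cells of a production as they are found in the program. -/
def productionCells (p : List ℕ) : List Cell :=
  p.flatMap fun x => (worked, idle) :: List.replicate (code prods x) (idle, idle)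

/-- In the program a marker follows each number, but for copying it has to precede the code of a
letter. Because of the leading `0` the list can be regrouped in this way, with one marker left over
to close the production. -/
theorem segments_production (p : List ℕ) (ls : List ℕ) :
    segments (0 :: p.map (code prods) ++ ls) =
      productionCells prods p ++ (worked, idle) :: segments ls := by
  induction p with
  | nil => simp [productionCells]
  | cons x p ih =>
    simp only [List.map_cons, List.cons_append, segments_cons, List.replicate_zero,
      List.nil_append] at ih ⊢
    rw [ih]
    simp [productionCells]

/-- Copy a production. -/
theorem copy_production (p : List ℕ) (L : List Symbol) {V : List Cell}
    (hV : Copying (V ++ [(idle, worked)])) :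
    ∃ U, Clearable U ∧ (U.map clear).reverse = productionCells prods p ∧
      Reaches rogozhin.step
        (headLeft 3 (leftOf (productionCells prods p) ++ L) (rightOf (V ++ [(idle, worked)])))
        (headLeft 3 L (rightOf (U ++ (V ++ [(idle, worked)]) ++ separated prods p))) := by
  induction p generalizing V with
  | nil =>
    refine ⟨[], by simp [Clearable], rfl, ?_⟩
    simp only [productionCells, separated, List.flatMap_nil, leftOf_nil, List.nil_append,
      List.append_nil]
    exact ReflTransGen.refl
  | cons x p ih =>
    obtain ⟨W, e, hW, h₁⟩ := copy_letter hV (codePred prods x)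
      (leftOf (productionCells prods p) ++ L)
    obtain ⟨U, hU, hUc, h₂⟩ := ih hW
    refine ⟨U ++ (unary (code prods x) ++ [(worked, idle)]), hU.append
      ((clearable_unary _).append (by simp [Clearable])), ?_, ?_⟩
    · rw [List.map_append, List.reverse_append, hUc, List.map_append, map_clear_unary,
        List.reverse_append, List.reverse_replicate]
      simp [productionCells, clear]
    · have e₁ : productionCells prods (x :: p) =
          (worked, idle) :: List.replicate (codePred prods x + 1) (idle, idle) ++
            productionCells prods p := rfl
      rw [e₁, leftOf_append, List.append_assoc]
      refine h₁.trans ?_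
      rw [← e] at h₂
      rw [← e]
      have e₂ : U ++ (unary (code prods x) ++ [(worked, idle)]) ++ (V ++ [(idle, worked)]) ++
          separated prods (x :: p) = U ++ (unary (codePred prods x + 1) ++
            (worked, idle) :: (V ++ [(idle, worked)]) ++
              (worked, worked) :: unary (codePred prods x + 1)) ++ separated prods p := by
        simp [separated, code]
      rw [e₂]
      exact h₂

theorem numbers_append (ps qs : List (List ℕ)) :
    numbers prods (ps ++ qs) = numbers prods ps ++ numbers prods qs := by
  simp [numbers]

theorem length_code (a : ℕ) :
    (0 :: numbers prods (prods.take a)).length = code prods a := by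
  rw [List.length_cons, length_numbers]; rfl

theorem exists_zero_cons (ps : List (List ℕ)) : ∃ ls, numbers prods ps ++ [0] = 0 :: ls := by
  cases ps with
  | nil => exact ⟨[], rfl⟩
  | cons p ps => exact ⟨p.map (code prods) ++ numbers prods ps ++ [0], by simp [numbers]⟩

/-- The code of `a` equals the number of markers in front of its production, so counting stops
exactly there. The new word has to be nonempty because the final sweep ends at the separator of its
first letter. -/
theorem wordConfig_step (k a b : ℕ) (w p : List ℕ) (hp : prods[a]? = some p) (hw : w ++ p ≠ []) :
    ∃ k', Reaches₁ rogozhin.step (wordConfig prods k (a :: b :: w))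
      (wordConfig prods k' (w ++ p)) := by
  obtain ⟨ha, rfl⟩ := List.getElem?_eq_some_iff.1 hp
  obtain ⟨ls, hls⟩ := exists_zero_cons prods (prods.drop (a + 1))
  set ks := 0 :: numbers prods (prods.take a) with hks
  have hprog : program prods = ks ++ (0 :: prods[a].map (code prods) ++ 0 :: ls) := by
    have h₁ : numbers prods prods = numbers prods (prods.take a) ++
        (0 :: prods[a].map (code prods) ++ numbers prods (prods.drop (a + 1))) := by
      rw [← congrArg (numbers prods) (List.take_append_drop a prods), numbers_append,
        List.drop_eq_getElem_cons ha]
      rfl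
    rw [program, h₁, hks, ← hls]
    simp
  -- Clearing `V` gives back the part of the program that has been passed, preceded by blank used
  -- cells.
  obtain ⟨V, k', hV, hVc, h₁⟩ := counting prods k a b w ks _ hprog (length_code prods a)
  rw [segments_production] at h₁
  have hcop : Copying (V ++ [(idle, worked)]) :=
    (hV.append (clearable_unary 1)).copying
  obtain ⟨V', hV', hcop'⟩ := hcop.append_separated prods w
  obtain ⟨U, hU, hUc, h₂⟩ := copy_production prods prods[a]
    (leftOf ((worked, idle) :: segments (0 :: ls)) ++ [worked, worked]) hcop'
  obtain ⟨c, v, hcv⟩ := List.exists_cons_of_ne_nil hw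
  have h₃ := end_copy (U ++ V) (hU.append hV) (leftOf (segments ls) ++ [worked, worked])
    (rightOf (wordCells prods (c :: v)))
  refine ⟨k', ?_⟩
  rw [hV', leftOf_append, List.append_assoc] at h₁
  refine (h₁.trans_left h₂).trans ?_
  have e₁ : rightOf (U ++ (V' ++ [(idle, worked)]) ++ separated prods prods[a]) =
      rightOf (U ++ V ++ [(idle, worked)]) ++
        worked :: worked :: rightOf (wordCells prods (c :: v)) := by
    rw [← hV', List.append_assoc, List.append_assoc _ _ (separated prods prods[a]),
      ← separated_append, hcv, separated_cons, ← List.append_assoc, rightOf_append,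
      List.append_assoc]
    rfl
  have e₂ : leftCells prods k' = [(idle, worked), (idle, worked)] ++ ((U ++ V).map clear).reverse ++
        [(worked, idle), (worked, idle)] ++ segments ls := by
    rw [leftCells, hprog, segments_append, segments_production, List.map_append,
      List.reverse_append, hVc, hUc]
    simp
  rw [e₁, hcv, wordConfig, e₂, leftOf_append _ (segments ls), List.append_assoc (leftOf _)]
  exact h₃

/-- The configuration in which the machine halts. -/
theorem wordConfig_halt (k b : ℕ) (w : List ℕ) :
    ∃ V : List Cell, (∀ c ∈ V, c ≠ (worked, worked)) ∧
      (10, [], worked, worked :: rightOf ((worked, worked) :: V ++ separated prods w)) ∈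
        eval rogozhin.step (wordConfig prods k (prods.length :: b :: w)) := by
  -- The halting letter has the number `prods.length`, so its code passes over all productions; a
  -- single marker is left before the two ones at the end.
  obtain ⟨V, k', hV, -, h₁⟩ := counting prods k prods.length b w
    (0 :: numbers prods prods) [0] rfl (by
      have := length_code prods prods.length
      rwa [List.take_length] at this)
  refine ⟨V ++ [(idle, worked)], ?_, ?_⟩
  · intro c hc
    rcases (hV.append (clearable_unary 1)) c hc with rfl | rfl <;> simp
  · rw [reaches_eval h₁.to_reflTransGen]
    exact halt_copy _

end Rogozhin

end CivVI

namespace CivVI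

namespace Rogozhin

/-! ### Tag systems with letters from a finite type -/

section FiniteTag

variable {α : Type*} {n : ℕ} (e : α ≃ Fin (n + 1)) (P : α → List α)

/-- The productions of a tag system whose letters are numbered by `e`; the last letter is the
halting letter. -/
def productions : List (List ℕ) :=
  List.ofFn fun i : Fin n => (P (e.symm i.castSucc)).map fun x => (e x : ℕ)

theorem reaches₁_of_tagStep {h : α} (he : e h = Fin.last n) {w w' : List α}
    (hw : TransGen (TagStep P h) w w') (k : ℕ) :
    ∃ k', Reaches₁ rogozhin.step
      (wordConfig (productions e P) k (w.map fun x => (e x : ℕ)))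
      (wordConfig (productions e P) k' (w'.map fun x => (e x : ℕ))) := by
  have one : ∀ w w' k, TagStep P h w w' → ∃ k', Reaches₁ rogozhin.step
      (wordConfig (productions e P) k (w.map fun x => (e x : ℕ)))
      (wordConfig (productions e P) k' (w'.map fun x => (e x : ℕ))) := by
    rintro _ _ k ⟨a, b, w, ha, hne⟩
    have hlt : (e a : ℕ) < n := by
      have h₁ : e a ≠ Fin.last n := fun h₂ => ha (e.injective (h₂.trans he.symm))
      exact Fin.val_lt_last h₁
    have hp : (productions e P)[(e a : ℕ)]? = some ((P a).map fun x => (e x : ℕ)) := by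
      have hl : (e a : ℕ) < (productions e P).length := by simpa [productions] using hlt
      rw [List.getElem?_eq_getElem hl]
      simp [productions]
    have := wordConfig_step (productions e P) k (e a) (e b) (w.map fun x => (e x : ℕ)) _ hp
      (by rw [← List.map_append]; simpa using hne)
    simpa using this
  induction hw with
  | single h => exact one _ _ _ h
  | tail _ h ih =>
    obtain ⟨k₁, h₁⟩ := ih
    obtain ⟨k₂, h₂⟩ := one _ _ k₁ h
    exact ⟨k₂, h₁.trans h₂⟩

end FiniteTag

end Rogozhin

/-! ## Passes of a tag system over its word -/

section Pass

variable {α : Type*}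

/-- The letters of a word at even positions. -/
def evens : List α → List α
  | [] => []
  | [a] => [a]
  | a :: _ :: w => a :: evens w

theorem evens_append_of_even {u : List α} (hu : Even u.length) (v : List α) :
    evens (u ++ v) = evens u ++ evens v := by
  induction u using evens.induct with
  | case1 => rfl
  | case2 a => simp at hu
  | case3 a b w ih =>
    have hw : Even w.length := by
      simp only [List.length_cons] at hu
      rw [Nat.even_add_one, Nat.even_add_one, not_not] at hu
      exact hu
    simp only [List.cons_append, evens, ih hw]

theorem evens_append_of_odd {u : List α} (hu : ¬ Even u.length) (v : List α) :
    evens (u ++ v) = evens u ++ evens v.tail := by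
  induction u using evens.induct with
  | case1 => simp at hu
  | case2 a => cases v <;> rfl
  | case3 a b w ih =>
    have hw : ¬ Even w.length := by
      simp only [List.length_cons] at hu
      rw [Nat.even_add_one, Nat.even_add_one, not_not] at hu
      exact hu
    simp only [List.cons_append, evens, ih hw]

theorem evens_replicate (n : ℕ) (x : α) :
    evens (List.replicate n x) = List.replicate ((n + 1) / 2) x := by
  induction n using Nat.twoStepInduction with
  | zero => rfl
  | one => rfl
  | more n ih _ =>
    rw [List.replicate_succ, List.replicate_succ, evens, ih,
      show (n + 2 + 1) / 2 = (n + 1) / 2 + 1 by omega, List.replicate_succ]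

theorem evens_cons_replicate (n : ℕ) (x y : α) :
    evens (x :: List.replicate n y) = x :: List.replicate (n / 2) y := by
  cases n with
  | zero => rfl
  | succ n => rw [List.replicate_succ, evens, evens_replicate]

/-- Every letter is replaced by two letters. -/
def double {β : Type*} (f g : α → β) (w : List α) : List β := w.flatMap fun x => [f x, g x]

@[simp] theorem double_cons {β : Type*} (f g : α → β) (a : α) (w : List α) :
    double f g (a :: w) = f a :: g a :: double f g w := rfl

@[simp] theorem double_append {β : Type*} (f g : α → β) (v w : List α) :
    double f g (v ++ w) = double f g v ++ double f g w := by
  simp [double]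

theorem evens_double {β : Type*} (f g : α → β) (w : List α) :
    evens (double f g w) = w.map f := by
  induction w with
  | nil => rfl
  | cons a w ih => simpa [double, evens] using ih

theorem evens_tail_double {β : Type*} (f g : α → β) (w : List α) :
    evens (double f g w).tail = w.map g := by
  induction w with
  | nil => rfl
  | cons a w ih =>
    cases w with
    | nil => rfl
    | cons b w => simpa [double, evens] using ih

theorem even_length_double {β : Type*} (f g : α → β) (w : List α) :
    Even (double f g w).length := by
  simp [double]

variable {P : α → List α} {h : α}

/-- If `u` has odd length, the last step that reads a letter of `u` deletes the first letter of what
follows. In this way the parity of `u` shifts the alignment of the next pass. A second letter in `v`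
then keeps the word nonempty. -/
theorem pass_append (u v : List α) (hu : ∀ x ∈ evens u, x ≠ h) (hv : v ≠ [])
    (hv' : Even u.length ∨ 2 ≤ v.length) :
    ReflTransGen (TagStep P h) (u ++ v)
      (if Even u.length then v ++ (evens u).flatMap P else (v ++ (evens u).flatMap P).tail) := by
  induction u using evens.induct generalizing v with
  | case1 => simpa [evens] using ReflTransGen.refl
  | case2 a =>
    obtain ⟨b, c, v, rfl⟩ : ∃ b c v', v = b :: c :: v' := by
      match v with
      | [] => simp at hv
      | [_] => simp at hv'
      | b :: c :: v' => exact ⟨b, c, v', rfl⟩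
    have := TagStep.intro (P := P) a b (c :: v) (hu a (by simp [evens])) (by simp)
    simpa [evens] using ReflTransGen.single this
  | case3 a b w ih =>
    have hpar : Even (a :: b :: w).length ↔ Even w.length := by
      simp only [List.length_cons]
      rw [Nat.even_add_one, Nat.even_add_one, not_not]
    have h₁ := TagStep.intro (P := P) a b (w ++ v) (hu a (by simp [evens])) (by simp [hv])
    have h₂ := ih (v ++ P a) (fun x hx => hu x (by simp [evens, hx])) (by simp [hv]) (by
      rw [hpar] at hv'
      refine hv'.imp id fun h => ?_
      rw [List.length_append]; omega)
    rw [← List.append_assoc] at h₂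
    have h₃ := ReflTransGen.head h₁ h₂
    simpa only [hpar, evens, List.flatMap_cons, List.append_assoc, List.cons_append] using h₃

/-- The result of reading the whole word once. -/
def pass (P : α → List α) (u : List α) : List α :=
  if Even u.length then (evens u).flatMap P else ((evens u).flatMap P).tail

theorem transGen_pass (a b : α) (u : List α) (hu : ∀ x ∈ evens (a :: b :: u), x ≠ h)
    (hP : P a ≠ []) (hP' : Even u.length ∨ 2 ≤ (P a).length) :
    TransGen (TagStep P h) (a :: b :: u) (pass P (a :: b :: u)) := by
  have h₁ := TagStep.intro (P := P) a b u (hu a (by simp [evens])) (by simp [hP])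
  have h₂ := pass_append (P := P) (h := h) u (P a) (fun x hx => hu x (by simp [evens, hx])) hP hP'
  have hpar : Even (a :: b :: u).length ↔ Even u.length := by
    simp only [List.length_cons]
    rw [Nat.even_add_one, Nat.even_add_one, not_not]
  have h₃ := TransGen.head' h₁ h₂
  simpa only [pass, hpar, evens, List.flatMap_cons] using h₃

end Pass

/-! ## Machines with two numbers -/

/-- An instruction of a machine with two numbers. -/
inductive Instr (σ : Type) where
  /-- Replace `M` by `cL * M + dL` and `N` by `cR * N + dR`. -/
  | expand (cL dL cR dR : ℕ) (next : σ)
  /-- Replace `M` by `M / 2` and `N` by `c * N + d`, and branch on the parity of `M`. -/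
  | halveLeft (c d : ℕ) (next : Bool → σ)
  /-- Replace `N` by `N / 2` and `M` by `c * M + d`, and branch on the parity of `N`. -/
  | halveRight (c d : ℕ) (next : Bool → σ)

/-- One step of the machine with two numbers. -/
def numberStep {σ : Type} (I : σ → Option (Instr σ)) : σ × ℕ × ℕ → Option (σ × ℕ × ℕ)
  | (s, M, N) =>
    (I s).map fun
      | .expand cL dL cR dR next => (next, cL * M + dL, cR * N + dR)
      | .halveLeft c d next => (next (M.bodd), M / 2, c * N + d)
      | .halveRight c d next => (next (N.bodd), c * M + d, N / 2)

/-! ### The tag system of a machine with two numbers -/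

namespace NumberMachine

/-- The phases of the simulation of an instruction by a tag system. -/
inductive Phase where
  | standard
  | middle
  | parity (b : Bool)

/-- The places in a word: the numbers `M` and `N` are represented by a head and by a tail of as
many letters. -/
inductive Place where
  | leftHead
  | leftTail
  | rightHead
  | rightTail
  deriving DecidableEq

open Phase Place

instance : Finite Phase :=
  Finite.of_surjective (fun x : Option (Option Bool) => match x with
    | none => standard
    | some none => middle
    | some (some b) => parity b) fun y => by
      rcases y with _ | _ | b
      exacts [⟨none, rfl⟩, ⟨some none, rfl⟩, ⟨some (some b), rfl⟩]

instance : Finite Place :=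
  Finite.of_surjective (fun x : Bool × Bool => match x with
    | (true, true) => leftHead
    | (true, false) => leftTail
    | (false, true) => rightHead
    | (false, false) => rightTail) fun y => by
      cases y
      exacts [⟨(true, true), rfl⟩, ⟨(true, false), rfl⟩, ⟨(false, true), rfl⟩, ⟨(false, false), rfl⟩]

variable {σ : Type}

/-- The letters of the tag system. -/
abbrev Letter (σ : Type) : Type := σ × Phase × Place

/-- The productions of the tag system. -/
def production (I : σ → Option (Instr σ)) : Letter σ → List (Letter σ)
  | (s, standard, p) =>
    match I s with
    | none => []
    | some (.expand cL dL cR dR next) =>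
      let f : Place → Letter σ := fun p => (next, standard, p)
      match p with
      | leftHead => double f f (leftHead :: List.replicate dL leftTail)
      | leftTail => double f f (List.replicate cL leftTail)
      | rightHead => double f f (rightHead :: List.replicate dR rightTail)
      | rightTail => double f f (List.replicate cR rightTail)
    | some (.halveLeft c d _) =>
      let f : Place → Letter σ := fun p => (s, middle, p)
      match p with
      -- The side to be halved is written with single letters: the middle phase reads every second
      -- of them, and the length of the word gets the parity of `M + 1`.
      | leftHead => [f leftHead]
      | leftTail => [f leftTail]
      | rightHead => double f f (rightHead :: List.replicate d rightTail)
      | rightTail => double f f (List.replicate c rightTail)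
    | some (.halveRight c d _) =>
      let f : Place → Letter σ := fun p => (s, middle, p)
      match p with
      | leftHead => double f f (leftHead :: List.replicate d leftTail)
      | leftTail => double f f (List.replicate c leftTail)
      | rightHead => [f rightHead]
      | rightTail => [f rightTail]
  | (s, middle, p) => [(s, parity true, p), (s, parity false, p)]
  | (s, parity b, p) =>
    match I s with
    | some (.halveLeft _ _ next) | some (.halveRight _ _ next) =>
      -- In the case `false` the word that is read has odd length, so the pass deletes the first
      -- letter of its result. The extra letter makes up for this.
      (if b = false ∧ p = leftHead then [(next b, standard, p)] else []) ++
        [(next b, standard, p), (next b, standard, p)]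
    | _ => []

/-- The places of a word that represents the numbers `M` and `N`. -/
def places (M N : ℕ) : List Place :=
  leftHead :: List.replicate M leftTail ++ rightHead :: List.replicate N rightTail

/-- The word that represents a configuration. -/
def word (s : σ) (M N : ℕ) : List (Letter σ) :=
  double (fun p => (s, standard, p)) (fun p => (s, standard, p)) (places M N)

theorem flatMap_replicate_replicate {β γ δ : Type*} (f : β → List γ) (g : δ → γ) (x : β) (y : δ)
    (m c : ℕ) (h : f x = double g g (List.replicate c y)) :
    (List.replicate m x).flatMap f = double g g (List.replicate (c * m) y) := by
  induction m with
  | zero => rfl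
  | succ m ih =>
    rw [List.replicate_succ, List.flatMap_cons, ih, h, Nat.mul_succ, Nat.add_comm,
      List.replicate_add]
    rw [double_append]

theorem flatMap_replicate_singleton {β γ : Type*} (f : β → List γ) (x : β) (y : γ) (m : ℕ)
    (h : f x = [y]) : (List.replicate m x).flatMap f = List.replicate m y := by
  induction m with
  | zero => rfl
  | succ m ih => rw [List.replicate_succ, List.flatMap_cons, ih, h, List.replicate_succ]; rfl

theorem decide_even_succ (n : ℕ) : decide (Even (n + 1)) = n.bodd := by
  rw [Bool.eq_iff_iff, decide_eq_true_eq, Nat.even_add_one, Nat.not_even_iff_odd,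
    Nat.odd_iff, Nat.mod_two_of_bodd]
  cases n.bodd <;> simp

/-- The parity phase: the word is read with or without its first letter, and this selects the
next state. -/
theorem parity_pass {I : σ → Option (Instr σ)} {s : σ} {h : Letter σ} (hh : h.2.1 = standard)
    (next : Bool → σ) (hI : (∃ c d, I s = some (.halveLeft c d next)) ∨
      ∃ c d, I s = some (.halveRight c d next)) (M N : ℕ) (b : Bool) :
    let u := double (fun p => (s, parity true, p)) (fun p => (s, parity false, p)) (places M N)
    TransGen (TagStep (production I) h) (if b then u else u.tail) (word (next b) M N) := by
  intro u
  have hprod : ∀ b p, production I (s, parity b, p) =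
      (if b = false ∧ p = leftHead then [(next b, standard, p)] else []) ++
        [(next b, standard, p), (next b, standard, p)] := by
    intro b p
    rcases hI with ⟨c, d, hI⟩ | ⟨c, d, hI⟩ <;> simp only [production, hI]
  have hne : ∀ b p, ((s, parity b, p) : Letter σ) ≠ h := by
    rintro b p rfl
    cases hh
  have hev : Even u.length := even_length_double _ _ _
  cases b with
  | true =>
    have hp : pass (production I) u = word (next true) M N := by
      rw [pass, if_pos hev, evens_double, List.flatMap_map]
      simp [hprod, word, double]
    have := transGen_pass (P := production I) (h := h) (s, parity true, leftHead)
      (s, parity false, leftHead) u.tail.tail (by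
        change ∀ x ∈ evens u, x ≠ h
        rw [evens_double]
        intro x hx
        obtain ⟨p, _, rfl⟩ := List.mem_map.1 hx
        exact hne _ _) (by simp [hprod]) (Or.inr (by simp [hprod]))
    change TransGen _ u (pass (production I) u) at this
    rw [hp] at this
    exact this
  -- The word without its first letter begins with a letter `parity false`, and the pass reads only
  -- letters of this kind.
  | false =>
    have hp : pass (production I) u.tail = word (next false) M N := by
      have h₁ : ¬ Even u.tail.length := by
        have : u.length = u.tail.length + 1 := rfl
        rw [this, Nat.even_add_one] at hev
        exact hev
      rw [pass, if_neg h₁, evens_tail_double, List.flatMap_map]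
      have h₂ : ∀ w : List Place, leftHead ∉ w →
          w.flatMap (fun p => production I (s, parity false, p)) =
            double (fun p => (next false, standard, p)) (fun p => (next false, standard, p)) w := by
        intro w hw
        refine List.flatMap_congr fun p hp => ?_
        rw [hprod, if_neg (by rintro ⟨_, rfl⟩; exact hw hp)]
        rfl
      rw [places, List.cons_append, List.flatMap_cons, h₂ _ (by simp [List.mem_replicate]), hprod]
      simp [word, places]
    obtain ⟨x, v, hx⟩ : ∃ x v, u.tail = (s, parity false, leftHead) :: x :: v := by
      cases M with
      | zero => exact ⟨_, _, rfl⟩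
      | succ M => exact ⟨_, _, rfl⟩
    have := transGen_pass (P := production I) (h := h) (s, parity false, leftHead) x v (by
        rw [← hx, evens_tail_double]
        intro x hx
        obtain ⟨p, _, rfl⟩ := List.mem_map.1 hx
        exact hne _ _) (by simp [hprod]) (Or.inr (by simp [hprod]))
    rw [← hx, hp] at this
    exact this

/-- The middle phase: it tests the parity of the length of the word. -/
theorem middle_pass {I : σ → Option (Instr σ)} {s : σ} {h : Letter σ} (hh : h.2.1 = standard)
    (M N : ℕ) (a b : Letter σ) (w : List (Letter σ))
    (hw : evens (a :: b :: w) = (places M N).map fun p => (s, middle, p)) :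
    let u := double (fun p => (s, parity true, p)) (fun p => (s, parity false, p)) (places M N)
    TransGen (TagStep (production I) h) (a :: b :: w)
      (if decide (Even (a :: b :: w).length) then u else u.tail) := by
  intro u
  have ha : a = (s, middle, leftHead) := by
    simp only [evens, places, List.cons_append, List.map_cons, List.cons.injEq] at hw
    exact hw.1
  have hp : pass (production I) (a :: b :: w) =
      if decide (Even (a :: b :: w).length) then u else u.tail := by
    rw [pass, hw, List.flatMap_map]
    simp only [decide_eq_true_eq]
    rfl
  rw [← hp]
  refine transGen_pass a b w ?_ (by simp [ha, production]) (Or.inr (by simp [ha, production]))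
  rw [hw]
  intro x hx
  obtain ⟨p, _, rfl⟩ := List.mem_map.1 hx
  rintro rfl
  cases hh

/-- As letters are doubled, the pass reads each place once and stays aligned. The halting letter
belongs to another state and so does not occur. -/
theorem standard_pass {I : σ → Option (Instr σ)} {s : σ} {h : Letter σ} (hs : h ≠ (s, standard, leftHead))
    (hI : I s ≠ none) (hh : h.2 = (standard, leftHead)) (M N : ℕ) :
    TransGen (TagStep (production I) h) (word s M N)
      ((places M N).flatMap fun p => production I (s, standard, p)) := by
  have hp : pass (production I) (word s M N) =
      (places M N).flatMap fun p => production I (s, standard, p) := by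
    rw [word, pass, if_pos (even_length_double _ _ _), evens_double, List.flatMap_map]
  rw [← hp]
  refine transGen_pass (P := production I) (h := h) (s, standard, leftHead)
      (s, standard, leftHead) (word s M N).tail.tail ?_ ?_ (Or.inl ?_)
  · change ∀ x ∈ evens (word s M N), x ≠ h
    rw [word, evens_double]
    intro x hx
    obtain ⟨p, _, rfl⟩ := List.mem_map.1 hx
    rintro rfl
    simp only [Prod.mk.injEq, true_and] at hh
    rw [hh] at hs
    exact hs rfl
  · cases hI' : I s with
    | none => exact absurd hI' hI
    | some i => cases i <;> simp [production, hI']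
  · have h₁ : Even (word s M N).length := even_length_double _ _ _
    have h₂ : (word s M N).length = (word s M N).tail.tail.length + 2 := rfl
    rw [h₂] at h₁
    simpa [Nat.even_add] using h₁

/-- The tag system simulates a step of the machine with two numbers. -/
theorem transGen_tagStep {I : σ → Option (Instr σ)} {H : σ} (hH : ∀ s, I s = none ↔ s = H)
    {c c' : σ × ℕ × ℕ} (hc : numberStep I c = some c') :
    TransGen (TagStep (production I) (H, standard, leftHead))
      (word c.1 c.2.1 c.2.2) (word c'.1 c'.2.1 c'.2.2) := by
  obtain ⟨s, M, N⟩ := c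
  cases hI : I s with
  | none => simp [numberStep, hI] at hc
  | some i =>
    have hne : I s ≠ none := by simp [hI]
    have h₀ := standard_pass (h := (H, standard, leftHead)) (by
      intro h
      simp only [Prod.mk.injEq, and_true] at h
      exact hne ((hH s).2 h.symm)) hne rfl M N
    refine h₀.trans_left ?_
    rw [places, List.cons_append, List.flatMap_cons, List.flatMap_append, List.flatMap_cons]
    cases i with
    | expand cL dL cR dR next =>
      simp only [numberStep, hI, Option.map_some, Option.some.injEq] at hc
      subst hc
      set f : Place → Letter σ := fun p => (next, standard, p)
      rw [flatMap_replicate_replicate (c := cL) (g := f) (y := leftTail) (h := by simp [production, hI, f]),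
        flatMap_replicate_replicate (c := cR) (g := f) (y := rightTail) (h := by simp [production, hI, f])]
      have : double f f (leftHead :: List.replicate dL leftTail) ++
          (double f f (List.replicate (cL * M) leftTail) ++
            (double f f (rightHead :: List.replicate dR rightTail) ++
              double f f (List.replicate (cR * N) rightTail))) =
          word next (cL * M + dL) (cR * N + dR) := by
        rw [word, places, Nat.add_comm _ dL, Nat.add_comm _ dR]
        simp only [double_append, double_cons, List.cons_append, List.append_assoc,
          List.replicate_add, f]
      rw [← this]
      simp only [production, hI]
      exact ReflTransGen.refl
    | halveLeft c d next =>
      simp only [numberStep, hI, Option.map_some, Option.some.injEq] at hc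
      subst hc
      set f : Place → Letter σ := fun p => (s, middle, p)
      rw [flatMap_replicate_singleton (y := f leftTail) (h := by simp [production, hI, f]),
        flatMap_replicate_replicate (c := c) (g := f) (y := rightTail)
          (h := by simp [production, hI, f])]
      set U : List (Letter σ) := f leftHead :: List.replicate M (f leftTail) ++
        double f f (rightHead :: List.replicate (c * N + d) rightTail) with hU
      have hprod : production I (s, standard, leftHead) ++ (List.replicate M (f leftTail) ++
          (production I (s, standard, rightHead) ++
            double f f (List.replicate (c * N) rightTail))) = U := by
        rw [hU, Nat.add_comm _ d, List.replicate_add, double_cons, double_append]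
        simp [production, hI, f]
      have hlen : decide (Even U.length) = M.bodd := by
        have h₁ : U.length = M + 1 + (double f f (rightHead ::
          List.replicate (c * N + d) rightTail)).length := by
          simp [hU]
          omega
        have h₂ := even_length_double f f (rightHead :: List.replicate (c * N + d) rightTail)
        rw [← decide_even_succ M]
        refine decide_eq_decide.2 ?_
        rw [h₁, Nat.even_add]
        tauto
      have hev : evens U = (places (M / 2) (c * N + d)).map f := by
        by_cases hM : Even (M + 1)
        · rw [hU, evens_append_of_even (by simpa using hM), evens_double, evens_cons_replicate]
          simp [places]
        -- For odd `M + 1` the reading enters the right half at its second letter. Since that half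
        -- is doubled, the same places are read.
        · rw [hU, evens_append_of_odd (by simpa using hM), evens_tail_double,
            evens_cons_replicate]
          simp [places]
      obtain ⟨b, w, hb⟩ : ∃ b w, U = f leftHead :: b :: w := by
        cases M with
        | zero => exact ⟨_, _, rfl⟩
        | succ M => exact ⟨_, _, rfl⟩
      have h₁ := middle_pass (I := I) (s := s) (h := (H, standard, leftHead)) rfl
        (M / 2) (c * N + d) (f leftHead) b w (by rw [← hb]; exact hev)
      have h₂ := parity_pass (I := I) (s := s) (h := (H, standard, leftHead)) rfl next
        (Or.inl ⟨c, d, hI⟩) (M / 2) (c * N + d) M.bodd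
      rw [← hb, hlen] at h₁
      rw [hprod]
      exact (h₁.trans h₂).to_reflTransGen
    | halveRight c d next =>
      simp only [numberStep, hI, Option.map_some, Option.some.injEq] at hc
      subst hc
      set f : Place → Letter σ := fun p => (s, middle, p)
      rw [flatMap_replicate_replicate (c := c) (g := f) (y := leftTail)
          (h := by simp [production, hI, f]),
        flatMap_replicate_singleton (y := f rightTail) (h := by simp [production, hI, f])]
      set U : List (Letter σ) := double f f (leftHead :: List.replicate (c * M + d) leftTail) ++
        f rightHead :: List.replicate N (f rightTail) with hU
      have hprod : production I (s, standard, leftHead) ++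
          (double f f (List.replicate (c * M) leftTail) ++
          (production I (s, standard, rightHead) ++ List.replicate N (f rightTail))) = U := by
        rw [hU, Nat.add_comm _ d, List.replicate_add, double_cons, double_append]
        simp [production, hI, f]
      have hlen : decide (Even U.length) = N.bodd := by
        have h₁ : U.length = (double f f (leftHead ::
          List.replicate (c * M + d) leftTail)).length + (N + 1) := by
          simp [hU]
          omega
        have h₂ := even_length_double f f (leftHead :: List.replicate (c * M + d) leftTail)
        rw [← decide_even_succ N]
        refine decide_eq_decide.2 ?_
        rw [h₁, Nat.even_add]
        tauto
      have hev : evens U = (places (c * M + d) (N / 2)).map f := by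
        rw [hU, evens_append_of_even (even_length_double _ _ _), evens_double,
          evens_cons_replicate]
        simp [places]
      have h₁ := middle_pass (I := I) (s := s) (h := (H, standard, leftHead)) rfl
        (c * M + d) (N / 2) (f leftHead) (f leftHead) U.tail.tail hev
      have h₂ := parity_pass (I := I) (s := s) (h := (H, standard, leftHead)) rfl next
        (Or.inr ⟨c, d, hI⟩) (c * M + d) (N / 2) N.bodd
      change TransGen _ U _ at h₁
      have hlen' : decide (Even (f leftHead :: f leftHead :: U.tail.tail).length) = N.bodd := hlen
      rw [hlen'] at h₁
      rw [hprod]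
      exact (h₁.trans h₂).to_reflTransGen

/-- The halting configurations of Rogozhin's machine that represent the numbers `M` and `N`. -/
def HaltConfig (M N : ℕ) (κ : Config (Fin 24) Symbol) : Prop :=
  ∃ (prods : List (List ℕ)) (V : List Rogozhin.Cell) (w : List ℕ),
    (∀ c ∈ V, c ≠ (.worked, .worked)) ∧ w.length = 2 * M + 2 * N + 2 ∧
    κ = (10, [], .worked, .worked ::
      Rogozhin.rightOf ((.worked, .worked) :: V ++ Rogozhin.separated prods w))

/-- Used cells pile up between the program and the word, so the relation admits any number `k` of
them. At the halt all letters but the first two are still there, with their separators; counting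
these recovers `M + N`. -/
theorem simulates_rogozhin [Finite σ] {I : σ → Option (Instr σ)} {H : σ}
    (hH : ∀ s, I s = none ↔ s = H) :
    ∃ (prods : List (List ℕ)) (num : Letter σ → ℕ),
      Simulates (numberStep I) rogozhin.step
        (fun c κ => ∃ k, κ = Rogozhin.wordConfig prods k ((word c.1 c.2.1 c.2.2).map num))
        (fun c κ => HaltConfig c.2.1 c.2.2 κ) := by
  obtain ⟨m, ⟨e₀⟩⟩ := Finite.exists_equiv_fin (Letter σ)
  obtain ⟨n, rfl⟩ : ∃ n, m = n + 1 := by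
    cases m with
    | zero => exact (e₀ (H, standard, leftHead)).elim0
    | succ n => exact ⟨n, rfl⟩
  set h : Letter σ := (H, standard, leftHead)
  -- The halting letter needs the last number, the only one without a production.
  set e : Letter σ ≃ Fin (n + 1) := e₀.trans (Equiv.swap (e₀ h) (Fin.last n))
  have he : e h = Fin.last n := by simp [e]
  refine ⟨Rogozhin.productions e (production I), fun x => e x, ?_⟩
  rintro ⟨s, M, N⟩ _ ⟨k, rfl⟩
  refine ⟨fun c hc => ?_, fun hc => ?_⟩
  · obtain ⟨k', hk⟩ := Rogozhin.reaches₁_of_tagStep e (production I) he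
      (transGen_tagStep hH hc) k
    exact ⟨_, ⟨k', rfl⟩, hk⟩
  · have hs : s = H := by
      rw [← hH]
      simpa [numberStep] using hc
    subst hs
    have hw : (word s M N).map (fun x => (e x : ℕ)) =
        (Rogozhin.productions e (production I)).length :: (e h : ℕ) ::
          (word s M N).tail.tail.map (fun x => (e x : ℕ)) := by
      have : (Rogozhin.productions e (production I)).length = (e h : ℕ) := by
        simp [Rogozhin.productions, he]
      rw [this]
      rfl
    obtain ⟨V, hV, hm⟩ := Rogozhin.wordConfig_halt (Rogozhin.productions e (production I)) k (e h)
      ((word s M N).tail.tail.map (fun x => (e x : ℕ)))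
    rw [← hw] at hm
    refine ⟨_, ⟨_, V, (word s M N).tail.tail.map (fun x => (e x : ℕ)), hV, ?_, rfl⟩, hm⟩
    simp [word, places, double]
    omega

end NumberMachine

end CivVI

namespace CivVI

/-! ## One-tape machines in the form of Mathlib are simulated by machines with two numbers -/

/-- A coding of the symbols of a finite alphabet by numbers below `2 ^ bits`; the code of the
blank symbol is `0`. -/
structure DigitCoding (Γ : Type) [Inhabited Γ] where
  bits : ℕ
  digit : Γ → ℕ
  symbol : ℕ → Γ
  digit_default : digit default = 0
  digit_lt : ∀ a, digit a < 2 ^ bits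
  symbol_digit : ∀ a, symbol (digit a) = a

theorem nonempty_digitCoding (Γ : Type) [Inhabited Γ] [Finite Γ] : Nonempty (DigitCoding Γ) := by
  obtain ⟨m, ⟨e⟩⟩ := Finite.exists_equiv_fin Γ
  have hm : 0 < m := Fin.pos (e default)
  let e' : Γ ≃ Fin m := e.trans (Equiv.swap (e default) ⟨0, hm⟩)
  exact ⟨{
    bits := m
    digit := fun a => e' a
    symbol := fun i => if h : i < m then e'.symm ⟨i, h⟩ else default
    digit_default := by simp [e']
    digit_lt := fun a => (e' a).2.trans Nat.lt_two_pow_self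
    symbol_digit := fun a => by simp }⟩

namespace DigitCoding

open Turing

variable {Γ : Type} [Inhabited Γ] (D : DigitCoding Γ)

/-- The base of the number system. -/
def base : ℕ := 2 ^ D.bits

/-- The number whose digits are the symbols of a list. -/
def ofList (l : List Γ) : ℕ := l.foldr (fun a n => D.digit a + D.base * n) 0

/-- The number whose digits are the symbols of a half-tape. -/
def num (L : ListBlank Γ) : ℕ :=
  L.liftOn D.ofList (by
    rintro a b ⟨n, rfl⟩
    have h : D.ofList (List.replicate n default) = 0 := by
      induction n with
      | zero => rfl
      | succ n ih =>
        rw [List.replicate_succ, ofList, List.foldr_cons, ← ofList, ih, D.digit_default]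
        simp
    rw [ofList, ofList, List.foldr_append, ← ofList, ← ofList, h]
    rfl)

theorem num_cons (a : Γ) (L : ListBlank Γ) :
    D.num (L.cons a) = D.digit a + D.base * D.num L := by
  induction L using ListBlank.induction_on with
  | h l => rfl

theorem num_eq (L : ListBlank Γ) : D.num L = D.digit L.head + D.base * D.num L.tail := by
  conv_lhs => rw [← ListBlank.cons_head_tail L]
  exact D.num_cons _ _

theorem base_pos : 0 < D.base := Nat.two_pow_pos _

theorem digit_lt_base (a : Γ) : D.digit a < D.base := D.digit_lt a

theorem num_mod (L : ListBlank Γ) : D.num L % D.base = D.digit L.head := by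
  rw [num_eq, Nat.add_mul_mod_self_left, Nat.mod_eq_of_lt (D.digit_lt_base _)]

theorem num_div (L : ListBlank Γ) : D.num L / D.base = D.num L.tail := by
  rw [num_eq, Nat.add_mul_div_left _ _ D.base_pos, Nat.div_eq_of_lt (D.digit_lt_base _),
    zero_add]

end DigitCoding

/-! ### The program with two numbers for a one-tape machine -/

namespace TapeMachine

open Turing

variable {Γ Λ : Type} [Inhabited Γ] [Inhabited Λ] (D : DigitCoding Γ) (M : TM0.Machine Γ Λ)
  {S : Set Λ} (ss : TM0.Supports M S)

/-- The states of the machine with two numbers: the halting state, a state of the given machine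
together with the scanned symbol, and the states in which a symbol is read bit by bit from one of
the numbers. -/
abbrev NumberState (D : DigitCoding Γ) (S : Set Λ) : Type :=
  Option ((S × Γ) ⊕ (Bool × S × Fin (D.bits + 1) × Fin D.base))

/-- The state that scans a symbol. -/
def scan (q : S) (a : Γ) : NumberState D S := some (.inl (q, a))

/-- The state in which `j` bits with value `x` have been read. -/
def pop (right : Bool) (q : S) (j x : ℕ) : NumberState D S :=
  -- The truncations only make the function total; they have no effect on the values that occur.
  some (.inr (right, q, ⟨min j D.bits, by omega⟩, ⟨x % D.base, Nat.mod_lt _ (Nat.two_pow_pos _)⟩))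

/-- The program of the machine with two numbers. -/
def instructions : NumberState D S → Option (Instr (NumberState D S))
  | none => none
  | some (.inl (q, a)) =>
    match h : M q a with
    -- On halting, the scanned symbol is pushed onto the right half-tape and the left one is
    -- discarded. The result is the single number `N`, as Mathlib reads its output from the head to
    -- the right.
    | none => some (.expand 0 0 D.base (D.digit a) none)
    | some (q', .write b) => some (.expand 1 0 1 0 (scan D ⟨q', ss.2 h q.2⟩ b))
    | some (q', .move .right) =>
      some (.expand D.base (D.digit a) 1 0 (pop D true ⟨q', ss.2 h q.2⟩ 0 0))
    | some (q', .move .left) =>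
      some (.expand 1 0 D.base (D.digit a) (pop D false ⟨q', ss.2 h q.2⟩ 0 0))
  | some (.inr (right, q, j, x)) =>
    if (j : ℕ) < D.bits then
      if right then
        some (.halveRight 1 0 fun b => pop D true q (j + 1) (x + b.toNat * 2 ^ (j : ℕ)))
      else
        some (.halveLeft 1 0 fun b => pop D false q (j + 1) (x + b.toNat * 2 ^ (j : ℕ)))
    else some (.expand 1 0 1 0 (scan D q (D.symbol x)))

theorem instructions_eq_none (s : NumberState D S) : instructions D M ss s = none ↔ s = none := by
  rcases s with _ | ⟨q, a⟩ | ⟨right, q, j, x⟩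
  · simp [instructions]
  · simp only [instructions]
    split <;> simp
  · simp only [instructions]
    split_ifs <;> simp

/-- The base is a power of two, so halving `D.bits` times removes one digit, and the parities met
are its bits, lowest first. Here `j` bits have been read and `i` are still to come. -/
theorem reaches_pop (right : Bool) (q : S) (i j x m n : ℕ) (hj : i + j = D.bits)
    (hx : x < 2 ^ j) :
    Reaches (numberStep (instructions D M ss)) (pop D right q j x, m, n)
      (scan D q (D.symbol (x + 2 ^ j * ((if right then n else m) % 2 ^ i))),
        if right then m else m / 2 ^ i, if right then n / 2 ^ i else n) := by
  have hlt : x < D.base := hx.trans_le (Nat.pow_le_pow_right (by norm_num) (by omega))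
  induction i generalizing j x m n with
  | zero =>
    refine ReflTransGen.single ?_
    have : min j D.bits = D.bits := by omega
    cases right <;>
    simp [numberStep, pop, instructions, this, Nat.mod_eq_of_lt hlt, Nat.mod_one]
  | succ i ih =>
    have hmin : min j D.bits = j := by omega
    have hlt' : j < D.bits := by omega
    have key : ∀ k : ℕ, x + k.bodd.toNat * 2 ^ j + 2 ^ (j + 1) * (k / 2 % 2 ^ i) =
        x + 2 ^ j * (k % 2 ^ (i + 1)) := by
      intro k
      have h₁ : k % 2 ^ (i + 1) = k % 2 + 2 * (k / 2 % 2 ^ i) := by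
        rw [Nat.pow_succ', Nat.mod_mul]
      rw [h₁, Nat.mod_two_of_bodd, pow_succ]
      ring
    have hb : ∀ k : ℕ, x + k.bodd.toNat * 2 ^ j < 2 ^ (j + 1) := by
      intro k
      have : k.bodd.toNat ≤ 1 := Bool.toNat_le _
      have := Nat.mul_le_mul_right (2 ^ j) this
      rw [pow_succ]
      omega
    have hb' : ∀ k : ℕ, x + k.bodd.toNat * 2 ^ j < D.base := fun k =>
      (hb k).trans_le (Nat.pow_le_pow_right (by norm_num) (by omega))
    cases right with
    | true =>
      have h := ih (j + 1) (x + n.bodd.toNat * 2 ^ j) m (n / 2) (by omega) (hb n) (hb' n)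
      refine ReflTransGen.head
        (b := (pop D true q (j + 1) (x + n.bodd.toNat * 2 ^ j), m, n / 2)) ?_ ?_
      · simp [numberStep, pop, instructions, hmin, hlt', Nat.mod_eq_of_lt hlt]
      · simp only [if_true] at h ⊢
        rw [key, Nat.div_div_eq_div_mul, ← pow_succ'] at h
        exact h
    | false =>
      have h := ih (j + 1) (x + m.bodd.toNat * 2 ^ j) (m / 2) n (by omega) (hb m) (hb' m)
      refine ReflTransGen.head
        (b := (pop D false q (j + 1) (x + m.bodd.toNat * 2 ^ j), m / 2, n)) ?_ ?_
      · simp [numberStep, pop, instructions, hmin, hlt', Nat.mod_eq_of_lt hlt]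
      · simp only [if_false, Bool.false_eq_true] at h ⊢
        rw [key, Nat.div_div_eq_div_mul, ← pow_succ'] at h
        exact h

theorem instructions_none {q : Λ} {hq : q ∈ S} {a : Γ} (h : M q a = none) :
    instructions D M ss (scan D ⟨q, hq⟩ a) = some (.expand 0 0 D.base (D.digit a) none) := by
  simp only [instructions, scan]
  split
  · rfl
  all_goals
    rename_i h'
    cases h'.symm.trans h

theorem instructions_write {q q' : Λ} {hq : q ∈ S} {a b : Γ} (h : M q a = some (q', .write b)) :
    instructions D M ss (scan D ⟨q, hq⟩ a) =
      some (.expand 1 0 1 0 (scan D ⟨q', ss.2 h hq⟩ b)) := by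
  simp only [instructions, scan]
  split <;>
  · rename_i h'
    cases h'.symm.trans h <;> rfl

theorem instructions_right {q q' : Λ} {hq : q ∈ S} {a : Γ} (h : M q a = some (q', .move .right)) :
    instructions D M ss (scan D ⟨q, hq⟩ a) =
      some (.expand D.base (D.digit a) 1 0 (pop D true ⟨q', ss.2 h hq⟩ 0 0)) := by
  simp only [instructions, scan]
  split <;>
  · rename_i h'
    cases h'.symm.trans h <;> rfl

theorem instructions_left {q q' : Λ} {hq : q ∈ S} {a : Γ} (h : M q a = some (q', .move .left)) :
    instructions D M ss (scan D ⟨q, hq⟩ a) =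
      some (.expand 1 0 D.base (D.digit a) (pop D false ⟨q', ss.2 h hq⟩ 0 0)) := by
  simp only [instructions, scan]
  split <;>
  · rename_i h'
    cases h'.symm.trans h <;> rfl

/-- A configuration of the machine with two numbers represents one of the given machine. -/
def Represents (c : TM0.Cfg Γ Λ) (d : NumberState D S × ℕ × ℕ) : Prop :=
  ∃ hq : c.q ∈ S, d = (scan D ⟨c.q, hq⟩ c.Tape.head, D.num c.Tape.left, D.num c.Tape.right)

/-- The half-tapes are stacks, stored as numbers. A move pushes the scanned symbol onto one of them
by an `expand` and pops the new one from the other by `reaches_pop`. -/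
theorem simulates_numberStep :
    Simulates (TM0.step M) (numberStep (instructions D M ss)) (Represents D)
      (fun c d => d = (none, 0, D.num c.Tape.right₀)) := by
  rintro ⟨q, T⟩ _ ⟨hq, rfl⟩
  obtain ⟨a, L, R⟩ := T
  dsimp only at hq ⊢
  cases hM : M q a with
  | none =>
    refine ⟨fun b hb => by simp [TM0.step, hM] at hb, fun _ => ⟨_, rfl, ?_⟩⟩
    refine mem_eval.2 ⟨ReflTransGen.single ?_, rfl⟩
    simp only [numberStep, instructions_none D M ss hM, Tape.right₀, D.num_cons]
    simp [Nat.add_comm]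
  | some o =>
    refine ⟨fun b hb => ?_, fun h => by simp [TM0.step, hM] at h⟩
    obtain ⟨q', st⟩ := o
    have hq' : q' ∈ S := ss.2 hM hq
    simp only [TM0.step, hM, Option.map_some, Option.some.injEq] at hb
    subst hb
    rcases st with (_ | _) | b
    · refine ⟨_, ⟨hq', rfl⟩, TransGen.head' (b := (pop D false ⟨q', hq'⟩ 0 0, D.num L,
        D.num (R.cons a))) ?_ ?_⟩
      · simp [numberStep, instructions_left D M ss hM, D.num_cons, Nat.add_comm]
      · have h := reaches_pop D M ss false ⟨q', hq'⟩ D.bits 0 0 (D.num L)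
          (D.num (R.cons a)) rfl (by norm_num)
        simp only [Bool.false_eq_true, if_false, pow_zero, one_mul, zero_add] at h
        rw [← DigitCoding.base, D.num_mod, D.num_div, D.symbol_digit] at h
        exact h
    · refine ⟨_, ⟨hq', rfl⟩, TransGen.head' (b := (pop D true ⟨q', hq'⟩ 0 0,
        D.num (L.cons a), D.num R)) ?_ ?_⟩
      · simp [numberStep, instructions_right D M ss hM, D.num_cons, Nat.add_comm]
      · have h := reaches_pop D M ss true ⟨q', hq'⟩ D.bits 0 0
          (D.num (L.cons a)) (D.num R) rfl (by norm_num)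
        simp only [if_true, pow_zero, one_mul, zero_add] at h
        rw [← DigitCoding.base, D.num_mod, D.num_div, D.symbol_digit] at h
        exact h
    · refine ⟨_, ⟨hq', rfl⟩, TransGen.single ?_⟩
      simp [numberStep, instructions_write D M ss hM, Tape.write]

end TapeMachine

end CivVI

namespace CivVI

/-! ## Binary notation -/

section Binary

open Turing.PartrecToTM2

/-- The symbol for a binary digit. -/
def bitSymbol (b : Bool) : Γ' := if b then .bit1 else .bit0

theorem trNat_of_ne_zero {n : ℕ} (hn : n ≠ 0) : trNat n = bitSymbol n.bodd :: trNat (n / 2) := by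
  have h : ∀ (b : Bool) (k : ℕ), Nat.bit b k ≠ 0 → trNat (Nat.bit b k) = bitSymbol b :: trNat k := by
    intro b k hk
    cases b with
    | true =>
      have : ((Nat.bit true k : ℕ) : Num) = (k : Num).bit1 := by
        rw [Nat.bit_true_apply]; push_cast; rw [← Num.bit1_of_bit1]; rw [two_mul]
      rw [trNat, this, trNat]
      cases (k : Num) <;> rfl
    | false =>
      have : ((Nat.bit false k : ℕ) : Num) = (k : Num).bit0 := by
        rw [Nat.bit_false_apply]; push_cast; rw [← Num.bit0_of_bit0]; rw [two_mul]
      have hk : (k : Num) ≠ 0 := by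
        intro h0
        apply hk
        have : k = 0 := by exact_mod_cast h0
        simp [this]
      rw [trNat, this, trNat]
      cases hk' : (k : Num) with
      | zero => exact absurd hk' hk
      | pos p => rfl
  have := h n.bodd n.div2 (by rwa [Nat.bit_bodd_div2])
  rwa [Nat.bit_bodd_div2, Nat.div2_val] at this

/-- One round of a loop over the binary digits of a number, from the lowest one. -/
def foldBitsStep (f : Bool → ℕ → ℕ) (p : ℕ × ℕ) : ℕ × ℕ :=
  if p.1 = 0 then p else (p.1 / 2, f p.1.bodd p.2)

/-- The loop is idle once the number is `0`, so any bound of at least `n` rounds will do; taking `n`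
itself makes the loop primitive recursive. -/
theorem iterate_foldBitsStep (f : Bool → ℕ → ℕ) (g : Γ' → ℕ → ℕ)
    (hg : ∀ b, g (bitSymbol b) = f b) (k n x : ℕ) (hn : n ≤ k) :
    (foldBitsStep f)^[k] (n, x) = (0, (trNat n).foldl (fun x a => g a x) x) := by
  induction k generalizing n x with
  | zero =>
    obtain rfl : n = 0 := by omega
    simp
  | succ k ih =>
    rw [Function.iterate_succ_apply]
    by_cases h : n = 0
    · subst h
      have : foldBitsStep f (0, x) = (0, x) := by simp [foldBitsStep]
      rw [this, ih _ _ (by omega)]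
    · have : foldBitsStep f (n, x) = (n / 2, f n.bodd x) := by simp [foldBitsStep, h]
      rw [this, ih _ _ (by omega), trNat_of_ne_zero h, List.foldl_cons, hg]

theorem computable_iterate_foldBitsStep {f : Bool → ℕ → ℕ} (hf : Primrec₂ f) :
    Primrec fun n => ((foldBitsStep f)^[n] (n, 0)).2 := by
  have h : Primrec (foldBitsStep f) := by
    refine Primrec.ite (Primrec.eq.comp Primrec.fst (Primrec.const 0)) Primrec.id ?_
    exact Primrec.pair (Primrec.nat_div.comp Primrec.fst (Primrec.const 2))
      (hf.comp (Primrec.nat_bodd.comp Primrec.fst) Primrec.snd)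
  exact Primrec.snd.comp (Primrec.nat_iterate Primrec.id
    (Primrec.pair Primrec.id (Primrec.const 0)) (h.comp₂ Primrec₂.right))

theorem foldr_trNat (n : ℕ) :
    (trNat n).foldr (fun a x => 2 * x + if a = .bit1 then 1 else 0) 0 = n := by
  induction n using Nat.strong_induction_on with
  | _ n ih =>
    by_cases h : n = 0
    · subst h; simp
    · rw [trNat_of_ne_zero h, List.foldr_cons, ih _ (by omega)]
      have h₁ := Nat.bodd_add_div2 n
      rw [Nat.div2_val] at h₁
      cases hb : n.bodd <;> simp [hb, bitSymbol] at h₁ ⊢ <;> omega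

theorem mem_trNat {n : ℕ} {a : Γ'} (h : a ∈ trNat n) : a = .bit0 ∨ a = .bit1 := by
  induction n using Nat.strong_induction_on with
  | _ n ih =>
    by_cases hn : n = 0
    · subst hn; simp at h
    · rw [trNat_of_ne_zero hn, List.mem_cons] at h
      rcases h with rfl | h
      · cases n.bodd <;> simp [bitSymbol]
      · exact ih _ (by omega) h

end Binary

/-! ## Reading digits -/

/-- One round of a loop that reads binary digits, highest first, from a number that is written to
the base `B`, where `bit` says which digits stand for `0` and `1`. -/
def readStep (B : ℕ) (bit : ℕ → Option Bool) (p : ℕ × ℕ) : ℕ × ℕ :=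
  ((bit (p.1 % B)).map fun b => (p.1 / B, 2 * p.2 + b.toNat)).getD p

theorem primrec_iterate_readStep {B : ℕ} {bit : ℕ → Option Bool} (hb : Primrec bit) :
    Primrec fun n => ((readStep B bit)^[n] (n / B, 0)).2 := by
  have h : Primrec (readStep B bit) := by
    refine Primrec.option_getD.comp (Primrec.option_map
      (hb.comp (Primrec.nat_mod.comp Primrec.fst (Primrec.const B))) ?_) Primrec.id
    refine Primrec.pair (Primrec.nat_div.comp (Primrec.fst.comp Primrec.fst) (Primrec.const B)) ?_
    refine Primrec.nat_add.comp (Primrec.nat_mul.comp (Primrec.const 2)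
      (Primrec.snd.comp Primrec.fst)) ?_
    exact (Primrec.dom_bool Bool.toNat).comp Primrec.snd
  exact Primrec.snd.comp (Primrec.nat_iterate Primrec.id
    (Primrec.pair (Primrec.nat_div.comp Primrec.id (Primrec.const B)) (Primrec.const 0))
    (h.comp₂ Primrec₂.right))

theorem primrec_of_forall_ge {α : Type*} [Primcodable α] (f : ℕ → α) (n : ℕ) (d : α)
    (hf : ∀ i, n ≤ i → f i = d) : Primrec f := by
  have h : f = fun i => ((List.range n).map f).getD i d := by
    funext i
    rw [List.getD_eq_getElem?_getD]
    by_cases hi : i < n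
    · simp [hi]
    · simp [hi, hf i (by omega)]
  rw [h]
  exact Primrec.list_getD d |>.comp (Primrec.const _) Primrec.id

end CivVI

namespace CivVI

/-! ### Input and output on the tape of Mathlib's machine for a partial recursive function -/

namespace TapeMachine

open Turing TM2to1

instance : Finite PartrecToTM2.K' :=
  Finite.of_surjective (fun x : Bool × Bool => match x with
    | (true, true) => PartrecToTM2.K'.main
    | (true, false) => PartrecToTM2.K'.rev
    | (false, true) => PartrecToTM2.K'.aux
    | (false, false) => PartrecToTM2.K'.stack) fun y => by
      cases y
      exacts [⟨(true, true), rfl⟩, ⟨(true, false), rfl⟩, ⟨(false, true), rfl⟩,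
        ⟨(false, false), rfl⟩]

/-- The contents of one cell of each of the four stacks. -/
abbrev StackCell : Type := ∀ _ : PartrecToTM2.K', Option PartrecToTM2.Γ'

/-- The alphabet of the one-tape machine for a partial recursive function. -/
abbrev TapeSymbol : Type := TM2to1.Γ' PartrecToTM2.K' fun _ => PartrecToTM2.Γ'

instance : Finite TapeSymbol := inferInstanceAs (Finite (Bool × StackCell))

variable (D : DigitCoding TapeSymbol)

/-- A cell above the bottom of the stacks. -/
def upperCell (x : StackCell) : TapeSymbol := ((false, x) : Bool × StackCell)

/-- The contents of a cell in the main stack. -/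
def mainOf (a : TapeSymbol) : Option PartrecToTM2.Γ' := (show Bool × StackCell from a).2 .main

/-- The binary digit for which a symbol stands. -/
def bitOf : Option PartrecToTM2.Γ' → Option Bool
  | some .bit0 => some false
  | some .bit1 => some true
  | _ => none

/-- The binary digit in the main stack that belongs to a digit of the base. -/
def mainBit (d : ℕ) : Option Bool := if d < D.base then bitOf (mainOf (D.symbol d)) else none

theorem primrec_mainBit : Primrec (mainBit D) :=
  primrec_of_forall_ge _ D.base none fun i hi => by simp [mainBit, Nat.not_lt.2 hi]

theorem mainBit_digit (a : TapeSymbol) : mainBit D (D.digit a) = bitOf (mainOf a) := by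
  rw [mainBit, D.symbol_digit]
  exact if_pos (D.digit_lt a)

/-- The tape cells above the bottom of the stacks. -/
def upper (L : ListBlank StackCell) : ListBlank TapeSymbol :=
  L.map (⟨Prod.mk false, rfl⟩ : PointedMap StackCell TapeSymbol)

theorem head_upper (L : ListBlank StackCell) :
    (upper L).head = upperCell L.head := ListBlank.head_map _ _

theorem tail_upper (L : ListBlank StackCell) : (upper L).tail = upper L.tail :=
  ListBlank.tail_map _ _

theorem head_main {L : ListBlank StackCell} {l : List (Option PartrecToTM2.Γ')}
    (h : L.map (proj .main) = ListBlank.mk l) : L.head .main = l.headI := by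
  have := congrArg ListBlank.head h
  rw [ListBlank.head_map, ListBlank.head_mk] at this
  exact this

theorem tail_main {L : ListBlank StackCell} {l : List (Option PartrecToTM2.Γ')}
    (h : L.map (proj .main) = ListBlank.mk l) :
    L.tail.map (proj .main) = ListBlank.mk l.tail := by
  rw [← ListBlank.tail_map, h, ListBlank.tail_mk]

/-- Only the blank symbol has the digit `0`, so every occupied cell adds at least one. Thus the
number itself bounds the rounds needed to read the stack. -/
theorem length_le_num_upper {l : List PartrecToTM2.Γ'} {L : ListBlank StackCell}
    (h : L.map (proj .main) = ListBlank.mk (l.map some)) : l.length ≤ D.num (upper L) := by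
  induction l generalizing L with
  | nil => simp
  | cons a l ih =>
    have h₁ := ih (tail_main h)
    have h₂ := head_main h
    rw [D.num_eq, tail_upper, List.length_cons]
    have h₃ : D.digit (upper L).head ≠ 0 := by
      intro h0
      rw [← D.digit_default] at h0
      have := congrArg D.symbol h0
      rw [D.symbol_digit, D.symbol_digit, head_upper] at this
      have : L.head .main = none := congrArg mainOf this
      rw [h₂] at this
      cases this
    have h₄ : D.num (upper L.tail) ≤ D.base * D.num (upper L.tail) :=
      Nat.le_mul_of_pos_left _ D.base_pos
    omega

theorem iterate_readStep {l : List PartrecToTM2.Γ'} (hl : ∀ a ∈ l, a = .bit0 ∨ a = .bit1)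
    {L : ListBlank StackCell} (h : L.map (proj .main) = ListBlank.mk (l.map some)) (k v : ℕ)
    (hk : l.length ≤ k) :
    ((readStep D.base (mainBit D))^[k] (D.num (upper L), v)).2 =
      l.foldl (fun x a => 2 * x + if a = .bit1 then 1 else 0) v := by
  induction l generalizing L k v with
  | nil =>
    have h₂ : L.head .main = none := head_main h
    have : readStep D.base (mainBit D) (D.num (upper L), v) = (D.num (upper L), v) := by
      rw [readStep, D.num_mod, mainBit_digit, head_upper]
      simp only [show mainOf (upperCell L.head) = none from h₂]
      rfl
    rw [Function.iterate_fixed this]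
    rfl
  | cons a l ih =>
    obtain ⟨k, rfl⟩ : ∃ k', k = k' + 1 := ⟨k - 1, by simp at hk; omega⟩
    have h₂ : L.head .main = some a := head_main h
    rw [Function.iterate_succ_apply]
    have : readStep D.base (mainBit D) (D.num (upper L), v) =
        (D.num (upper L.tail), 2 * v + if a = .bit1 then 1 else 0) := by
      rw [readStep, D.num_mod, D.num_div, mainBit_digit, head_upper, tail_upper]
      simp only [show mainOf (upperCell L.head) = some a from h₂]
      rcases hl a (by simp) with rfl | rfl <;> rfl
    rw [this, ih (fun x hx => hl x (by simp [hx])) (tail_main h) _ _ (by simpa using hk)]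
    rfl

/-- The number stored in the main stack. -/
def output (N : ℕ) : ℕ := ((readStep D.base (mainBit D))^[N] (N / D.base, 0)).2

theorem primrec_output : Primrec (output D) := primrec_iterate_readStep (primrec_mainBit D)

/-- On the tape the stack lies bottom first. The bottom cell holds the end mark `cons`, which the
division by the base skips; the binary digits follow, highest first, and the reading loop is idle
from the first empty cell on. -/
theorem output_num {L : ListBlank StackCell} {m : ℕ}
    (h : L.map (proj .main) =
      ListBlank.mk ((PartrecToTM2.trList [m]).map some).reverse) :
    output D (D.num (addBottom L)) = m := by
  have h' : L.tail.map (proj .main) = ListBlank.mk ((PartrecToTM2.trNat m).reverse.map some) := by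
    rw [tail_main h]
    simp [PartrecToTM2.trList]
  have h₁ : (addBottom L).tail = upper L.tail := ListBlank.tail_cons _ _
  rw [output, D.num_div, h₁, iterate_readStep D (fun a ha => mem_trNat (List.mem_reverse.1 ha)) h',
    List.foldl_reverse, foldr_trNat]
  refine (length_le_num_upper D h').trans ?_
  rw [D.num_eq (addBottom L), h₁]
  exact (Nat.le_mul_of_pos_left _ D.base_pos).trans (Nat.le_add_left _ _)

/-- The cell with a given symbol in the main stack, above the bottom. -/
def mainSymbol (a : PartrecToTM2.Γ') : TapeSymbol :=
  ((false, Function.update (fun _ => none) .main (some a)) : Bool × StackCell)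

/-- The number that represents the half-tape with a number in the main stack. -/
def input (n : ℕ) : ℕ :=
  ((foldBitsStep fun b x => D.digit (mainSymbol (bitSymbol b)) + D.base * x)^[n] (n, 0)).2

theorem input_eq (n : ℕ) :
    input D n = D.ofList ((PartrecToTM2.trNat n).reverse.map mainSymbol) := by
  rw [input, iterate_foldBitsStep _ (fun a x => D.digit (mainSymbol a) + D.base * x)
    (fun b => rfl) n n 0 le_rfl, DigitCoding.ofList, List.foldr_map, List.foldr_reverse]

theorem primrec_input : Primrec (input D) := by
  refine computable_iterate_foldBitsStep ?_
  refine Primrec.nat_add.comp ((Primrec.dom_bool fun b => D.digit (mainSymbol (bitSymbol b))).comp Primrec.fst) ?_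
  exact Primrec.nat_mul.comp (Primrec.const _) Primrec.snd

end TapeMachine

open Turing in
-- Mathlib compiles `f` to a machine with four stacks, then to one tape, then to elementary
-- instructions; `simulates_numberStep` adds the last stage. The input lies to the right of the
-- head, so the first number is `0` at the start.
theorem exists_numberMachine {f : ℕ →. ℕ} (hf : Partrec f) :
    ∃ (σ : Type) (_ : Finite σ) (I : σ → Option (Instr σ)) (H s₀ : σ) (input output : ℕ → ℕ),
      (∀ s, I s = none ↔ s = H) ∧ Primrec input ∧ Primrec output ∧
      ∀ n, ((eval (numberStep I) (s₀, 0, input n)).Dom ↔ (f n).Dom) ∧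
        ∀ c ∈ eval (numberStep I) (s₀, 0, input n), c.2.1 = 0 ∧ output c.2.2 ∈ f n := by
  obtain ⟨c, hc⟩ := ToPartrec.Code.exists_code (Nat.Partrec'.part_iff₁.2 hf)
  -- Mathlib's machines start at the default label, which therefore has to be the entry point of the
  -- code for `f`.
  let _ : Inhabited PartrecToTM2.Λ' :=
    ⟨PartrecToTM2.trNormal c PartrecToTM2.Cont'.halt⟩
  let _ : Fintype PartrecToTM2.K' := Fintype.ofFinite _
  obtain ⟨D⟩ := nonempty_digitCoding TapeMachine.TapeSymbol
  have ss₂ := PartrecToTM2.tr_supports c PartrecToTM2.Cont'.halt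
  -- All labels that are used lie in a finite set; this makes the state space of the machine with
  -- two numbers finite.
  have ss := TM1to0.tr_supports _ (TM2to1.tr_supports _ ss₂)
  set M₂ : PartrecToTM2.Λ' →
    TM2.Stmt (fun _ : PartrecToTM2.K' => PartrecToTM2.Γ') PartrecToTM2.Λ'
      (Option PartrecToTM2.Γ') := PartrecToTM2.tr
  set M := TM1to0.tr (TM2to1.tr M₂)
  have hinit : ∀ v, TM2.eval M₂ .main (PartrecToTM2.trList v) =
      (c.eval v).map PartrecToTM2.trList := by
    intro v
    have : (TM2.init .main (PartrecToTM2.trList v) : PartrecToTM2.Cfg') =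
        PartrecToTM2.init c v := by
      rw [TM2.init, PartrecToTM2.init]
      congr 1
      funext k
      cases k <;> rfl
    let g : PartrecToTM2.Cfg' → List PartrecToTM2.Γ' := fun x => TM2.Cfg.stk x .main
    have h : TM2.eval M₂ .main (PartrecToTM2.trList v) =
        (eval (TM2.step M₂) (TM2.init .main (PartrecToTM2.trList v))).map g := rfl
    rw [h, this, PartrecToTM2.tr_eval]
    exact Part.map_map _ _ _
  have hM : ∀ v, TM0.eval M (TM2to1.trInit .main (PartrecToTM2.trList v)) =
    TM1.eval (TM2to1.tr M₂) (TM2to1.trInit .main (PartrecToTM2.trList v)) := fun v =>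
    TM1to0.tr_eval _ _
  have hsim := TapeMachine.simulates_numberStep D M ss
  -- The symbol scanned at first is the bottom cell with `cons`, the same for all inputs; so the one
  -- for the input `0` can be built into the start state.
  refine ⟨TapeMachine.NumberState D _, inferInstance, TapeMachine.instructions D M ss, none,
    TapeMachine.scan D ⟨default, ss.1⟩
      (TM2to1.trInit .main (PartrecToTM2.trList [0])).headI,
    TapeMachine.input D, TapeMachine.output D, TapeMachine.instructions_eq_none D M ss,
    TapeMachine.primrec_input D, TapeMachine.primrec_output D, fun n => ?_⟩
  have htr : TapeMachine.Represents D (TM0.init (TM2to1.trInit .main (PartrecToTM2.trList [n])))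
      (TapeMachine.scan D ⟨default, ss.1⟩
        (TM2to1.trInit .main (PartrecToTM2.trList [0])).headI, 0, TapeMachine.input D n) := by
    have h : ∀ n, TM2to1.trInit .main (PartrecToTM2.trList [n]) =
        ((true, Function.update (fun _ => none) .main (some .cons)) :
          Bool × TapeMachine.StackCell) ::
        (PartrecToTM2.trNat n).reverse.map TapeMachine.mainSymbol := by
      intro n
      simp [TM2to1.trInit, PartrecToTM2.trList]
      rfl
    refine ⟨ss.1, ?_⟩
    rw [TapeMachine.input_eq, h, h]
    rfl
  have hcode : c.eval [n] = pure <$> f n := hc ⟨[n], rfl⟩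
  have hdom : (TM1.eval (TM2to1.tr M₂) (TM2to1.trInit .main (PartrecToTM2.trList [n]))).Dom ↔
      (f n).Dom := by
    refine (TM2to1.tr_eval_dom M₂ .main _).trans ?_
    rw [hinit, hcode]
    rfl
  constructor
  · rw [hsim.dom_iff htr, ← hdom, ← hM]
    rfl
  · intro d hd
    obtain ⟨e, he⟩ := Part.dom_iff_mem.1 ((hsim.dom_iff htr).1 (Part.dom_iff_mem.2 ⟨d, hd⟩))
    obtain ⟨d', hd', he'⟩ := hsim.exists_mem_eval htr he
    obtain rfl := Part.mem_unique hd he'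
    have h₁ : e.Tape.right₀ ∈ TM1.eval (TM2to1.tr M₂)
        (TM2to1.trInit .main (PartrecToTM2.trList [n])) := by
      rw [← hM]
      exact Part.mem_map _ he
    obtain ⟨m, hm⟩ := Part.dom_iff_mem.1 (hdom.1 (Part.dom_iff_mem.2 ⟨_, h₁⟩))
    have h₂ : PartrecToTM2.trList [m] ∈ TM2.eval M₂ .main (PartrecToTM2.trList [n]) := by
      rw [hinit, hcode]
      exact Part.mem_map _ (Part.mem_map _ hm)
    obtain ⟨S, L, hL, hS, hS'⟩ := TM2to1.tr_eval M₂ _ _ h₁ h₂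
    rw [hd', ← hL]
    refine ⟨rfl, ?_⟩
    rwa [TapeMachine.output_num D (hS' ▸ hS .main)]

end CivVI

namespace CivVI

/-! ## An interpreter for descriptions of Turing machines -/

namespace Description

/-- The instruction for a state and a symbol: the first quintuple that fits. -/
def lookup (D : Description) (q a : ℕ) : Option (ℕ × ℕ × ℕ × ℕ × Bool) :=
  D.2.2[D.2.2.findIdx fun t => decide ((t.1, t.2.1) = (q, a))]?

/-- One step of the machine with a given description. -/
def step (p : Description × Config ℕ ℕ) : Option (Description × Config ℕ ℕ) :=
  (lookup p.1 p.2.1 p.2.2.2.1).map fun t =>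
    (p.1, t.2.2.1,
      bif t.2.2.2.2 then
        (t.2.2.2.1 :: p.2.2.1, p.2.2.2.2.head?.getD p.1.2.1, p.2.2.2.2.tail)
      else (p.2.2.1.tail, p.2.2.1.head?.getD p.1.2.1, t.2.2.2.1 :: p.2.2.2.2))

theorem primrec_step : Primrec step := by
  have hidx : Primrec fun p : Description × Config ℕ ℕ =>
      p.1.2.2.findIdx fun t => decide ((t.1, t.2.1) = (p.2.1, p.2.2.2.1)) := by
    refine Primrec.list_findIdx (Primrec.snd.comp (Primrec.snd.comp Primrec.fst)) ?_
    have h₁ : Primrec fun x : (Description × Config ℕ ℕ) × (ℕ × ℕ × ℕ × ℕ × Bool) =>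
        (x.2.1, x.2.2.1) := Primrec.pair (Primrec.fst.comp Primrec.snd)
          (Primrec.fst.comp (Primrec.snd.comp Primrec.snd))
    have h₂ : Primrec fun x : (Description × Config ℕ ℕ) × (ℕ × ℕ × ℕ × ℕ × Bool) =>
        (x.1.2.1, x.1.2.2.2.1) := Primrec.pair (Primrec.fst.comp (Primrec.snd.comp Primrec.fst))
          (Primrec.fst.comp (Primrec.snd.comp (Primrec.snd.comp (Primrec.snd.comp Primrec.fst))))
    exact (Primrec.eq.comp h₁ h₂).decide
  have hl : Primrec fun p : Description × Config ℕ ℕ => lookup p.1 p.2.1 p.2.2.2.1 :=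
    Primrec.list_getElem?.comp (Primrec.snd.comp (Primrec.snd.comp Primrec.fst)) hidx
  refine Primrec.option_map hl ?_
  have hp : Primrec fun x : (Description × Config ℕ ℕ) × (ℕ × ℕ × ℕ × ℕ × Bool) => x.1 :=
    Primrec.fst
  have ht : Primrec fun x : (Description × Config ℕ ℕ) × (ℕ × ℕ × ℕ × ℕ × Bool) => x.2.2.2 :=
    Primrec.snd.comp (Primrec.snd.comp Primrec.snd)
  have hL : Primrec fun x : (Description × Config ℕ ℕ) × (ℕ × ℕ × ℕ × ℕ × Bool) => x.1.2.2.1 :=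
    Primrec.fst.comp (Primrec.snd.comp (Primrec.snd.comp hp))
  have hR : Primrec fun x : (Description × Config ℕ ℕ) × (ℕ × ℕ × ℕ × ℕ × Bool) => x.1.2.2.2.2 :=
    Primrec.snd.comp (Primrec.snd.comp (Primrec.snd.comp (Primrec.snd.comp hp)))
  have hb : Primrec fun x : (Description × Config ℕ ℕ) × (ℕ × ℕ × ℕ × ℕ × Bool) => x.1.1.2.1 :=
    Primrec.fst.comp (Primrec.snd.comp (Primrec.fst.comp hp))
  have ha : Primrec fun x : (Description × Config ℕ ℕ) × (ℕ × ℕ × ℕ × ℕ × Bool) =>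
      x.2.2.2.2.1 := Primrec.fst.comp (Primrec.snd.comp ht)
  refine Primrec.pair (Primrec.fst.comp hp) (Primrec.pair (Primrec.fst.comp ht) ?_)
  refine Primrec.cond (Primrec.snd.comp (Primrec.snd.comp ht)) ?_ ?_
  · exact Primrec.pair (Primrec.list_cons.comp ha hL) (Primrec.pair
      (Primrec.option_getD.comp (Primrec.list_head?.comp hR) hb) (Primrec.list_tail.comp hR))
  · exact Primrec.pair (Primrec.list_tail.comp hL) (Primrec.pair
      (Primrec.option_getD.comp (Primrec.list_head?.comp hL) hb) (Primrec.list_cons.comp ha hR))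

/-- The initial configuration on an input, together with the description. -/
def init (p : Description × List ℕ) : Description × Config ℕ ℕ :=
  (p.1, p.1.1, [], p.2.head?.getD p.1.2.1, p.2.tail)

theorem primrec_init : Primrec init := by
  refine Primrec.pair Primrec.fst (Primrec.pair (Primrec.fst.comp Primrec.fst)
    (Primrec.pair (Primrec.const []) (Primrec.pair ?_ (Primrec.list_tail.comp Primrec.snd))))
  exact Primrec.option_getD.comp (Primrec.list_head?.comp Primrec.snd)
    (Primrec.fst.comp (Primrec.snd.comp Primrec.fst))

/-- The final configuration of the machine with a given description on a given input. -/
def interpret (p : Description × List ℕ) : Part (Config ℕ ℕ) :=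
  (eval step (init p)).map Prod.snd

theorem partrec_interpret : Partrec interpret := by
  have h : Partrec (eval step) := by
    refine Partrec.fix (Computable.partrec ?_)
    refine ((Primrec.option_casesOn primrec_step (Primrec.sumInl.comp Primrec.id)
      (Primrec.sumInr.comp Primrec.snd).to₂).of_eq fun p => ?_).to_comp
    cases step p <;> rfl
  exact (h.comp primrec_init.to_comp).map (Computable.snd.comp Computable.snd)

end Description

namespace TM

variable {m n : ℕ} (M : TM (Fin m) (Fin n))

theorem mem_describe {t : ℕ × ℕ × ℕ × ℕ × Bool} :
    t ∈ M.describe.2.2 ↔ ∃ q a o, M.δ q a = some o ∧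
      ((q : ℕ), (a : ℕ), (o.1 : ℕ), (o.2.1 : ℕ), o.2.2.isRight) = t := by
  simp only [describe, List.mem_flatMap, List.mem_finRange, true_and, List.mem_filterMap,
    Option.map_eq_some_iff]

/-- All quintuples for one state and symbol coincide, since they come from a function, so the search
for the first fit loses nothing. -/
theorem lookup_describe (q : Fin m) (a : Fin n) :
    M.describe.lookup q a =
      (M.δ q a).map fun o => ((q : ℕ), (a : ℕ), (o.1 : ℕ), (o.2.1 : ℕ), o.2.2.isRight) := by
  rw [Description.lookup]
  by_cases h : M.describe.2.2.findIdx (fun t => decide ((t.1, t.2.1) = ((q : ℕ), (a : ℕ)))) <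
      M.describe.2.2.length
  · rw [List.getElem?_eq_getElem h]
    obtain ⟨q', a', o, ho, ht⟩ := M.mem_describe.1 (List.getElem_mem h)
    have h₁ := List.findIdx_getElem (w := h)
    rw [← ht] at h₁ ⊢
    simp only [decide_eq_true_eq, Prod.mk.injEq, Fin.val_inj] at h₁
    obtain ⟨rfl, rfl⟩ := h₁
    rw [ho]
    rfl
  · rw [List.getElem?_eq_none (not_lt.1 h)]
    cases ho : M.δ q a with
    | none => rfl
    | some o =>
      refine absurd (List.findIdx_lt_length_of_exists ⟨_, M.mem_describe.2 ⟨q, a, o, ho, rfl⟩, ?_⟩) h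
      simp

theorem step_describe (c : Config (Fin m) (Fin n)) :
    Description.step (M.describe, c.toNat) =
      (M.step c).map fun c => (M.describe, c.toNat) := by
  obtain ⟨q, l, a, r⟩ := c
  have h : Description.lookup (M.describe, Config.toNat (q, l, a, r)).1
      (M.describe, Config.toNat (q, l, a, r)).2.1
      (M.describe, Config.toNat (q, l, a, r)).2.2.2.1 = _ := M.lookup_describe q a
  rw [Description.step, h, step]
  rcases M.δ q a with _ | ⟨q', a', _ | _⟩
  · rfl
  · cases l <;> simp [Config.toNat, Dir.isRight, describe]
  · cases r <;> simp [Config.toNat, Dir.isRight, describe]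

theorem interpret_describe (w : List (Fin n)) :
    Description.interpret (M.describe, w.map Fin.val) =
      (eval M.step (M.init w)).map Config.toNat := by
  have hresp : Respects M.step Description.step fun a b => (M.describe, a.toNat) = b := by
    rw [fun_respects]
    intro c
    have := M.step_describe c
    cases hc : M.step c with
    | none => rw [hc] at this; exact this
    | some d => rw [hc] at this; exact TransGen.single this
  have hinit : Description.init (M.describe, w.map Fin.val) =
      (M.describe, (M.init w).toNat) := by
    cases w <;> simp [Description.init, init, Config.toNat, describe]
  have h := tr_eval' M.step Description.step (fun c => (M.describe, c.toNat)) hresp (M.init w)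
  rw [Description.interpret, hinit, h, Part.map_eq_map, Part.map_map]
  rfl

end TM

end CivVI

namespace CivVI

/-! ## The machine is universal -/

namespace Rogozhin

open CivVI.Symbol

/-- Count the pairs of worked tiles; the first component holds the first symbol of an incomplete
pair. -/
def countStep : Option Symbol × ℕ → Symbol → Option Symbol × ℕ
  | (none, n), s => (some s, n)
  | (some t, n), s => (none, n + if t = worked ∧ s = worked then 1 else 0)

/-- The number of pairs of worked tiles. -/
def countPairs (l : List Symbol) : ℕ := (l.foldl countStep (none, 0)).2

theorem primrec_countPairs : Primrec countPairs := by
  have h : Primrec fun x : (Option Symbol × ℕ) × Symbol => countStep x.1 x.2 := by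
    have h' : Primrec fun x : (Option Symbol × ℕ) × Symbol =>
        (Option.casesOn x.1.1 (some x.2, x.1.2) fun t =>
          (none, x.1.2 + if t = worked ∧ x.2 = worked then 1 else 0) : Option Symbol × ℕ) := by
      refine Primrec.option_casesOn (Primrec.fst.comp Primrec.fst)
        (Primrec.pair (Primrec.option_some.comp Primrec.snd) (Primrec.snd.comp Primrec.fst)) ?_
      refine Primrec.pair (Primrec.const none) (Primrec.nat_add.comp
        (Primrec.snd.comp (Primrec.fst.comp Primrec.fst)) ?_)
      exact (Primrec.dom_finite fun y : Symbol × Symbol =>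
        if y.1 = worked ∧ y.2 = worked then 1 else 0).comp
        (Primrec.pair Primrec.snd (Primrec.snd.comp Primrec.fst))
    refine h'.of_eq ?_
    rintro ⟨⟨_ | t, n⟩, s⟩ <;> rfl
  exact Primrec.snd.comp (Primrec.list_foldl Primrec.id (Primrec.const (none, 0))
    (h.comp Primrec.snd).to₂)

theorem foldl_countStep_rightOf (V : List Cell) (n : ℕ) :
    (rightOf V).foldl countStep (none, n) = (none, n + V.count (worked, worked)) := by
  induction V generalizing n with
  | nil => rfl
  | cons c V ih =>
    rw [rightOf_cons, List.foldl_cons, List.foldl_cons, countStep, countStep, ih, List.count_cons]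
    congr 1
    obtain ⟨s, t⟩ := c
    cases s <;> cases t <;> simp
    omega

theorem foldl_countStep_idle (p : Option Symbol × ℕ) (j : ℕ) :
    ((List.replicate j idle).foldl countStep p).2 = p.2 := by
  induction j generalizing p with
  | zero => rfl
  | succ j ih =>
    rw [List.replicate_succ, List.foldl_cons, ih]
    rcases p with ⟨_ | t, n⟩ <;> simp [countStep]

/-- The trailing blanks stand for the cells that the finite tape may list in excess; they must not
affect the decoder. -/
theorem countPairs_rightOf (V : List Cell) (j : ℕ) :
    countPairs (rightOf V ++ List.replicate j idle) = V.count (worked, worked) := by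
  rw [countPairs, List.foldl_append, foldl_countStep_rightOf, foldl_countStep_idle, zero_add]

theorem count_separated (prods : List (List ℕ)) (w : List ℕ) :
    (separated prods w).count (worked, worked) = w.length := by
  induction w with
  | nil => rfl
  | cons a w ih =>
    have h : (unary (code prods a)).count (worked, worked) = 0 := by
      rw [List.count_eq_zero]
      intro h
      have := List.eq_of_mem_replicate h
      simp at this
    rw [separated, List.flatMap_cons, ← separated, List.cons_append, List.count_cons_self,
      List.count_append, h, ih, List.length_cons, zero_add]

theorem rightOf_flatten_replicate (n : ℕ) (V : List Cell) :
    rightOf (List.replicate n V).flatten = (List.replicate n (rightOf V)).flatten := by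
  induction n with
  | zero => rfl
  | succ n ih => simp [List.replicate_succ, ih]

theorem even_length_rightOf (V : List Cell) : Even (rightOf V).length := by
  simp [rightOf]

theorem even_length_leftOf (V : List Cell) : Even (leftOf V).length := by
  simp [leftOf]

/-- The configurations for machines with two numbers, the first of which is zero, consist of a
fixed part and of copies of a block. -/
theorem exists_wordConfig_eq {σ : Type} (prods : List (List ℕ))
    (num : NumberMachine.Letter σ → ℕ) (s : σ) :
    ∃ l r blk : List Symbol, Even l.length ∧ Odd r.length ∧ Even blk.length ∧ ∀ n,
      wordConfig prods 0 ((NumberMachine.word s 0 n).map num) =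
        (0, l, idle, r ++ (List.replicate n blk).flatten) := by
  set x := num (s, .standard, .leftHead)
  set y := num (s, .standard, .rightHead)
  set z := num (s, .standard, .rightTail)
  have hcode : unary (code prods x) = (idle, worked) :: unary (codePred prods x) :=
    List.replicate_succ
  refine ⟨leftOf (leftCells prods 0) ++ [worked, worked],
    worked :: rightOf (unary (codePred prods x) ++ separated prods [x, y, y]),
    rightOf (separated prods [z, z]), ?_, ?_, even_length_rightOf _, fun n => ?_⟩
  · rw [List.length_append]
    exact (even_length_leftOf _).add even_two
  · rw [List.length_cons]
    exact (even_length_rightOf _).add_one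
  · have hw : (NumberMachine.word s 0 n).map num =
        x :: ([x, y, y] ++ (List.replicate n [z, z]).flatten) := by
      have : ∀ n, (double (fun p => (s, NumberMachine.Phase.standard, p))
          (fun p => (s, NumberMachine.Phase.standard, p))
            (List.replicate n NumberMachine.Place.rightTail)).map num =
              (List.replicate n [z, z]).flatten := by
        intro n
        induction n with
        | zero => rfl
        | succ n ih => simp [List.replicate_succ, ih, z]
      simp [NumberMachine.word, NumberMachine.places, this, x, y]
    have hs : ∀ n, separated prods (List.replicate n [z, z]).flatten =
        (List.replicate n (separated prods [z, z])).flatten := by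
      intro n
      induction n with
      | zero => rfl
      | succ n ih =>
        rw [List.replicate_succ, List.replicate_succ, List.flatten_cons, List.flatten_cons,
          separated_append, ih]
    rw [hw, wordConfig, wordCells, separated_append, hs, hcode, headRight, List.cons_append,
      rightOf_cons, List.headD_cons, List.tail_cons, rightOf_append, rightOf_append,
      rightOf_append, rightOf_flatten_replicate]
    simp

end Rogozhin

open Rogozhin in
-- One machine with two numbers is fixed, for the interpreter as a partial function of natural
-- numbers. Its program on the tape does not depend on the input, which only enters through the
-- number of copies of a block of symbols; hence the encoder is computable.
theorem isUTM_rogozhin : IsUTM 48 2 State Symbol rogozhin.flaggedStep rogozhin.flaggedInitial := by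
  have hF : Partrec (fun n : ℕ => (Part.ofOption (Encodable.decode n)).bind
      fun p : Description × List ℕ => (Description.interpret p).map Encodable.encode) :=
    Partrec.nat_iff.2 Description.partrec_interpret
  obtain ⟨σ, _, I, H, s₀, input, output, hH, hin, hout, heval⟩ := exists_numberMachine hF
  obtain ⟨prods, num, hsim⟩ := NumberMachine.simulates_rogozhin hH
  have hsim' := rogozhin.simulates_flaggedStep
  obtain ⟨l, r, blk, hl, hr, hblk, hconf⟩ := exists_wordConfig_eq prods num s₀
  set enc : Description × List ℕ → Config State Symbol := fun p =>
    ((0, .b), l, .idle, r ++ (List.replicate (input (Encodable.encode p)) blk).flatten) with henc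
  have hflag : ∀ p, rogozhin.flag 0 (enc p).2.1 .idle (enc p).2.2.2 = .b := by
    intro p
    obtain ⟨a, r', rfl⟩ : ∃ a r', r = a :: r' := List.exists_cons_of_ne_nil fun h => by
      simp [h] at hr
    rfl
  -- At the halt with `M = 0` there are `2 * N + 2` separators and the cell of two ones at the end,
  -- in total `2 * N + 3` pairs. The tail drops the first symbol to the right of the head, which
  -- aligns the pairs with the cells.
  refine ⟨rfl, rfl, enc, fun κ => (Encodable.decode (output ((countPairs κ.2.2.2.tail - 3) / 2)) :
    Option (Config ℕ ℕ)).getD default, ?_, ?_, fun a b M w => ⟨⟨⟨?_, ?_⟩, rfl⟩, ?_⟩⟩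
  · refine Computable.pair (Computable.const _) (Computable.pair (Computable.const _)
      (Computable.pair (Computable.const _) ?_))
    refine (Primrec.list_append.comp (Primrec.const r) (Primrec.list_flatten.comp ?_)).to_comp
    have : Primrec fun n : ℕ => List.replicate n blk :=
      (Primrec.list_map Primrec.list_range (Primrec.const blk).to₂).of_eq fun n => by
        simp [List.map_const']
    exact this.comp (hin.comp Primrec.encode)
  · refine Primrec.to_comp (Primrec.option_getD.comp (Primrec.decode.comp (hout.comp
      (Primrec.nat_div.comp (Primrec.nat_sub.comp (primrec_countPairs.comp
        (Primrec.list_tail.comp (Primrec.snd.comp (Primrec.snd.comp Primrec.snd))))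
          (Primrec.const 3)) (Primrec.const 2)))) (Primrec.const default))
  · have : Even ((List.replicate (input (Encodable.encode (M.describe, w.map Fin.val)))
        blk).flatten.length) := by
      simp [List.length_flatten, hblk]
    rw [List.length_append]
    have h := (hl.add_one.add_odd hr).add this
    rwa [add_assoc] at h
  · exact (hflag _).symm
  · set p : Description × List ℕ := (M.describe, w.map Fin.val)
    set n := Encodable.encode p
    have hκ : ∃ k, wordConfig prods 0 ((NumberMachine.word s₀ 0 (input n)).map num) =
        wordConfig prods k ((NumberMachine.word s₀ 0 (input n)).map num) := ⟨0, rfl⟩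
    have hrel : rogozhin.FlaggedRel
        (wordConfig prods 0 ((NumberMachine.word s₀ 0 (input n)).map num)) (enc p) := by
      refine ⟨0, 0, ?_⟩
      rw [hconf]
      have := hflag p
      simp only [List.replicate_zero, List.append_nil, TM.withFlag]
      exact congrArg (fun x => (((0, x), l, Symbol.idle,
        r ++ (List.replicate (input n) blk).flatten) : Config State Symbol)) this.symm
    have hn : (Part.ofOption (Encodable.decode n)).bind
        (fun p : Description × List ℕ => (Description.interpret p).map Encodable.encode) =
        (Description.interpret p).map Encodable.encode := by
      simp [n]
    have hdom : (eval rogozhin.flaggedStep (enc p)).Dom ↔ (Description.interpret p).Dom := by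
      rw [hsim'.dom_iff hrel, hsim.dom_iff (a₁ := (s₀, 0, input n)) hκ, (heval n).1, hn]
      rfl
    have hval : ∀ κ ∈ eval rogozhin.flaggedStep (enc p),
        (Encodable.decode (output ((countPairs κ.2.2.2.tail - 3) / 2)) :
          Option (Config ℕ ℕ)).getD default ∈ Description.interpret p := by
      intro κ hκ'
      have h₁ := (hsim'.dom_iff hrel).1 (Part.dom_iff_mem.2 ⟨κ, hκ'⟩)
      obtain ⟨c, hc⟩ := Part.dom_iff_mem.1
        ((hsim.dom_iff (a₁ := (s₀, 0, input n)) hκ).1 h₁)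
      obtain ⟨κ₁, hhalt, hκ₁⟩ := hsim.exists_mem_eval (a₁ := (s₀, 0, input n)) hκ hc
      obtain ⟨κ₂, hrel₂, hκ₂⟩ := hsim'.exists_mem_eval hrel hκ₁
      obtain rfl := Part.mem_unique hκ' hκ₂
      obtain ⟨hM, hN⟩ := (heval n).2 c hc
      obtain ⟨prods', V, v, hV, hv, rfl⟩ := hhalt
      obtain ⟨i, j, rfl⟩ := hrel₂
      have hcount : countPairs (rightOf ((.worked, .worked) :: V ++ separated prods' v) ++
          List.replicate j .idle) = 2 * c.2.2 + 3 := by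
        rw [countPairs_rightOf, List.cons_append, List.count_cons_self, List.count_append,
          count_separated, hv, List.count_eq_zero.2 fun h => hV _ h rfl, hM]
        omega
      rw [hn] at hN
      obtain ⟨e, he, he'⟩ := (Part.mem_map_iff _).1 hN
      have : (countPairs (rogozhin.withFlag (10 : Fin 24) ([] ++ List.replicate i rogozhin.blank)
          Symbol.worked (Symbol.worked :: rightOf ((.worked, .worked) :: V ++ separated prods' v) ++
            List.replicate j rogozhin.blank)).2.2.2.tail - 3) / 2 = c.2.2 := by
        have h : (rogozhin.withFlag (10 : Fin 24) ([] ++ List.replicate i rogozhin.blank)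
          Symbol.worked (Symbol.worked :: rightOf ((.worked, .worked) :: V ++ separated prods' v) ++
            List.replicate j rogozhin.blank)).2.2.2.tail =
            rightOf ((.worked, .worked) :: V ++ separated prods' v) ++
              List.replicate j .idle := rfl
        rw [h, hcount]
        omega
      rw [this, ← he', Encodable.encodek]
      exact he
    rw [← M.interpret_describe w]
    refine Part.ext fun z => ⟨fun hz => ?_, fun hz => ?_⟩
    · obtain ⟨κ, hκ', rfl⟩ := (Part.mem_map_iff _).1 hz
      exact hval κ hκ'
    · obtain ⟨κ, hκ'⟩ := Part.dom_iff_mem.1 (hdom.2 (Part.dom_iff_mem.2 ⟨z, hz⟩))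
      rw [Part.mem_unique hz (hval κ hκ')]
      exact Part.mem_map _ hκ'

end CivVI

namespace CivVI

/-! ## Playing without disasters -/

namespace Game

/-- `Path w g t g'`: the player can bring the game from `g` to `g'` in `t` turns without
disasters. -/
inductive Path (w : World) : Game → ℕ → Game → Prop
  | refl (g : Game) : Path w g 0 g
  | act {g g' g'' : Game} {t : ℕ} : Act w g g' → Path w g' t g'' → Path w g t g''
  | turn {g g'' : Game} {t : ℕ} : Path w (g.advance w) t g'' → Path w g (t + 1) g''

variable {w : World} {g g' g'' : Game}

theorem Path.trans {s t : ℕ} (h : Path w g s g') (h' : Path w g' t g'') : Path w g (s + t) g'' := by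
  induction h with
  | refl => rwa [zero_add]
  | act ha _ ih => exact .act ha (ih h')
  | turn _ ih =>
    rw [Nat.add_right_comm]
    exact .turn (ih h')

theorem Path.trans_of_zero {t : ℕ} (h : Path w g 0 g') (h' : Path w g' t g'') :
    Path w g t g'' := zero_add t ▸ h.trans h'

theorem Path.single (h : Act w g g') : Path w g 0 g' := .act h (.refl _)

theorem Path.advance (g : Game) : Path w g 1 (g.advance w) := .turn (.refl _)

theorem Act.turn_eq (h : Act w g g') : g'.turn = g.turn := by
  cases h <;> rfl

theorem strike_empty (g : Game) : g.strike ∅ = g := by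
  simp [strike]

theorem Path.play {disasters : ℕ → Finset Hex} {t : ℕ} (h : Path w g t g')
    (hd : ∀ t, g.turn ≤ t → disasters t = ∅) : Play w disasters g t g' := by
  induction h with
  | refl => exact .refl _
  | act ha _ ih => exact .act ha (ih (by rwa [ha.turn_eq]))
  | turn _ ih =>
    refine .turn ?_
    rw [hd _ le_rfl, endTurn, strike_empty]
    exact ih fun t ht => hd t ((Nat.le_succ _).trans ht)

theorem Play.turn_le {disasters : ℕ → Finset Hex} {t : ℕ} (h : Play w disasters g t g') :
    g.turn ≤ g'.turn := by
  induction h with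
  | refl => exact le_rfl
  | act ha _ ih => rwa [ha.turn_eq] at ih
  | turn _ ih => exact (Nat.le_succ _).trans ih

/-! ### Cities at the end of a turn -/

/-- A City without regard to its stock of food. -/
def _root_.CivVI.City.core (C : City) : City := { C with food := 0 }

theorem _root_.CivVI.City.core_eq_iff {C D : City} : C.core = D.core ↔
    C.pop = D.pop ∧ C.tiles = D.tiles ∧ C.worked = D.worked ∧ C.production = D.production ∧
      C.cap = D.cap ∧ C.training = D.training := by
  cases C; cases D
  simp [City.core]

/-- The Citizens have places to work, and all tiles give enough Food for their Citizens. -/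
def Fertile (w : World) (g : Game) (c : Hex) : Prop :=
  g.Staffed c ∧ ∀ h ∈ (g.city c).tiles, w.terrain h ≠ .other

theorem two_le_food {x : Terrain} (h : x ≠ .other) : 2 ≤ x.food := by
  cases x <;> simp_all [Terrain.food]

/-- Every worked tile feeds its own Citizen and the two extra Food of the center feed the remaining
one. So no City starves, and the bare terrain of the center is a surplus, positive on the strip. -/
theorem Fertile.le_cityFood {c : Hex} (h : g.Fertile w c) :
    2 * (g.city c).pop + (w.terrain c).food ≤ g.cityFood w c := by
  have h₁ : (g.city c).worked.card • 2 ≤ ∑ h ∈ (g.city c).worked, g.tileFood w h := by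
    refine Finset.card_nsmul_le_sum _ _ _ fun x hx => ?_
    exact (two_le_food (h.2 x (h.1.1 x hx))).trans (Nat.le_add_right _ _)
  have h₂ := h.1.2
  rw [cityFood]
  simp only [smul_eq_mul] at h₁
  omega

theorem feed_of_cap_le {c : Hex} (h : g.Fertile w c) (hcap : (g.city c).cap ≤ (g.city c).pop) :
    (g.feed w c).core = (g.city c).core := by
  have h₁ := h.le_cityFood
  rw [feed]
  rw [if_neg (by omega), if_neg (by omega)]
  rfl

theorem produce_of_not_training {C : City} (h : C.training = false) : g.produce w C = C := by
  simp [produce, Finishes, h]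

theorem advance_city {c : Hex} (hc : c ∈ g.centers) :
    (g.advance w).city c = g.produce w (g.feed w c) := if_pos hc

theorem advance_city_of_calm {c : Hex} (h : g.Fertile w c)
    (hcap : (g.city c).cap ≤ (g.city c).pop) (ht : (g.city c).training = false) :
    ((g.advance w).city c).core = (g.city c).core := by
  by_cases hc : c ∈ g.centers
  · have h₁ := feed_of_cap_le h hcap
    have h₂ := City.core_eq_iff.1 h₁
    rw [advance_city hc, produce_of_not_training (h₂.2.2.2.2.2.trans ht), h₁]
  · exact congrArg City.core (if_neg hc)

/-- A growing City stores food or gains a Citizen. -/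
theorem advance_city_of_growing {c : Hex} (hc : c ∈ g.centers) (h : g.Fertile w c)
    (hcap : (g.city c).pop < (g.city c).cap) (ht : (g.city c).training = false)
    (hterrain : w.terrain c ≠ .other) (hfree : ∃ x ∈ (g.city c).tiles, x ∉ (g.city c).worked) :
    (((g.advance w).city c).core = (g.city c).core ∧
      (g.city c).food < ((g.advance w).city c).food ∧
      ((g.advance w).city c).food < w.growth (g.city c).pop) ∨
    (((g.advance w).city c).pop = (g.city c).pop + 1 ∧
      ((g.advance w).city c).tiles = (g.city c).tiles ∧
      ((g.advance w).city c).cap = (g.city c).cap ∧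
      ((g.advance w).city c).training = false ∧
      (g.advance w).Staffed c) := by
  have h₁ := h.le_cityFood
  have h₂ := two_le_food hterrain
  by_cases hg : w.growth (g.city c).pop ≤ (g.city c).food + g.cityFood w c - 2 * (g.city c).pop
  · right
    have hfeed : g.feed w c = { g.city c with
        pop := (g.city c).pop + 1
        food := (g.city c).food + g.cityFood w c - 2 * (g.city c).pop - w.growth (g.city c).pop
        worked := g.hire w (g.city c) } := by
      rw [feed]
      dsimp only
      rw [if_neg (by omega), if_pos ⟨hcap, hg⟩]
    have hadv := advance_city (w := w) hc
    rw [produce_of_not_training (by rw [hfeed]; exact ht), hfeed] at hadv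
    refine ⟨by rw [hadv], by rw [hadv], by rw [hadv], by rw [hadv]; exact ht, ?_⟩
    rw [Staffed, hadv]
    dsimp only
    have hne : ((g.city c).tiles.filter fun h => h ∉ (g.city c).worked) ≠ [] := by
      obtain ⟨x, hx, hx'⟩ := hfree
      exact List.ne_nil_of_mem (List.mem_filter.2 ⟨hx, by simpa using hx'⟩)
    rw [hire]
    cases hm : ((g.city c).tiles.filter fun h => h ∉ (g.city c).worked).argmax (g.tileYield w) with
    | none => exact absurd (List.argmax_eq_none.1 hm) hne
    | some x =>
      have hx := List.mem_filter.1 (List.argmax_mem hm)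
      have hx' : x ∉ (g.city c).worked := by simpa using hx.2
      refine ⟨fun y hy => ?_, ?_⟩
      · rcases Finset.mem_insert.1 hy with rfl | hy
        exacts [hx.1, h.1.1 y hy]
      · dsimp only
        rw [Finset.card_insert_of_notMem hx', h.1.2]
  · left
    have hfeed : g.feed w c = { g.city c with
        food := min ((g.city c).food + g.cityFood w c - 2 * (g.city c).pop)
          (w.growth (g.city c).pop) } := by
      rw [feed]
      dsimp only
      rw [if_neg (by omega), if_neg (by tauto)]
    have hadv := advance_city (w := w) hc
    rw [produce_of_not_training (by rw [hfeed]; exact ht), hfeed] at hadv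
    rw [hadv]
    refine ⟨rfl, ?_, ?_⟩ <;> dsimp only <;> omega

/-- A City that trains a Settler adds Production or loses a Citizen to the Settler. -/
theorem advance_city_of_training {c : Hex} (hc : c ∈ g.centers) (h : g.Fertile w c)
    (hcap : (g.city c).cap ≤ (g.city c).pop) (ht : (g.city c).training = true)
    (hpop : 2 ≤ (g.city c).pop) :
    (g.city c).production + 1 < g.settlerCost ∧
      ((g.advance w).city c).core =
        City.core { g.city c with production := (g.city c).production + 1 } ∨
    ((g.advance w).city c).pop = (g.city c).pop - 1 ∧
      ((g.advance w).city c).tiles = (g.city c).tiles ∧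
      ((g.advance w).city c).cap = (g.city c).cap ∧
      ((g.advance w).city c).training = false ∧
      (g.advance w).Staffed c ∧ (c, 2) ∈ (g.advance w).settlers := by
  obtain ⟨hp, hti, hw, hpr, hca, htr⟩ := City.core_eq_iff.1 (feed_of_cap_le h hcap)
  by_cases hcost : g.settlerCost ≤ (g.city c).production + 1
  · right
    have hf : g.Finishes (g.feed w c) := ⟨htr.trans ht, hp.symm ▸ hpop, hpr.symm ▸ hcost⟩
    have hadv := advance_city (w := w) hc
    rw [produce, if_pos hf] at hadv
    refine ⟨by rw [hadv]; exact congrArg (· - 1) hp, by rw [hadv]; exact hti,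
      by rw [hadv]; exact hca, by rw [hadv], ?_, ?_⟩
    · rw [Staffed, hadv]
      dsimp only
      have hcard := h.1.2
      rw [layOff, hw, hp, hti, if_neg (by omega)]
      cases hm : ((g.city c).tiles.filter fun h => h ∈ (g.city c).worked).argmin
          (g.tileYield w) with
      | none =>
        obtain ⟨x, hx⟩ : (g.city c).worked.Nonempty := by
          rw [← Finset.card_pos]; omega
        have hx' : x ∈ (g.city c).tiles.filter fun h => h ∈ (g.city c).worked :=
          List.mem_filter.2 ⟨h.1.1 x hx, by simpa using hx⟩
        rw [List.argmin_eq_none.1 hm] at hx'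
        simp at hx'
      | some x =>
        have hx : x ∈ (g.city c).worked := by
          simpa using (List.mem_filter.1 (List.argmin_mem hm)).2
        refine ⟨fun y hy => h.1.1 y (Finset.mem_of_mem_erase hy), ?_⟩
        dsimp only
        rw [Finset.card_erase_of_mem hx]
        omega
    · refine Multiset.mem_add.2 (Or.inr (Multiset.mem_map.2 ⟨c, ?_, rfl⟩))
      exact Finset.mem_filter.2 ⟨hc, hf⟩
  · left
    refine ⟨not_le.1 hcost, ?_⟩
    have hf : ¬ g.Finishes (g.feed w c) := fun hf => hcost (by
      have := hf.2.2
      rwa [hpr] at this)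
    rw [advance_city hc, produce, if_neg hf, if_pos ⟨htr.trans ht, hp.symm ▸ hpop⟩]
    rw [City.core_eq_iff]
    exact ⟨hp, hti, hw, congrArg (· + 1) hpr, hca, htr⟩

end Game

end CivVI

namespace CivVI

namespace Game

variable {w : World} {g g' g'' : Game}

/-! ### The strip -/

theorem mem_ring_iff {h k : Hex} : k ∈ ring h ↔
    (k.1 = h.1 + 1 ∧ k.2 = h.2) ∨ (k.1 = h.1 - 1 ∧ k.2 = h.2) ∨ (k.1 = h.1 ∧ k.2 = h.2 + 1) ∨
      (k.1 = h.1 ∧ k.2 = h.2 - 1) ∨ (k.1 = h.1 + 1 ∧ k.2 = h.2 - 1) ∨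
      (k.1 = h.1 - 1 ∧ k.2 = h.2 + 1) := by
  simp [ring, Prod.ext_iff]

theorem abs_le_of_mem_ring {j : ℤ} {k : Hex} (h : k ∈ ring (cityHex j)) : |k.2| ≤ 1 := by
  rw [mem_ring_iff] at h
  simp only [cityHex] at h
  rw [abs_le]
  omega

theorem eq_of_mem_ring {i j : ℤ} {k : Hex} (hi : k ∈ ring (cityHex i))
    (hj : k ∈ ring (cityHex j)) : i = j := by
  rw [mem_ring_iff] at hi hj
  simp only [cityHex] at hi hj
  omega

theorem cityHex_injective : Function.Injective cityHex := by
  intro i j h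
  simp only [cityHex, Prod.mk.injEq, and_true] at h
  omega

theorem _root_.CivVI.World.HasStrip.ne_other (hw : w.HasStrip) {h : Hex} (hh : |h.2| ≤ 1) :
    w.terrain h ≠ .other := by
  obtain ⟨x, y⟩ := h
  obtain ⟨h₁, h₂⟩ := abs_le.1 hh
  dsimp only at h₁ h₂
  obtain ⟨ha, hb, hc⟩ := hw x
  have : y = 0 ∨ y = 1 ∨ y = -1 := by omega
  rcases this with rfl | rfl | rfl
  · rw [ha]; simp
  · rw [hb]; simp
  · rw [hc]; simp

/-- The Cities on the strip are those with the numbers from `lo` to `hi - 1`, with the six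
surrounding hexes; the state tiles are in order. -/
structure Strip (w : World) (g : Game) (lo hi : ℤ) : Prop where
  state : g.HasStateTiles w
  row : ∀ h : Hex, h.2 = 0 → (h ∈ g.centers ↔ ∃ j, lo ≤ j ∧ j < hi ∧ h = cityHex j)
  tiles : ∀ j, lo ≤ j → j < hi → (g.city (cityHex j)).tiles = ring (cityHex j)
  staffed : ∀ j, lo ≤ j → j < hi → g.Staffed (cityHex j)

variable {lo hi : ℤ}

theorem Strip.mem_centers (h : Strip w g lo hi) {j : ℤ} :
    cityHex j ∈ g.centers ↔ lo ≤ j ∧ j < hi := by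
  rw [h.row _ rfl]
  refine ⟨?_, fun ⟨h₁, h₂⟩ => ⟨j, h₁, h₂, rfl⟩⟩
  rintro ⟨i, h₁, h₂, h₃⟩
  rw [cityHex_injective h₃]
  exact ⟨h₁, h₂⟩

theorem Strip.cases (h : Strip w g lo hi) {c : Hex} (hc : c ∈ g.centers) :
    c ∈ g.stateCities ∨ ∃ j, lo ≤ j ∧ j < hi ∧ c = cityHex j := by
  by_cases h0 : c.2 = 0
  · exact Or.inr ((h.row c h0).1 hc)
  · exact Or.inl (Finset.mem_filter.2 ⟨hc, h0⟩)

theorem Strip.fertile (h : Strip w g lo hi) (hw : w.HasStrip) {c : Hex} (hc : c ∈ g.centers) :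
    g.Fertile w c := by
  rcases h.cases hc with hs | ⟨j, h₁, h₂, rfl⟩
  · exact ⟨h.state.staffed c hs, fun k hk => (h.state.off c hs k hk).2⟩
  · refine ⟨h.staffed j h₁ h₂, fun k hk => ?_⟩
    rw [h.tiles j h₁ h₂] at hk
    exact hw.ne_other (abs_le_of_mem_ring hk)

theorem HasStateTiles.congr (h : g.HasStateTiles w) (hs : g'.stateCities = g.stateCities)
    (hc : ∀ c ∈ g'.centers, c ∈ g.centers ∨ c.2 = 0) (hi : g'.improvement = g.improvement)
    (ht : ∀ c ∈ g.stateCities, (g'.city c).tiles = (g.city c).tiles)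
    (hp : ∀ c ∈ g.stateCities, (g'.city c).pop = (g.city c).pop)
    (hst : ∀ c ∈ g.stateCities, g'.Staffed c) : g'.HasStateTiles w := by
  have hcount : ∀ i, ∀ c ∈ g.stateCities, g'.count i c = g.count i c := by
    intro i c hcs
    rw [count, count, ht c hcs, hi]
  constructor
  · rw [hs]; exact h.far
  · rw [hs]; exact fun c hcs => by rw [ht c hcs]; exact h.off c hcs
  · rw [hs]; exact fun c hcs => by rw [ht c hcs]; exact h.nodup c hcs
  · rw [hs]
    intro c hcs d hds
    rw [ht c hcs, ht d hds]
    exact h.disjoint c hcs d hds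
  · rw [hs, ← h.monasteries]
    exact Finset.sum_congr rfl (hcount _)
  · rw [hs, ← h.farms]
    exact Finset.sum_congr rfl (hcount _)
  · rw [hs, hi]
    intro c hcs k hk hne l hl
    rw [ht c hcs] at hk
    have h₁ := h.noDistrict c hcs k hk hne l hl
    refine ⟨h₁.1, fun hl' => ?_⟩
    rcases hc l hl' with h₂ | h₂
    · exact h₁.2 h₂
    · have h₃ := (h.off c hcs k hk).1
      rw [mem_ring_iff] at hl
      rw [le_abs] at h₃
      omega
  · rw [hs]; exact hst
  · rw [hs]
    intro c hcs
    rw [hcount _ c hcs, hp c hcs, ht c hcs]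
    exact h.citizens c hcs
  · rw [hi]; exact h.bare

theorem Strip.congr (h : Strip w g lo hi) (hc : g'.centers = g.centers)
    (hi' : g'.improvement = g.improvement)
    (ht : ∀ c ∈ g.centers, (g'.city c).tiles = (g.city c).tiles)
    (hp : ∀ c ∈ g.stateCities, (g'.city c).pop = (g.city c).pop)
    (hs : ∀ c ∈ g.centers, g'.Staffed c) : Strip w g' lo hi := by
  have hst : g'.stateCities = g.stateCities := by rw [stateCities, stateCities, hc]
  refine ⟨h.state.congr hst (fun c hcc => Or.inl (hc ▸ hcc)) hi'
    (fun c hcs => ht c (Finset.mem_filter.1 hcs).1) hp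
    (fun c hcs => hs c (Finset.mem_filter.1 hcs).1), ?_, ?_, ?_⟩
  · rw [hc]; exact h.row
  · intro j h₁ h₂
    rw [ht _ (h.mem_centers.2 ⟨h₁, h₂⟩), h.tiles j h₁ h₂]
  · exact fun j h₁ h₂ => hs _ (h.mem_centers.2 ⟨h₁, h₂⟩)

/-- The number of all Cities. -/
theorem Strip.card_centers (h : Strip w g lo hi) :
    (g.centers.card : ℤ) = max (hi - lo) 0 + g.stateCities.card := by
  have h₁ : g.centers.filter (fun c => ¬ c.2 ≠ 0) = (Finset.Ico lo hi).image cityHex := by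
    ext c
    rw [Finset.mem_filter, Finset.mem_image, not_not]
    constructor
    · rintro ⟨hc, h0⟩
      obtain ⟨j, h₁, h₂, rfl⟩ := (h.row c h0).1 hc
      exact ⟨j, Finset.mem_Ico.2 ⟨h₁, h₂⟩, rfl⟩
    · rintro ⟨j, hj, rfl⟩
      exact ⟨h.mem_centers.2 (Finset.mem_Ico.1 hj), rfl⟩
  have h₂ := Finset.card_filter_add_card_filter_not (s := g.centers) (fun c : Hex => c.2 ≠ 0)
  rw [h₁, Finset.card_image_of_injective _ cityHex_injective, Int.card_Ico] at h₂
  rw [stateCities]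
  omega

theorem Strip.unowned_iff (h : Strip w g lo hi) {j : ℤ} {k : Hex} (hk : k ∈ ring (cityHex j)) :
    g.Unowned k ↔ ¬ (lo ≤ j ∧ j < hi) := by
  constructor
  · intro hu hj
    apply hu _ (h.mem_centers.2 hj)
    rwa [h.tiles j hj.1 hj.2]
  · intro hj c hc hk'
    rcases h.cases hc with hs | ⟨i, h₁, h₂, rfl⟩
    · have h₁ := (h.state.off c hs k hk').1
      have h₂ := abs_le_of_mem_ring hk
      omega
    · rw [h.tiles i h₁ h₂] at hk'
      rw [eq_of_mem_ring hk hk'] at hj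
      exact hj ⟨h₁, h₂⟩

/-! ### Agreement of two games -/

/-- Outside of the set `S`, two games agree up to the stocks of food. -/
structure Agree (S : Set Hex) (g g' : Game) : Prop where
  centers : g'.centers = g.centers
  improvement : g'.improvement = g.improvement
  city : ∀ c ∉ S, (g'.city c).core = (g.city c).core

variable {S : Set Hex}

theorem Agree.trans (h : Agree S g g') (h' : Agree S g' g'') : Agree S g g'' :=
  ⟨h'.centers.trans h.centers, h'.improvement.trans h.improvement,
    fun c hc => (h'.city c hc).trans (h.city c hc)⟩

theorem staffed_of_core_eq {c : Hex} (h : (g'.city c).core = (g.city c).core)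
    (hs : g.Staffed c) : g'.Staffed c := by
  obtain ⟨hp, ht, hw, -⟩ := City.core_eq_iff.1 h
  rw [Staffed, hp, ht, hw]
  exact hs

theorem Strip.of_agree (h : Strip w g lo hi) (ha : Agree S g g') (hS : ∀ c ∈ S, c.2 = 0)
    (hs : ∀ c ∈ S, c ∈ g.centers → (g'.city c).tiles = (g.city c).tiles ∧ g'.Staffed c) :
    Strip w g' lo hi := by
  refine h.congr ha.centers ha.improvement (fun c hc => ?_) (fun c hc => ?_) (fun c hc => ?_)
  · by_cases hcS : c ∈ S
    · exact (hs c hcS hc).1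
    · exact (City.core_eq_iff.1 (ha.city c hcS)).2.1
  · have := Finset.mem_filter.1 hc
    exact (City.core_eq_iff.1 (ha.city c fun hcS => this.2 (hS c hcS))).1
  · by_cases hcS : c ∈ S
    · exact (hs c hcS hc).2
    · refine staffed_of_core_eq (ha.city c hcS) ?_
      rcases h.cases hc with hc' | ⟨j, h₁, h₂, rfl⟩
      exacts [h.state.staffed c hc', h.staffed j h₁ h₂]

/-- The City at `c` neither grows nor trains a Settler. -/
def CalmAt (g : Game) (c : Hex) : Prop :=
  (g.city c).cap ≤ (g.city c).pop ∧ (g.city c).training = false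

theorem CalmAt.of_core_eq {c : Hex} (h : g.CalmAt c) (he : (g'.city c).core = (g.city c).core) :
    g'.CalmAt c := by
  obtain ⟨hp, -, -, -, hc, ht⟩ := City.core_eq_iff.1 he
  rw [CalmAt, hp, hc, ht]
  exact h

/-- The end of a turn. -/
theorem Strip.agree_advance (h : Strip w g lo hi) (hw : w.HasStrip)
    (hcalm : ∀ c ∈ g.centers, c ∉ S → g.CalmAt c) : Agree S g (g.advance w) := by
  refine ⟨rfl, rfl, fun c hc => ?_⟩
  by_cases hcc : c ∈ g.centers
  · exact advance_city_of_calm (h.fertile hw hcc) (hcalm c hcc hc).1 (hcalm c hcc hc).2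
  · exact congrArg City.core (if_neg hcc)

theorem Strip.advance (h : Strip w g lo hi) (hw : w.HasStrip)
    (hcalm : ∀ c ∈ g.centers, g.CalmAt c) : Strip w (g.advance w) lo hi :=
  h.of_agree (S := ∅) (h.agree_advance hw fun c hc _ => hcalm c hc) (by simp) (by simp)

theorem mem_settlers_advance {h : Hex} {k : ℕ} (hk : (h, k) ∈ g.settlers) :
    (h, 2) ∈ (g.advance w).settlers :=
  Multiset.mem_add.2 (Or.inl (Multiset.mem_map.2 ⟨_, hk, rfl⟩))

theorem Agree.pop {c : Hex} (h : Agree S g g') (hc : c ∉ S) : (g'.city c).pop = (g.city c).pop :=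
  (City.core_eq_iff.1 (h.city c hc)).1

theorem Agree.calmAt {c : Hex} (h : Agree S g g') (hc : c ∉ S) (hg : g.CalmAt c) : g'.CalmAt c :=
  hg.of_core_eq (h.city c hc)

/-! ### Instructions of the player to all Cities -/

/-- New instructions to all Cities: the tiles to be worked, the sizes at which growth stops, and
whether a Settler is trained. -/
def arrange (g : Game) (W : Hex → Finset Hex) (k : Hex → ℕ) (b : Hex → Bool) : Game :=
  { g with city := fun c => if c ∈ g.centers then
      { g.city c with worked := W c, cap := k c, training := b c } else g.city c }

theorem path_arrange (w : World) (g : Game) (W : Hex → Finset Hex) (k : Hex → ℕ) (b : Hex → Bool)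
    (hW : ∀ c ∈ g.centers, (∀ h ∈ W c, h ∈ (g.city c).tiles) ∧ (W c).card + 1 = (g.city c).pop) :
    Path w g 0 (g.arrange W k b) := by
  have key : ∀ s ⊆ g.centers, Path w g 0 { g with city := fun c => if c ∈ s then
      { g.city c with worked := W c, cap := k c, training := b c } else g.city c } := by
    intro s
    induction s using Finset.induction_on with
    | empty => intro _; simpa using Path.refl g
    | insert c s hcs ih =>
      intro hs
      have hc : c ∈ g.centers := hs (Finset.mem_insert_self _ _)
      refine (ih ((Finset.subset_insert _ _).trans hs)).trans_of_zero ?_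
      set g₁ : Game := { g with city := fun c => if c ∈ s then
        { g.city c with worked := W c, cap := k c, training := b c } else g.city c }
      have h₁ : g₁.city c = g.city c := if_neg hcs
      refine .act (.assign g₁ c (W c) hc (by rw [h₁]; exact (hW c hc).1)
        (by rw [h₁]; exact (hW c hc).2)) ?_
      refine .act (.setCap _ c (k c) hc) ?_
      refine .act (.train _ c (b c) hc) ?_
      have : ∀ g₂ g₃ : Game, g₂ = g₃ → Path w g₂ 0 g₃ := by
        rintro g₂ _ rfl
        exact .refl _
      apply this
      simp only [setCity, Function.update_self, Function.update_idem]
      rw [h₁]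
      congr 1
      funext d
      by_cases hd : d = c
      · subst hd
        simp
      · simp [hd, g₁]
  exact key _ le_rfl

theorem arrange_city {W : Hex → Finset Hex} {k : Hex → ℕ} {b : Hex → Bool} {c : Hex}
    (hc : c ∈ g.centers) : (g.arrange W k b).city c =
      { g.city c with worked := W c, cap := k c, training := b c } := if_pos hc

theorem Strip.arrange (h : Strip w g lo hi) {W : Hex → Finset Hex} {k : Hex → ℕ}
    {b : Hex → Bool}
    (hW : ∀ c ∈ g.centers, (∀ h ∈ W c, h ∈ (g.city c).tiles) ∧ (W c).card + 1 = (g.city c).pop) :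
    Strip w (g.arrange W k b) lo hi := by
  refine h.congr rfl rfl (fun c hc => ?_) (fun c hc => ?_) (fun c hc => ?_)
  · rw [arrange_city hc]
  · rw [arrange_city (Finset.mem_filter.1 hc).1]
  · rw [Staffed, arrange_city hc]
    exact hW c hc

theorem Strip.staffed_of_mem (h : Strip w g lo hi) {c : Hex} (hc : c ∈ g.centers) :
    g.Staffed c := by
  rcases h.cases hc with hc' | ⟨j, h₁, h₂, rfl⟩
  exacts [h.state.staffed c hc', h.staffed j h₁ h₂]

/-- The player can stop growth and training everywhere, except that one City trains a Settler if
wanted. -/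
theorem Strip.exists_calm (h : Strip w g lo hi) (b : Hex → Bool) :
    ∃ g', Path w g 0 g' ∧ Strip w g' lo hi ∧ g'.worker = g.worker ∧
      g'.workerMoves = g.workerMoves ∧ g'.centers = g.centers ∧
      (∀ c, (g'.city c).pop = (g.city c).pop) ∧
      ∀ c ∈ g.centers, (g'.city c).cap = 0 ∧ (g'.city c).training = b c := by
  have hW : ∀ c ∈ g.centers, (∀ h ∈ (g.city c).worked, h ∈ (g.city c).tiles) ∧
      (g.city c).worked.card + 1 = (g.city c).pop := fun c hc => h.staffed_of_mem hc
  refine ⟨_, path_arrange w g (fun c => (g.city c).worked) (fun _ => 0) b hW,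
    h.arrange hW, rfl, rfl, rfl, fun c => ?_, fun c hc => ?_⟩
  · by_cases hc : c ∈ g.centers
    · rw [arrange_city hc]
    · exact congrArg City.pop (if_neg hc)
  · rw [arrange_city hc]
    exact ⟨rfl, rfl⟩

end Game

end CivVI

namespace CivVI

namespace Game

variable {w : World} {g g' g'' : Game} {lo hi : ℤ}

/-! ### Growing Cities -/

theorem ring_nodup (h : Hex) : (ring h).Nodup := by
  simp [ring, Prod.ext_iff]
  omega

theorem exists_mem_ring_notMem {h : Hex} {W : Finset Hex} (hW : W.card < 6) :
    ∃ x ∈ ring h, x ∉ W := by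
  by_contra! hall
  have h₁ : (ring h).toFinset ⊆ W := fun x hx => hall x (List.mem_toFinset.1 hx)
  have h₂ := Finset.card_le_card h₁
  rw [List.toFinset_card_of_nodup (ring_nodup h)] at h₂
  simp only [ring, List.length_cons, List.length_nil] at h₂
  omega

/-- The number `d` bounds the Food still missing, and each turn lowers it. With at most six Citizens
one of the six surrounding hexes is free for the newborn. -/
theorem Strip.exists_growth_of_cap (hw : w.HasStrip) (h : Strip w g lo hi) {j : ℤ}
    (hj : lo ≤ j ∧ j < hi) (hcalm : ∀ c ∈ g.centers, c ≠ cityHex j → g.CalmAt c)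
    (hpop : (g.city (cityHex j)).pop ≤ 6)
    (hcap : (g.city (cityHex j)).cap = (g.city (cityHex j)).pop + 1)
    (ht : (g.city (cityHex j)).training = false) {d : ℕ}
    (hd : w.growth (g.city (cityHex j)).pop ≤ (g.city (cityHex j)).food + d) :
    ∃ t g', t ≤ d + 1 ∧ Path w g t g' ∧ Strip w g' lo hi ∧ (∀ c ∈ g'.centers, g'.CalmAt c) ∧
      Agree {cityHex j} g g' ∧ g'.worker = g.worker ∧ g'.workerMoves = 2 ∧
      (g'.city (cityHex j)).pop = (g.city (cityHex j)).pop + 1 := by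
  induction d generalizing g with
  | zero | succ d =>
    have hc := h.mem_centers.2 hj
    have hfree : ∃ x ∈ (g.city (cityHex j)).tiles, x ∉ (g.city (cityHex j)).worked := by
      rw [h.tiles j hj.1 hj.2]
      refine exists_mem_ring_notMem ?_
      have := (h.staffed j hj.1 hj.2).2
      omega
    have ha : Agree {cityHex j} g (g.advance w) := h.agree_advance hw hcalm
    rcases advance_city_of_growing hc (h.fertile hw hc) (by omega) ht
      (hw.ne_other (by simp [cityHex])) hfree with ⟨h₁, h₂, h₃⟩ | ⟨h₁, h₂, h₃, h₄, h₅⟩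
    · obtain ⟨hp, -, -, -, hca, htr⟩ := City.core_eq_iff.1 h₁
      -- If nothing is missing, the City must grow: otherwise the new stock would lie above the old
      -- one and still below the required amount. The same text serves both cases of the induction.
      first
      | exfalso; omega
      | rename_i ih
        obtain ⟨t, g', htd, hpath, hs, hcalm', ha', hwk, hmv, hp'⟩ := ih (g := g.advance w)
          (h.of_agree ha (by simp [cityHex]) fun c hcS _ => by
            rw [Set.mem_singleton_iff.1 hcS]
            exact ⟨(City.core_eq_iff.1 h₁).2.1, staffed_of_core_eq h₁ (h.staffed j hj.1 hj.2)⟩)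
          (fun c hcc hcj => ha.calmAt (by simpa using hcj) (hcalm c hcc hcj))
          (by rw [hp]; exact hpop) (by rw [hp, hca]; exact hcap) (by rw [htr]; exact ht)
          (by rw [hp]; omega)
        exact ⟨t + 1, g', by omega, .turn hpath, hs, hcalm', ha.trans ha', hwk, hmv, by
          rw [hp', hp]⟩
    · refine ⟨1, _, by omega, Path.advance g, h.of_agree ha (by simp [cityHex]) fun c hcS _ => by
        rw [Set.mem_singleton_iff.1 hcS]; exact ⟨h₂, h₅⟩, fun c hcc => ?_, ha, rfl, rfl, h₁⟩
      by_cases hcj : c = cityHex j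
      · subst hcj
        exact ⟨by rw [h₁, h₃]; omega, h₄⟩
      · exact ha.calmAt (by simpa using hcj) (hcalm c hcc hcj)

theorem agree_setCity (g : Game) (c : Hex) (C : City) : Agree {c} g (g.setCity c C) :=
  ⟨rfl, rfl, fun d hd => by
    rw [setCity]
    dsimp only
    rw [Function.update_of_ne (by simpa using hd)]⟩

/-- A City on the strip can be made to grow by one Citizen. -/
theorem Strip.exists_growth (hw : w.HasStrip) (h : Strip w g lo hi) {j : ℤ}
    (hj : lo ≤ j ∧ j < hi) (hcalm : ∀ c ∈ g.centers, g.CalmAt c)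
    (hpop : (g.city (cityHex j)).pop ≤ 6) :
    ∃ t g', t ≤ w.growth (g.city (cityHex j)).pop + 1 ∧ Path w g t g' ∧ Strip w g' lo hi ∧
      (∀ c ∈ g'.centers, g'.CalmAt c) ∧
      Agree {cityHex j} g g' ∧ g'.worker = g.worker ∧ g'.workerMoves = 2 ∧
      (g'.city (cityHex j)).pop = (g.city (cityHex j)).pop + 1 := by
  have hc := h.mem_centers.2 hj
  set g₁ := g.setCity (cityHex j) { g.city (cityHex j) with cap := (g.city (cityHex j)).pop + 1 }
    with hg₁
  have hcity : g₁.city (cityHex j) =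
      { g.city (cityHex j) with cap := (g.city (cityHex j)).pop + 1 } := by
    rw [hg₁, setCity]
    exact Function.update_self _ _ _
  have ha : Agree {cityHex j} g g₁ := agree_setCity _ _ _
  have hs : Strip w g₁ lo hi := h.of_agree ha (by simp [cityHex]) fun c hcS _ => by
    rw [Set.mem_singleton_iff.1 hcS, Staffed, hcity]
    exact ⟨rfl, h.staffed j hj.1 hj.2⟩
  obtain ⟨t, g', ht, hpath, hs', hcalm', ha', hwk, hmv, hp⟩ := hs.exists_growth_of_cap hw hj
    (fun c hcc hcj => ha.calmAt (by simpa using hcj) (hcalm c hcc)) (by rw [hcity]; exact hpop)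
    (by rw [hcity]) (by rw [hcity]; exact (hcalm _ hc).2)
    (d := w.growth (g.city (cityHex j)).pop) (by rw [hcity]; exact Nat.le_add_left _ _)
  refine ⟨t, g', ht, .act (.setCap g _ _ hc) hpath, hs', hcalm', ha.trans ha', hwk, hmv, ?_⟩
  rw [hp, hcity]

/-! ### Settlers -/

/-- The price depends on the number of Cities only, hence is constant while the Settler is trained,
and Production grows by one per turn. The `1` beside `d` is the Production of the finishing turn. -/
theorem Strip.exists_settler (hw : w.HasStrip) (h : Strip w g lo hi) {j : ℤ}
    (hj : lo ≤ j ∧ j < hi) (hcalm : ∀ c ∈ g.centers, c ≠ cityHex j → g.CalmAt c)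
    (hpop : 2 ≤ (g.city (cityHex j)).pop) (hcap : (g.city (cityHex j)).cap = 0)
    (ht : (g.city (cityHex j)).training = true) {d : ℕ}
    (hd : g.settlerCost ≤ (g.city (cityHex j)).production + d + 1) :
    ∃ t g', 0 < t ∧ t ≤ d + 1 ∧ Path w g t g' ∧ Strip w g' lo hi ∧
      (∀ c ∈ g'.centers, g'.CalmAt c) ∧
      Agree {cityHex j} g g' ∧ g'.worker = g.worker ∧ g'.workerMoves = 2 ∧
      (cityHex j, 2) ∈ g'.settlers ∧
      (g'.city (cityHex j)).pop + 1 = (g.city (cityHex j)).pop := by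
  induction d generalizing g with
  | zero | succ d =>
    have hc := h.mem_centers.2 hj
    have ha : Agree {cityHex j} g (g.advance w) := h.agree_advance hw hcalm
    rcases advance_city_of_training hc (h.fertile hw hc) (by omega) ht hpop with
      ⟨h₁, h₂⟩ | ⟨h₁, h₂, h₃, h₄, h₅, h₆⟩
    · obtain ⟨hp, hti, hwo, hpr, hca, htr⟩ := City.core_eq_iff.1 h₂
      dsimp only at hp hti hwo hpr hca htr
      first
      | exfalso; omega
      | rename_i ih
        obtain ⟨t, g', ht0, htd, hpath, hs, hcalm', ha', hwk, hmv, hset, hp'⟩ :=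
          ih (g := g.advance w)
          (h.of_agree ha (by simp [cityHex]) fun c hcS _ => by
            rw [Set.mem_singleton_iff.1 hcS, Staffed, hp, hti, hwo]
            exact ⟨rfl, h.staffed j hj.1 hj.2⟩)
          (fun c hcc hcj => ha.calmAt (by simpa using hcj) (hcalm c hcc hcj))
          (by rw [hp]; exact hpop) (by rw [hca]; exact hcap) (by rw [htr]; exact ht)
          (by
            have : (g.advance w).settlerCost = g.settlerCost := rfl
            rw [this, hpr]; omega)
        exact ⟨t + 1, g', by omega, by omega, .turn hpath, hs, hcalm', ha.trans ha', hwk, hmv,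
          hset, by rw [hp', hp]⟩
    · refine ⟨1, _, by omega, by omega, Path.advance g,
        h.of_agree ha (by simp [cityHex]) fun c hcS _ => by
          rw [Set.mem_singleton_iff.1 hcS]; exact ⟨h₂, h₅⟩,
        fun c hcc => ?_, ha, rfl, rfl, h₆, by omega⟩
      by_cases hcj : c = cityHex j
      · subst hcj
        exact ⟨by omega, h₄⟩
      · exact ha.calmAt (by simpa using hcj) (hcalm c hcc hcj)

/-- A Settler moves two hexes along the strip, and the turn ends. -/
theorem Strip.exists_settler_move (hw : w.HasStrip) (h : Strip w g lo hi)
    (hcalm : ∀ c ∈ g.centers, g.CalmAt c) {x s : ℤ} (hs : s = 1 ∨ s = -1)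
    (hx : ((x, 0), 2) ∈ g.settlers) :
    ∃ g', Path w g 1 g' ∧ Strip w g' lo hi ∧ (∀ c ∈ g'.centers, g'.CalmAt c) ∧
      Agree ∅ g g' ∧ g'.worker = g.worker ∧ g'.workerMoves = 2 ∧
      ((x + 2 * s, 0), 2) ∈ g'.settlers := by
  obtain ⟨r, hr⟩ := Multiset.exists_cons_of_mem hx
  have hring : ∀ y : ℤ, ((y + s, 0) : Hex) ∈ ring (y, 0) := by
    intro y
    rw [mem_ring_iff]
    dsimp only
    omega
  have hpass : ∀ y : ℤ, Passable w (y, 0) := fun y => hw.ne_other (by simp)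
  set g₁ : Game := { g with settlers := ((x + s, 0), 1) ::ₘ r }
  set g₂ : Game := { g₁ with settlers := ((x + s + s, 0), 0) ::ₘ r } with hg₂
  have ha : Agree ∅ g g₂ := ⟨rfl, rfl, fun _ _ => rfl⟩
  have hstrip : Strip w g₂ lo hi := h.of_agree ha (by simp) (by simp)
  have ha' : Agree ∅ g₂ (g₂.advance w) := hstrip.agree_advance hw fun c hc _ => hcalm c hc
  refine ⟨g₂.advance w, ?_, hstrip.advance hw hcalm,
    fun c hc => ha'.calmAt (by simp) (hcalm c hc), ha.trans ha', rfl, rfl, ?_⟩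
  · refine .act (.moveSettler g _ _ 1 r hr (hring x) (hpass _)) ?_
    exact .act (.moveSettler g₁ _ _ 0 r rfl (hring _) (hpass _)) (Path.advance _)
  · refine mem_settlers_advance (k := 0) ?_
    have : x + s + s = x + 2 * s := by ring
    rw [hg₂, ← this]
    exact Multiset.mem_cons_self _ _

theorem newCity_spec (h : Strip w g lo hi) {j : ℤ} (hj : ¬ (lo ≤ j ∧ j < hi)) (k : ℕ) :
    (g.newCity w (cityHex j) k).pop = 2 ∧ (g.newCity w (cityHex j) k).cap = k ∧
      (g.newCity w (cityHex j) k).training = false ∧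
      (g.newCity w (cityHex j) k).tiles = ring (cityHex j) ∧
      (∀ x ∈ (g.newCity w (cityHex j) k).worked, x ∈ ring (cityHex j)) ∧
      (g.newCity w (cityHex j) k).worked.card = 1 := by
  have ht : (ring (cityHex j)).filter (fun k => g.Unowned k) = ring (cityHex j) :=
    List.filter_eq_self.2 fun k hk => by simpa using (h.unowned_iff hk).2 hj
  refine ⟨rfl, rfl, rfl, ht, ?_⟩
  rw [newCity]
  dsimp only
  rw [ht, hire]
  dsimp only
  cases hm : ((ring (cityHex j)).filter fun h => h ∉ (∅ : Finset Hex)).argmax (g.tileYield w) with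
  | none => simp [ring] at hm
  | some x =>
    have hx := (List.mem_filter.1 (List.argmax_mem hm)).1
    simpa using hx

theorem Strip.found (h : Strip w g lo hi) (hw : w.HasStrip)
    (hcalm : ∀ c ∈ g.centers, g.CalmAt c) {j lo' hi' : ℤ}
    (hj : ∀ i, lo' ≤ i ∧ i < hi' ↔ (lo ≤ i ∧ i < hi) ∨ i = j) (hnot : ¬ (lo ≤ j ∧ j < hi))
    (hset : (cityHex j, 2) ∈ g.settlers) :
    ∃ g', Path w g 0 g' ∧ Strip w g' lo' hi' ∧ (∀ c ∈ g'.centers, g'.CalmAt c) ∧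
      g'.worker = g.worker ∧ g'.workerMoves = g.workerMoves ∧
      (g'.city (cityHex j)).pop = 2 ∧ ∀ c, c ≠ cityHex j → g'.city c = g.city c := by
  obtain ⟨r, hr⟩ := Multiset.exists_cons_of_mem hset
  obtain ⟨hp, hcap, htr, hti, hwo, hcard⟩ := newCity_spec h hnot 2
  set C := g.newCity w (cityHex j) 2
  set g' : Game := { g with
    centers := insert (cityHex j) g.centers
    city := Function.update g.city (cityHex j) C
    settlers := r } with hg'
  have hself : g'.city (cityHex j) = C := Function.update_self _ _ _
  have hne : ∀ c, c ≠ cityHex j → g'.city c = g.city c := fun c hc =>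
    Function.update_of_ne hc _ _
  have hnm : cityHex j ∉ g.centers := fun hc => hnot (h.mem_centers.1 hc)
  have hst : g'.stateCities = g.stateCities := by
    ext c
    simp only [stateCities, hg', Finset.mem_filter, Finset.mem_insert]
    constructor
    · rintro ⟨rfl | hc, h0⟩
      · exact absurd rfl h0
      · exact ⟨hc, h0⟩
    · exact fun ⟨hc, h0⟩ => ⟨Or.inr hc, h0⟩
  have hstne : ∀ c ∈ g.stateCities, c ≠ cityHex j := by
    rintro c hc rfl
    exact hnm (Finset.mem_filter.1 hc).1
  have hstaffed : ∀ c, c ≠ cityHex j → g.Staffed c → g'.Staffed c := by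
    intro c hc hs
    rw [Staffed, hne c hc]
    exact hs
  -- The Settler has `1 + 1` movement points; the cap `2` equals the initial population, so the new
  -- City does not grow by itself.
  refine ⟨g', .single (.found g (cityHex j) 1 2 r hr (hw.ne_other (by simp [cityHex])) ?_),
    ⟨?_, ?_, ?_, ?_⟩, ?_, rfl, rfl, by rw [hself, hp], hne⟩
  · intro c hc
    rcases h.cases hc with hs | ⟨i, h₁, h₂, rfl⟩
    · exact h.state.far c hs _
    · have hij : i ≠ j := fun hij => hnot (hij ▸ ⟨h₁, h₂⟩)
      simp only [hexDist, cityHex]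
      omega
  · refine h.state.congr hst (fun c hc => ?_) rfl (fun c hc => ?_) (fun c hc => ?_)
      (fun c hc => hstaffed c (hstne c hc) (h.state.staffed c hc))
    · rcases Finset.mem_insert.1 hc with rfl | hc
      exacts [Or.inr rfl, Or.inl hc]
    · rw [hne c (hstne c hc)]
    · rw [hne c (hstne c hc)]
  · intro c h0
    rw [hg']
    simp only [Finset.mem_insert]
    rw [h.row c h0]
    constructor
    · rintro (rfl | ⟨i, h₁, h₂, rfl⟩)
      · exact ⟨j, ((hj j).2 (Or.inr rfl)).1, ((hj j).2 (Or.inr rfl)).2, rfl⟩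
      · exact ⟨i, ((hj i).2 (Or.inl ⟨h₁, h₂⟩)).1, ((hj i).2 (Or.inl ⟨h₁, h₂⟩)).2, rfl⟩
    · rintro ⟨i, h₁, h₂, rfl⟩
      rcases (hj i).1 ⟨h₁, h₂⟩ with ⟨h₃, h₄⟩ | rfl
      exacts [Or.inr ⟨i, h₃, h₄, rfl⟩, Or.inl rfl]
  · intro i h₁ h₂
    rcases (hj i).1 ⟨h₁, h₂⟩ with ⟨h₃, h₄⟩ | rfl
    · rw [hne _ fun hij => hnot (cityHex_injective hij ▸ ⟨h₃, h₄⟩), h.tiles i h₃ h₄]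
    · rw [hself, hti]
  · intro i h₁ h₂
    rcases (hj i).1 ⟨h₁, h₂⟩ with ⟨h₃, h₄⟩ | rfl
    · exact hstaffed _ (fun hij => hnot (cityHex_injective hij ▸ ⟨h₃, h₄⟩)) (h.staffed i h₃ h₄)
    · rw [Staffed, hself, hti, hp, hcard]
      exact ⟨hwo, rfl⟩
  · intro c hc
    by_cases hcj : c = cityHex j
    · rw [CalmAt, hcj, hself]
      exact ⟨by rw [hcap, hp], htr⟩
    · rw [CalmAt, hne c hcj]
      rcases Finset.mem_insert.1 hc with rfl | hc
      exacts [absurd rfl hcj, hcalm c hc]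

end Game

end CivVI

namespace CivVI

/-! ### Extending the strip and moving the Worker -/

namespace Game

variable {w : World} {g g' g'' : Game} {lo hi : ℤ}

/-- The first and the last City on the strip have four Citizens, and the others have three. -/
def Sized (g : Game) (lo hi : ℤ) : Prop :=
  ∀ j, lo ≤ j → j < hi → (g.city (cityHex j)).pop = if j = lo ∨ j + 1 = hi then 4 else 3

/-- A new City is founded at an end of the strip. The City at the end has the number `e`, and the
new City the number `e + s`. -/
theorem Strip.exists_extension (hw : w.HasStrip) (h : Strip w g lo hi) (hsize : g.Sized lo hi)
    {e s lo' hi' : ℤ} (he : lo ≤ e ∧ e < hi)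
    (hs : (s = 1 ∧ e + 1 = hi ∧ lo' = lo ∧ hi' = hi + 1) ∨
      (s = -1 ∧ e = lo ∧ lo' = lo - 1 ∧ hi' = hi)) :
    ∃ t g', 0 < t ∧ t ≤ g.settlerCost + (w.growth 2 + 2 * w.growth 3 + 5) ∧ Path w g t g' ∧
      Strip w g' lo' hi' ∧ g'.Sized lo' hi' ∧ g'.worker = g.worker ∧ g'.workerMoves = 2 := by
  have hs' : s = 1 ∨ s = -1 := by omega
  have hpe : (g.city (cityHex e)).pop = 4 := by
    rw [hsize e he.1 he.2, if_pos (by omega)]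
  obtain ⟨g₁, p₁, h₁, w₁, -, c₁, pop₁, calm₁⟩ := h.exists_calm fun c => decide (c = cityHex e)
  have hcost : g₁.settlerCost = g.settlerCost := by rw [settlerCost, settlerCost, c₁]
  have hmem : cityHex e ∈ g.centers := h.mem_centers.2 he
  obtain ⟨t₂, g₂, pos₂, ht₂, p₂, h₂, calm₂, a₂, w₂, -, set₂, pop₂⟩ := h₁.exists_settler hw he
    (fun c hc hce => ⟨by rw [(calm₁ c (c₁ ▸ hc)).1]; exact Nat.zero_le _,
      by rw [(calm₁ c (c₁ ▸ hc)).2]; simpa using hce⟩)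
    (by rw [pop₁, hpe]; norm_num) (calm₁ _ hmem).1 (by rw [(calm₁ _ hmem).2]; simp)
    -- The worst case is a City without stored Production.
    (d := g₁.settlerCost - 1) (by omega)
  -- Two turns of two hexes each cover the distance four to the next place for a City.
  obtain ⟨g₃, p₃, h₃, calm₃, a₃, w₃, -, set₃⟩ := h₂.exists_settler_move hw calm₂ hs' set₂
  obtain ⟨g₄, p₄, h₄, calm₄, a₄, w₄, -, set₄⟩ := h₃.exists_settler_move hw calm₃ hs' set₃
  have hplace : ((4 * e + 2 * s + 2 * s, 0) : Hex) = cityHex (e + s) := by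
    rw [cityHex, Prod.mk.injEq]
    exact ⟨by ring, rfl⟩
  rw [hplace] at set₄
  obtain ⟨g₅, p₅, h₅, calm₅, w₅, -, pop₅, city₅⟩ := h₄.found hw calm₄ (j := e + s) (lo' := lo')
    (hi' := hi') (by omega) (by omega) set₄
  have hj : lo' ≤ e + s ∧ e + s < hi' := by omega
  obtain ⟨t₆, g₆, ht₆, p₆, h₆, calm₆, a₆, w₆, -, pop₆⟩ :=
    h₅.exists_growth hw hj calm₅ (by rw [pop₅]; norm_num)
  rw [pop₅] at ht₆ pop₆
  obtain ⟨t₇, g₇, ht₇, p₇, h₇, calm₇, a₇, w₇, m₇, pop₇⟩ :=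
    h₆.exists_growth hw hj calm₆ (by rw [pop₆]; norm_num)
  rw [pop₆] at ht₇ pop₇
  rw [show 2 + 1 = 3 from rfl] at ht₇
  have hpos : 50 ≤ g.settlerCost := Nat.le_add_left _ _
  have hother : ∀ i, i ≠ e + s → i ≠ e → (g₇.city (cityHex i)).pop = (g.city (cityHex i)).pop := by
    intro i hi₁ hi₂
    have hi₁' : cityHex i ≠ cityHex (e + s) := fun hc => hi₁ (cityHex_injective hc)
    have hi₂' : cityHex i ≠ cityHex e := fun hc => hi₂ (cityHex_injective hc)
    rw [a₇.pop (by simpa using hi₁'), a₆.pop (by simpa using hi₁'), city₅ _ hi₁',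
      a₄.pop (by simp), a₃.pop (by simp), a₂.pop (by simpa using hi₂'), pop₁]
  have hend : (g₇.city (cityHex e)).pop = 3 := by
    have he' : cityHex e ≠ cityHex (e + s) := fun hc => by
      have := cityHex_injective hc
      omega
    rw [a₇.pop (by simpa using he'), a₆.pop (by simpa using he'), city₅ _ he',
      a₄.pop (by simp), a₃.pop (by simp)]
    rw [pop₁, hpe] at pop₂
    omega
  have hpath : Path w g (t₂ + 1 + 1 + t₆ + t₇) g₇ :=
    ((((p₁.trans_of_zero p₂).trans p₃).trans p₄).trans (p₅.trans_of_zero p₆)).trans p₇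
  have hwork : g₇.worker = g.worker := by rw [w₇, w₆, w₅, w₄, w₃, w₂, w₁]
  -- A lone City is both the first and the last; after the extension it is still at one end and must
  -- grow back to four. This is the second `w.growth 3` in the bound.
  by_cases hone : lo + 1 = hi
  · have he' : lo' ≤ e ∧ e < hi' := by omega
    obtain ⟨t₈, g₈, ht₈, p₈, h₈, -, a₈, w₈, m₈, pop₈⟩ :=
      h₇.exists_growth hw he' calm₇ (by rw [hend]; norm_num)
    rw [hend] at ht₈ pop₈
    refine ⟨_, g₈, ?_, ?_, hpath.trans p₈, h₈, fun i hi₁ hi₂ => ?_, w₈.trans hwork, m₈⟩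
    · omega
    · omega
    · rw [if_pos (by omega)]
      by_cases hie : i = e
      · rw [hie, pop₈]
      · have hi' : cityHex i ≠ cityHex e := fun hc => hie (cityHex_injective hc)
        have : i = e + s := by omega
        rw [a₈.pop (by simpa using hi'), this, pop₇]
  · refine ⟨_, g₇, ?_, ?_, hpath, h₇, fun i hi₁ hi₂ => ?_, hwork, m₇⟩
    · omega
    · omega
    · by_cases hie : i = e
      · rw [hie, hend, if_neg (by omega)]
      · by_cases his : i = e + s
        · rw [his, pop₇, if_pos (by omega)]
        · rw [hother i his hie, hsize i (by omega) (by omega)]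
          by_cases hi₃ : i = lo ∨ i + 1 = hi
          · rw [if_pos hi₃, if_pos (by omega)]
          · rw [if_neg hi₃, if_neg (by omega)]

/-! ### The Worker -/

/-- The Worker walks along the strip. -/
theorem Strip.exists_walk (hw : w.HasStrip) (h : Strip w g lo hi) (hwork : g.worker.2 = 0)
    (x : ℤ) : ∃ t g', Path w g t g' ∧ Strip w g' lo hi ∧
      (∀ c, (g'.city c).pop = (g.city c).pop) ∧ g'.worker = (x, 0) := by
  obtain ⟨g₁, p₁, h₁, w₁, -, c₁, pop₁, calm₁⟩ := h.exists_calm fun _ => false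
  have hcalm : ∀ c ∈ g₁.centers, g₁.CalmAt c := fun c hc =>
    ⟨by rw [(calm₁ c (c₁ ▸ hc)).1]; exact Nat.zero_le _, (calm₁ c (c₁ ▸ hc)).2⟩
  have key : ∀ (n : ℕ) (g : Game), Strip w g lo hi → (∀ c ∈ g.centers, g.CalmAt c) →
      g.worker.2 = 0 → (x - g.worker.1).natAbs = n →
      ∃ t g', Path w g t g' ∧ Strip w g' lo hi ∧
        (∀ c, (g'.city c).pop = (g.city c).pop) ∧ g'.worker = (x, 0) := by
    intro n
    induction n with
    | zero =>
      intro g h _ h0 hn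
      refine ⟨0, g, .refl _, h, fun _ => rfl, Prod.ext ?_ h0⟩
      dsimp only
      omega
    | succ n ih =>
      intro g h hc h0 hn
      obtain ⟨s, hs, hs'⟩ : ∃ s : ℤ, (s = 1 ∨ s = -1) ∧ (x - (g.worker.1 + s)).natAbs = n := by
        rcases le_total x g.worker.1 with hx | hx
        · exact ⟨-1, by omega, by omega⟩
        · exact ⟨1, by omega, by omega⟩
      have ha : Agree ∅ g (g.advance w) := h.agree_advance hw fun c hcc _ => hc c hcc
      set g₂ : Game := { g.advance w with worker := (g.worker.1 + s, 0), workerMoves := 1 } with hg₂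
      have ha₂ : Agree ∅ g g₂ := ⟨rfl, rfl, ha.city⟩
      obtain ⟨t, g', p, h', hp, hx⟩ := ih g₂ (h.of_agree ha₂ (by simp) (by simp))
        (fun c hcc => ha₂.calmAt (by simp) (hc c hcc)) rfl hs'
      refine ⟨1 + t, g', (Path.advance g).trans (.act (.moveWorker _ _ 1 rfl ?_ ?_) p), h',
        fun c => (hp c).trans (ha₂.pop (by simp)), hx⟩
      · rw [mem_ring_iff]
        have : (g.advance w).worker = g.worker := rfl
        rw [this, h0]
        dsimp only
        omega
      · exact hw.ne_other (by simp)
  obtain ⟨t, g', p, h', hp, hx⟩ := key _ g₁ h₁ hcalm (by rw [w₁]; exact hwork) rfl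
  exact ⟨t, g', p₁.trans_of_zero p, h', fun c => (hp c).trans (pop₁ c), hx⟩

/-- The Worker moves to the next cell. -/
theorem Strip.exists_step (hw : w.HasStrip) (h : Strip w g lo hi) (d : Dir)
    (hwork : g.worker.2 = 0) (hm : g.workerMoves = 2) :
    ∃ g', Path w g 0 g' ∧ Strip w g' lo hi ∧ g'.city = g.city ∧
      g'.worker = nextCell g.worker d := by
  obtain ⟨s, hs, hd⟩ : ∃ s : ℤ, (s = 1 ∨ s = -1) ∧
      nextCell g.worker d = (g.worker.1 + s + s, 0) := by
    cases d with
    | left => exact ⟨-1, by omega, Prod.ext (by simp only [nextCell]; ring) hwork⟩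
    | right => exact ⟨1, by omega, Prod.ext (by simp only [nextCell]; ring) hwork⟩
  have hpass : ∀ y : ℤ, Passable w (y, 0) := fun y => hw.ne_other (by simp)
  set g₁ : Game := { g with worker := (g.worker.1 + s, 0), workerMoves := 1 }
  set g₂ : Game := { g₁ with worker := (g.worker.1 + s + s, 0), workerMoves := 0 }
  have ha : Agree ∅ g g₂ := ⟨rfl, rfl, fun _ _ => rfl⟩
  refine ⟨g₂, .act (.moveWorker g _ 1 hm ?_ (hpass _)) (.single (.moveWorker g₁ _ 0 rfl ?_ (hpass _))),
    h.of_agree ha (by simp) (by simp), rfl, hd.symm⟩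
  · rw [mem_ring_iff, hwork]
    dsimp only
    omega
  · rw [mem_ring_iff]
    dsimp only [g₁]
    omega

end Game

end CivVI

namespace CivVI

namespace Game

variable {w : World} {g g' : Game} {lo hi : ℤ}

/-! ### Displaying a configuration -/

theorem exists_le_sum_eq {α : Type*} (s : Finset α) (f : α → ℕ) (k : ℕ)
    (hk : k ≤ ∑ c ∈ s, f c) : ∃ m : α → ℕ, (∀ c ∈ s, m c ≤ f c) ∧ ∑ c ∈ s, m c = k := by
  classical
  induction s using Finset.induction_on generalizing k with
  | empty => exact ⟨fun _ => 0, by simp, by simp at hk ⊢; omega⟩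
  | insert c s hc ih =>
    rw [Finset.sum_insert hc] at hk
    obtain ⟨m, hm, hsum⟩ := ih (k - min k (f c)) (by omega)
    refine ⟨Function.update m c (min k (f c)), fun d hd => ?_, ?_⟩
    · by_cases hdc : d = c
      · subst hdc
        rw [Function.update_self]
        exact min_le_right _ _
      · rw [Function.update_of_ne hdc]
        exact hm d (Finset.mem_of_mem_insert_of_ne hd hdc)
    · rw [Finset.sum_insert hc, Function.update_self, Finset.sum_update_of_notMem hc, hsum]
      omega

/-- A City off the strip can work any number of its Monasteries. -/
theorem HasStateTiles.exists_worked (h : g.HasStateTiles w) {c : Hex} (hc : c ∈ g.stateCities)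
    {m : ℕ} (hm : m ≤ g.count .monastery c) :
    ∃ W : Finset Hex, (∀ x ∈ W, x ∈ (g.city c).tiles) ∧ W.card + 1 = (g.city c).pop ∧
      (W.filter fun x => g.improvement x = some .monastery).card = m := by
  set A := ((g.city c).tiles.filter fun x => g.improvement x = some .monastery).toFinset
  set B := ((g.city c).tiles.filter fun x => ¬ g.improvement x = some .monastery).toFinset
  have hA : A.card = g.count .monastery c :=
    List.toFinset_card_of_nodup ((h.nodup c hc).filter _)
  have hB : B.card = _ := List.toFinset_card_of_nodup ((h.nodup c hc).filter _)
  have hAB := List.length_eq_length_filter_add (l := (g.city c).tiles)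
    fun x => decide (g.improvement x = some .monastery)
  have hB' : B.card + g.count .monastery c = (g.city c).tiles.length := by
    rw [hB, hAB, count, add_comm]
    simp
  obtain ⟨h₁, h₂⟩ := h.citizens c hc
  obtain ⟨A', hA', hcA⟩ := Finset.exists_subset_card_eq (s := A) (n := m) (by omega)
  -- The other Citizens fit on the remaining tiles, even if no Monastery is worked.
  obtain ⟨B', hB', hcB⟩ := Finset.exists_subset_card_eq (s := B)
    (n := (g.city c).pop - 1 - m) (by omega)
  have hmA : ∀ x ∈ A', x ∈ (g.city c).tiles ∧ g.improvement x = some .monastery := by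
    intro x hx
    simpa [A] using hA' hx
  have hmB : ∀ x ∈ B', x ∈ (g.city c).tiles ∧ g.improvement x ≠ some .monastery := by
    intro x hx
    simpa [B] using hB' hx
  have hdisj : Disjoint A' B' := by
    rw [Finset.disjoint_left]
    exact fun x hx hx' => (hmB x hx').2 (hmA x hx).2
  refine ⟨A' ∪ B', fun x hx => ?_, ?_, ?_⟩
  · rcases Finset.mem_union.1 hx with hx | hx
    exacts [(hmA x hx).1, (hmB x hx).1]
  · rw [Finset.card_union_of_disjoint hdisj]
    omega
  · rw [Finset.filter_union, Finset.filter_true_of_mem fun x hx => (hmA x hx).2,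
      Finset.filter_false_of_mem fun x hx => (hmB x hx).2, Finset.union_empty, hcA]

/-- A City on the strip with three or four Citizens can show two arbitrary symbols. -/
theorem exists_worked_ring (j : ℤ) {p : ℕ} (hp : p = 3 ∨ p = 4) (s t : Prop) :
    ∃ W : Finset Hex, (∀ x ∈ W, x ∈ ring (cityHex j)) ∧ W.card + 1 = p ∧
      (cellHex (2 * j) ∈ W ↔ s) ∧ (cellHex (2 * j + 1) ∈ W ↔ t) := by
  classical
  have hne : cellHex (2 * j) ≠ cellHex (2 * j + 1) := by
    simp only [cellHex, ne_eq, Prod.mk.injEq, and_true]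
    omega
  set A : Finset Hex := ({cellHex (2 * j), cellHex (2 * j + 1)} : Finset Hex).filter fun x =>
    (x = cellHex (2 * j) ∧ s) ∨ (x = cellHex (2 * j + 1) ∧ t) with hA
  -- The four floodplains absorb the at most three Citizens that no cell needs.
  set F : Finset Hex := ((ring (cityHex j)).filter fun x => x.2 ≠ 0).toFinset with hF
  have hcF : F.card = 4 := by
    rw [hF, List.toFinset_card_of_nodup ((ring_nodup _).filter _)]
    simp [ring, cityHex]
  have hcA : A.card ≤ 2 := (Finset.card_filter_le _ _).trans Finset.card_le_two
  obtain ⟨F', hF', hcF'⟩ := Finset.exists_subset_card_eq (s := F) (n := p - 1 - A.card) (by omega)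
  have hmF : ∀ x ∈ F', x ∈ ring (cityHex j) ∧ x.2 ≠ 0 := by
    intro x hx
    simpa [F] using hF' hx
  have hmA : ∀ x ∈ A, x = cellHex (2 * j) ∨ x = cellHex (2 * j + 1) := by
    intro x hx
    simpa using (Finset.mem_filter.1 hx).1
  have hdisj : Disjoint A F' := by
    rw [Finset.disjoint_left]
    intro x hx hx'
    apply (hmF x hx').2
    rcases hmA x hx with rfl | rfl <;> rfl
  refine ⟨A ∪ F', fun x hx => ?_, ?_, ?_, ?_⟩
  · rcases Finset.mem_union.1 hx with hx | hx
    · rw [mem_ring_iff]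
      rcases hmA x hx with rfl | rfl <;> simp only [cellHex, cityHex, and_true] <;> omega
    · exact (hmF x hx).1
  · rw [Finset.card_union_of_disjoint hdisj]
    omega
  · have : cellHex (2 * j) ∉ F' := fun hx => (hmF _ hx).2 rfl
    simp [hA, this, hne]
  · have : cellHex (2 * j + 1) ∉ F' := fun hx => (hmF _ hx).2 rfl
    simp [hA, this, hne.symm]

/-- The Faith yield comes from the Monasteries. -/
theorem Strip.faith_eq (h : Strip w g lo hi) : g.faith w = w.baseFaith +
    2 * ∑ c ∈ g.stateCities,
      ((g.city c).worked.filter fun x => g.improvement x = some .monastery).card := by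
  have hsum : ∑ c ∈ g.stateCities, ∑ x ∈ (g.city c).worked, g.tileFaith w x =
      ∑ c ∈ g.centers, ∑ x ∈ (g.city c).worked, g.tileFaith w x := by
    refine Finset.sum_subset (Finset.filter_subset _ _) fun c hc hcs => ?_
    rcases h.cases hc with hs | ⟨j, h₁, h₂, rfl⟩
    · exact absurd hs hcs
    · refine Finset.sum_eq_zero fun x hx => ?_
      have hx' := (h.staffed j h₁ h₂).1 x hx
      rw [h.tiles j h₁ h₂] at hx'
      rw [tileFaith, h.state.bare x (abs_le_of_mem_ring hx'), if_neg (by simp)]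
  rw [faith, ← hsum, Finset.mul_sum]
  congr 1
  refine Finset.sum_congr rfl fun c hc => ?_
  rw [Finset.card_filter, Finset.mul_sum]
  refine Finset.sum_congr rfl fun x hx => ?_
  rw [tileFaith]
  by_cases hm : g.improvement x = some .monastery
  · have hx' := (h.state.staffed c hc).1 x hx
    have hnil : ((ring x).filter fun k => k ∈ w.districts ∪ g.centers) = [] := by
      rw [List.filter_eq_nil_iff]
      intro k hk
      have := h.state.noDistrict c hc x hx' (by rw [hm]; simp) k hk
      simp [this.1, this.2]
    rw [if_pos hm, if_pos hm, hnil]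
    rfl
  · rw [if_neg hm, if_neg hm, mul_zero]

theorem cellHex_mem_ring (m : ℤ) : cellHex m ∈ ring (cityHex (m / 2)) := by
  rw [mem_ring_iff]
  simp only [cellHex, cityHex, and_true]
  omega

theorem Strip.unowned_cellHex (h : Strip w g lo hi) (m : ℤ) :
    g.Unowned (cellHex m) ↔ m < 2 * lo ∨ 2 * hi ≤ m := by
  rw [h.unowned_iff (cellHex_mem_ring m)]
  omega

theorem nextCell_cellHex (m : ℤ) (d : Dir) :
    nextCell (cellHex m) d = cellHex (match d with | .left => m - 1 | .right => m + 1) := by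
  cases d <;> simp only [nextCell, cellHex, Prod.mk.injEq, and_true] <;> ring

/-- The flag says whether a Settler is needed. -/
theorem Strip.flag_eq_iff {n : ℕ} (h : Strip w g lo (lo + n)) {q : Fin 24}
    {l : List Symbol} {a : Symbol} {r : List Symbol} (hlen : l.length + 1 + r.length = 2 * n)
    (hwork : g.worker = cellHex (2 * lo + l.length)) :
    rogozhin.flag q l a r = .n ↔ g.NeedsSettler q a := by
  have hδ : rogozhin.δ q a = table q a := rfl
  rw [TM.flag, NeedsSettler, hδ, hwork]
  rcases htab : table q a with _ | ⟨q', a', _ | _⟩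
  · simp
  · have : (∃ q'' a'' d, some (q', a', Dir.left) = some (q'', a'', d) ∧
        g.Unowned (nextCell (cellHex (2 * lo + l.length)) d)) ↔
        g.Unowned (cellHex (2 * lo + l.length - 1)) := by
      constructor
      · rintro ⟨_, _, _, heq, hu⟩
        cases heq
        rwa [nextCell_cellHex] at hu
      · exact fun hu => ⟨_, _, _, rfl, by rwa [nextCell_cellHex]⟩
    rw [this, h.unowned_cellHex]
    cases l with
    | nil => simp
    | cons b l =>
      simp only [List.length_cons] at hlen
      simp
      omega
  · have : (∃ q'' a'' d, some (q', a', Dir.right) = some (q'', a'', d) ∧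
        g.Unowned (nextCell (cellHex (2 * lo + l.length)) d)) ↔
        g.Unowned (cellHex (2 * lo + l.length + 1)) := by
      constructor
      · rintro ⟨_, _, _, heq, hu⟩
        cases heq
        rwa [nextCell_cellHex] at hu
      · exact fun hu => ⟨_, _, _, rfl, by rwa [nextCell_cellHex]⟩
    rw [this, h.unowned_cellHex]
    cases r with
    | nil =>
      simp only [List.length_nil] at hlen
      simp
      omega
    | cons b r =>
      simp only [List.length_cons] at hlen
      simp
      omega

/-- In one turn, the player can write any tape of the right length and any state, if the Worker
stands in the right place. -/
theorem Strip.exists_displays (hw : w.HasStrip) {n : ℕ} (h : Strip w g lo (lo + n))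
    (hsize : g.Sized lo (lo + n)) (q : Fin 24) {l : List Symbol} (a : Symbol) {r : List Symbol}
    (hlen : l.length + 1 + r.length = 2 * n) (hwork : g.worker = cellHex (2 * lo + l.length)) :
    ∃ g', Path w g 1 g' ∧ g'.HasStateTiles w ∧ g'.Displays w (rogozhin.withFlag q l a r) := by
  classical
  set T := l.reverse ++ a :: r with hT
  -- The number of the state is at most 23, the number of Monasteries; it is split among the Cities
  -- off the strip.
  obtain ⟨m, hm, hsum⟩ := exists_le_sum_eq g.stateCities (g.count .monastery) q
    (by rw [h.state.monasteries]; have := q.2; omega)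
  have hex : ∀ c, ∃ W : Finset Hex, (c ∈ g.centers →
      (∀ x ∈ W, x ∈ (g.city c).tiles) ∧ W.card + 1 = (g.city c).pop) ∧
      (c ∈ g.stateCities →
        (W.filter fun x => g.improvement x = some .monastery).card = m c) ∧
      ∀ i : ℕ, i < n → c = cityHex (lo + i) →
        (cellHex (2 * (lo + i)) ∈ W ↔ T[2 * i]? = some .worked) ∧
        (cellHex (2 * (lo + i) + 1) ∈ W ↔ T[2 * i + 1]? = some .worked) := by
    intro c
    by_cases hc : c ∈ g.centers
    · rcases h.cases hc with hs | ⟨j, h₁, h₂, rfl⟩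
      · obtain ⟨W, hW₁, hW₂, hW₃⟩ := h.state.exists_worked hs (hm c hs)
        refine ⟨W, fun _ => ⟨hW₁, hW₂⟩, fun _ => hW₃, ?_⟩
        rintro i - rfl
        exact absurd rfl (Finset.mem_filter.1 hs).2
      · obtain ⟨i, rfl⟩ : ∃ i : ℕ, j = lo + i := ⟨(j - lo).toNat, by omega⟩
        obtain ⟨W, hW₁, hW₂, hW₃, hW₄⟩ := exists_worked_ring (lo + i)
          (p := (g.city (cityHex (lo + i))).pop)
          (by rw [hsize _ h₁ h₂]; split_ifs <;> simp)
          (T[2 * i]? = some .worked) (T[2 * i + 1]? = some .worked)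
        refine ⟨W, fun _ => ⟨by rwa [h.tiles _ h₁ h₂], hW₂⟩,
          fun hs => absurd rfl (Finset.mem_filter.1 hs).2, ?_⟩
        intro i' _ hi'
        obtain rfl : i = i' := by
          have := cityHex_injective hi'
          omega
        exact ⟨hW₃, hW₄⟩
    · refine ⟨∅, fun hc' => absurd hc' hc, fun hs => absurd (Finset.mem_filter.1 hs).1 hc, ?_⟩
      rintro i hi rfl
      exact absurd (h.mem_centers.2 ⟨by omega, by omega⟩) hc
  choose W hW₁ hW₂ hW₃ using hex
  have hW₁' : ∀ c ∈ g.centers, (∀ x ∈ W c, x ∈ (g.city c).tiles) ∧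
      (W c).card + 1 = (g.city c).pop := hW₁
  -- With cap `0` and no training, the end of the turn moves no Citizen, so tape and state persist
  -- into the next turn.
  set g₁ := g.arrange W (fun _ => 0) (fun _ => false) with hg₁
  have h₁ : Strip w g₁ lo (lo + n) := h.arrange hW₁'
  have hcity : ∀ c ∈ g.centers, g₁.city c =
      { g.city c with worked := W c, cap := 0, training := false } := fun c hc => arrange_city hc
  have hcalm : ∀ c ∈ g₁.centers, g₁.CalmAt c := by
    intro c hc
    rw [CalmAt, hcity c hc]
    exact ⟨Nat.zero_le _, rfl⟩
  have h₂ : Strip w (g₁.advance w) lo (lo + n) := h₁.advance hw hcalm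
  have ha : Agree ∅ g₁ (g₁.advance w) := h₁.agree_advance hw fun c hc _ => hcalm c hc
  have hworked : ∀ c ∈ g.centers, ((g₁.advance w).city c).worked = W c := by
    intro c hc
    rw [(City.core_eq_iff.1 (ha.city c (by simp))).2.2.1, hcity c hc]
  refine ⟨g₁.advance w, (path_arrange w g W _ _ hW₁').trans_of_zero (Path.advance _), h₂.state,
    lo, n, ?_, ?_, ?_, ?_, hwork, rfl, ?_, h₂.flag_eq_iff hlen hwork⟩
  · simp only [List.length_append, List.length_reverse, List.length_cons]
    omega
  · intro c hc
    rw [h₂.row c hc]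
    constructor
    · rintro ⟨j, hj₁, hj₂, rfl⟩
      exact ⟨(j - lo).toNat, by omega, by congr 1; omega⟩
    · rintro ⟨i, hi, rfl⟩
      exact ⟨lo + i, by omega, by omega, rfl⟩
  · intro i hi
    have hi₁ : lo ≤ lo + (i : ℤ) := by omega
    have hi₂ : lo + (i : ℤ) < lo + n := by omega
    refine ⟨h₂.tiles _ hi₁ hi₂, ?_, h₂.staffed _ hi₁ hi₂⟩
    rw [ha.pop (by simp), hcity _ (h.mem_centers.2 ⟨hi₁, hi₂⟩)]
    dsimp only
    rw [hsize _ hi₁ hi₂]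
    refine if_congr ?_ rfl rfl
    omega
  · intro j s hs
    have hj : j < T.length := (List.getElem?_eq_some_iff.1 hs).1
    have hj' : j / 2 < n := by
      rw [hT] at hj
      simp only [List.length_append, List.length_reverse, List.length_cons] at hj
      omega
    have hmem : cityHex (lo + (j / 2 : ℕ)) ∈ g.centers :=
      h.mem_centers.2 ⟨by omega, by omega⟩
    rw [hworked _ hmem]
    obtain ⟨h₃, h₄⟩ := hW₃ _ (j / 2) hj' rfl
    have hsw : s = .worked ↔ T[j]? = some .worked := by
      rw [hs, Option.some_inj]
    rw [hsw]
    rcases Nat.even_or_odd' j with ⟨i, rfl | rfl⟩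
    · rw [show 2 * i / 2 = i by omega] at h₃ ⊢
      rw [← h₃]
      push_cast
      rw [mul_add]
    · rw [show (2 * i + 1) / 2 = i by omega] at h₄ ⊢
      rw [← h₄]
      push_cast
      rw [mul_add, add_assoc]
  · rw [h₂.faith_eq]
    congr 2
    rw [← hsum]
    refine Finset.sum_congr rfl fun c hc => ?_
    rw [hworked c (Finset.mem_filter.1 hc).1]
    exact hW₂ c hc

end Game

end CivVI

namespace CivVI

namespace Game

variable {w : World} {g g' : Game} {lo hi : ℤ}

/-! ### The game carries the machine -/

theorem Displays.exists_strip (hst : g.HasStateTiles w) {q : Fin 24} {x : Flag} {l : List Symbol}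
    {a : Symbol} {r : List Symbol} (hd : g.Displays w ((q, x), l, a, r)) :
    ∃ (lo : ℤ) (n : ℕ), Strip w g lo (lo + n) ∧ g.Sized lo (lo + n) ∧
      l.length + 1 + r.length = 2 * n ∧ g.worker = cellHex (2 * lo + l.length) ∧
      g.workerMoves = 2 ∧ (x = .n ↔ g.NeedsSettler q a) := by
  obtain ⟨lo, n, hlen, hrow, hcity, -, hwork, hmoves, -, hflag⟩ := hd
  have hidx : ∀ j, lo ≤ j → j < lo + n → ∃ i : ℕ, i < n ∧ j = lo + i := fun j h₁ h₂ =>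
    ⟨(j - lo).toNat, by omega, by omega⟩
  refine ⟨lo, n, ⟨hst, fun h h0 => ?_, fun j h₁ h₂ => ?_, fun j h₁ h₂ => ?_⟩, fun j h₁ h₂ => ?_,
    ?_, hwork, hmoves, hflag⟩
  · rw [hrow h h0]
    constructor
    · rintro ⟨i, hi, rfl⟩
      exact ⟨lo + i, by omega, by omega, rfl⟩
    · rintro ⟨j, h₁, h₂, rfl⟩
      obtain ⟨i, hi, rfl⟩ := hidx j h₁ h₂
      exact ⟨i, hi, rfl⟩
  · obtain ⟨i, hi, rfl⟩ := hidx j h₁ h₂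
    exact (hcity i hi).1
  · obtain ⟨i, hi, rfl⟩ := hidx j h₁ h₂
    exact (hcity i hi).2.2
  · obtain ⟨i, hi, rfl⟩ := hidx j h₁ h₂
    rw [(hcity i hi).2.1]
    refine if_congr ?_ rfl rfl
    omega
  · simp only [List.length_append, List.length_reverse, List.length_cons] at hlen
    omega

/-- An instruction within the tape takes one turn. -/
theorem Strip.exists_displays_of_step (hw : w.HasStrip) {n : ℕ} (h : Strip w g lo (lo + n))
    (hsize : g.Sized lo (lo + n)) {m : ℤ} (hwork : g.worker = cellHex m)
    (hmoves : g.workerMoves = 2) (d : Dir) (q : Fin 24) {l : List Symbol} (a : Symbol)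
    {r : List Symbol} (hlen : l.length + 1 + r.length = 2 * n)
    (hm : nextCell (cellHex m) d = cellHex (2 * lo + l.length)) :
    ∃ g', Path w g 1 g' ∧ g'.HasStateTiles w ∧ g'.Displays w (rogozhin.withFlag q l a r) := by
  obtain ⟨g₁, p₁, h₁, c₁, w₁⟩ := h.exists_step hw d (by rw [hwork]; rfl) hmoves
  obtain ⟨g₂, p₂, h₂⟩ := h₁.exists_displays hw
    (by rw [Sized, c₁]; exact hsize) q a hlen (by rw [w₁, hwork, hm])
  exact ⟨g₂, p₁.trans_of_zero p₂, h₂⟩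

theorem exists_path_of_flaggedStep (hw : w.HasStrip) (hst : g.HasStateTiles w)
    {κ κ' : Config State Symbol} (hd : g.Displays w κ) (hstep : rogozhin.flaggedStep κ = some κ') :
    ∃ t g', Path w g t g' ∧ g'.HasStateTiles w ∧ g'.Displays w κ' ∧ (κ.1.2 = .b → t = 1) ∧
      (κ.1.2 = .n → 0 < t ∧
        t ≤ (w.growth 2 + 2 * w.growth 3 + 3) +
          (15 * tapeLength κ + 50 + 30 * g.stateCities.card) + 3) := by
  obtain ⟨⟨q, x⟩, l, a, r⟩ := κ
  obtain ⟨lo, n, h, hsize, hlen, hwork, hmoves, hflag⟩ := hd.exists_strip hst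
  -- Twice the number of Cities is the length of the tape plus twice the number of Cities off the
  -- strip.
  have hcost : g.settlerCost = 15 * tapeLength ((q, x), l, a, r) + 50 +
      30 * g.stateCities.card := by
    have := h.card_centers
    rw [settlerCost, tapeLength, hlen]
    omega
  have hn : 0 < n := by omega
  cases x with
  | b =>
    have done : ∀ g', Path w g 1 g' → g'.HasStateTiles w → g'.Displays w κ' →
        ∃ t g', Path w g t g' ∧ g'.HasStateTiles w ∧ g'.Displays w κ' ∧
          (Flag.b = .b → t = 1) ∧ (Flag.b = .n → 0 < t ∧
            t ≤ (w.growth 2 + 2 * w.growth 3 + 3) +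
              (15 * tapeLength ((q, Flag.b), l, a, r) + 50 + 30 * g.stateCities.card) + 3) :=
      fun g' p hs hd' => ⟨1, g', p, hs, hd', fun _ => rfl, fun hx => by cases hx⟩
    cases hδ : rogozhin.δ q a with
    | none => simp [TM.flaggedStep, hδ] at hstep
    | some o =>
      obtain ⟨q', a', _ | _⟩ := o
      · cases l with
        | nil => simp [TM.flaggedStep, hδ] at hstep
        | cons c l =>
          rw [rogozhin.flaggedStep_left hδ (c := c) (l' := l) (by simp), Option.some_inj] at hstep
          subst hstep
          obtain ⟨g', p, hs, hd'⟩ := h.exists_displays_of_step hw hsize hwork hmoves .left q'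
            (l := l) c (r := a' :: r) (by simp only [List.length_cons] at hlen ⊢; omega)
            (by rw [nextCell_cellHex]; simp only [List.length_cons]; congr 1; push_cast; ring)
          exact done g' p hs hd'
      · cases r with
        | nil => simp [TM.flaggedStep, hδ] at hstep
        | cons c r =>
          rw [rogozhin.flaggedStep_right hδ (c := c) (r' := r) (by simp), Option.some_inj] at hstep
          subst hstep
          obtain ⟨g', p, hs, hd'⟩ := h.exists_displays_of_step hw hsize hwork hmoves .right q'
            (l := a' :: l) c (r := r) (by simp only [List.length_cons] at hlen ⊢; omega)
            (by rw [nextCell_cellHex]; simp only [List.length_cons]; congr 1; push_cast; ring)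
          exact done g' p hs hd'
  | n =>
    have hflag' := (h.flag_eq_iff hlen hwork).2 (hflag.1 rfl)
    -- First the strip is extended, then the instruction is carried out in one more turn.
    suffices ∃ t g₁ g', 0 < t ∧ t ≤ g.settlerCost + (w.growth 2 + 2 * w.growth 3 + 5) ∧
        Path w g t g₁ ∧ Path w g₁ 1 g' ∧ g'.HasStateTiles w ∧ g'.Displays w κ' by
      obtain ⟨t, g₁, g', ht, ht', p₁, p₂, hs, hd'⟩ := this
      refine ⟨t + 1, g', p₁.trans p₂, hs, hd', fun hx => (by cases hx), fun _ => ⟨by omega, ?_⟩⟩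
      rw [← hcost]
      omega
    cases hδ : rogozhin.δ q a with
    | none => simp [TM.flaggedStep, hδ] at hstep
    | some o =>
      obtain ⟨q', a', _ | _⟩ := o
      · obtain rfl : l = [] := by
          simpa [TM.flag, hδ] using hflag'
        rw [rogozhin.flaggedStep_left hδ (c := .idle) (l' := [.idle]) rfl,
          Option.some_inj] at hstep
        subst hstep
        obtain ⟨t, g₁, ht, ht', p₁, h₁, hsize₁, w₁, m₁⟩ := h.exists_extension hw hsize (e := lo)
          (s := -1) (lo' := lo - 1) (hi' := lo - 1 + (n + 1 : ℕ)) (by omega)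
          (Or.inr ⟨rfl, rfl, rfl, by push_cast; ring⟩)
        obtain ⟨g', p, hs, hd'⟩ := h₁.exists_displays_of_step hw hsize₁ (w₁.trans hwork) m₁ .left q'
          (l := [.idle]) .idle (r := a' :: r)
          (by simp only [List.length_cons, List.length_nil] at hlen ⊢; omega)
          (by
            rw [nextCell_cellHex]
            simp only [List.length_cons, List.length_nil]
            congr 1; push_cast; ring)
        exact ⟨t, g₁, g', ht, ht', p₁, p, hs, hd'⟩
      · obtain rfl : r = [] := by
          simpa [TM.flag, hδ] using hflag'
        rw [rogozhin.flaggedStep_right hδ (c := .idle) (r' := [.idle]) rfl,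
          Option.some_inj] at hstep
        subst hstep
        obtain ⟨t, g₁, ht, ht', p₁, h₁, hsize₁, w₁, m₁⟩ := h.exists_extension hw hsize
          (e := lo + n - 1) (s := 1) (lo' := lo) (hi' := lo + (n + 1 : ℕ)) (by omega)
          (Or.inl ⟨rfl, by ring, rfl, by push_cast; ring⟩)
        obtain ⟨g', p, hs, hd'⟩ := h₁.exists_displays_of_step hw hsize₁ (w₁.trans hwork) m₁ .right
          q' (l := a' :: l) .idle (r := [.idle])
          (by simp only [List.length_cons, List.length_nil] at hlen ⊢; omega)
          (by
            rw [nextCell_cellHex]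
            simp only [List.length_cons]
            congr 1; push_cast; ring)
        exact ⟨t, g₁, g', ht, ht', p₁, p, hs, hd'⟩

/-! ### From the setup to a configuration -/

theorem Setup.strip (h : g.Setup w) : Strip w g 0 1 := by
  have hj : ∀ j : ℤ, 0 ≤ j → j < 1 → cityHex j = (0, 0) := by
    intro j h₁ h₂
    obtain rfl : j = 0 := by omega
    rfl
  refine ⟨h.stateTiles, fun k hk => ?_, fun j h₁ h₂ => ?_, fun j h₁ h₂ => ?_⟩
  · rw [h.oneCity k hk]
    constructor
    · rintro rfl
      exact ⟨0, le_rfl, one_pos, rfl⟩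
    · rintro ⟨j, h₁, h₂, rfl⟩
      exact hj j h₁ h₂
  · rw [hj j h₁ h₂]
    exact h.tiles
  · rw [hj j h₁ h₂]
    exact h.staffed

theorem Setup.exists_sized (hw : w.HasStrip) (h : g.Setup w) :
    ∃ t g', Path w g t g' ∧ Strip w g' 0 1 ∧ g'.Sized 0 1 ∧ g'.worker.2 = 0 := by
  have key : ∀ (d : ℕ) (g : Game), Strip w g 0 1 → (g.city (cityHex 0)).pop + d = 4 →
      ∃ t g', Path w g t g' ∧ Strip w g' 0 1 ∧ (g'.city (cityHex 0)).pop = 4 ∧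
        g'.worker = g.worker := by
    intro d
    induction d with
    | zero => exact fun g h hp => ⟨0, g, .refl _, h, hp, rfl⟩
    | succ d ih =>
      intro g h hp
      obtain ⟨g₁, p₁, h₁, w₁, -, c₁, pop₁, calm₁⟩ := h.exists_calm fun _ => false
      have hcalm : ∀ c ∈ g₁.centers, g₁.CalmAt c := fun c hc =>
        ⟨by rw [(calm₁ c (c₁ ▸ hc)).1]; exact Nat.zero_le _, (calm₁ c (c₁ ▸ hc)).2⟩
      obtain ⟨t, g₂, -, p₂, h₂, -, -, w₂, -, pop₂⟩ := h₁.exists_growth hw (j := 0) (by norm_num)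
        hcalm (by rw [pop₁]; omega)
      rw [pop₁] at pop₂
      obtain ⟨t', g₃, p₃, h₃, pop₃, w₃⟩ := ih g₂ h₂ (by omega)
      exact ⟨t + t', g₃, p₁.trans_of_zero (p₂.trans p₃), h₃, pop₃, by rw [w₃, w₂, w₁]⟩
  have hpop : (g.city (cityHex 0)).pop ≤ 4 := h.pop
  obtain ⟨t, g', p, h', hp, hwk⟩ := key (4 - (g.city (cityHex 0)).pop) g h.strip (by omega)
  refine ⟨t, g', p, h', fun j h₁ h₂ => ?_, by rw [hwk]; exact h.worker⟩
  obtain rfl : j = 0 := by omega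
  rw [hp, if_pos (Or.inl rfl)]

theorem Setup.exists_strip (hw : w.HasStrip) (h : g.Setup w) (n : ℕ) :
    ∃ t g', Path w g t g' ∧ Strip w g' 0 (0 + (n + 1 : ℕ)) ∧ g'.Sized 0 (0 + (n + 1 : ℕ)) ∧
      g'.worker.2 = 0 := by
  induction n with
  | zero => simpa using h.exists_sized hw
  | succ n ih =>
    obtain ⟨t, g₁, p₁, h₁, hs₁, w₁⟩ := ih
    obtain ⟨t', g₂, -, -, p₂, h₂, hs₂, w₂, -⟩ := h₁.exists_extension hw hs₁ (e := n) (s := 1)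
      (lo' := 0) (hi' := 0 + (n + 1 + 1 : ℕ)) (by push_cast; omega)
      (Or.inl ⟨rfl, by push_cast; ring, rfl, by push_cast; ring⟩)
    exact ⟨t + t', g₂, p₁.trans p₂, h₂, hs₂, by rw [w₂, w₁]⟩

/-- Contents play no role while the tape is built: Cities are added on the right until the length
fits, the Worker walks to the scanned cell, and one turn writes all symbols and the state. -/
theorem Setup.exists_displays (hw : w.HasStrip) (h : g.Setup w) {κ : Config State Symbol}
    (hκ : rogozhin.FlaggedValid κ) :
    ∃ t g', Path w g t g' ∧ g'.HasStateTiles w ∧ g'.Displays w κ := by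
  obtain ⟨⟨q, x⟩, l, a, r⟩ := κ
  obtain ⟨⟨n, hn⟩, rfl⟩ := hκ
  obtain ⟨n, rfl⟩ : ∃ m, n = m + 1 := ⟨n - 1, by omega⟩
  obtain ⟨t₁, g₁, p₁, h₁, hs₁, w₁⟩ := h.exists_strip hw n
  obtain ⟨t₂, g₂, p₂, h₂, pop₂, w₂⟩ := h₁.exists_walk hw w₁ (2 * (2 * 0 + l.length) - 1)
  obtain ⟨g₃, p₃, hst, hd⟩ := h₂.exists_displays hw
    (fun j hj₁ hj₂ => by rw [pop₂, hs₁ j hj₁ hj₂]) q a (l := l) (r := r) (by omega) w₂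
  exact ⟨_, g₃, (p₁.trans p₂).trans p₃, hst, hd⟩

end Game

end CivVI

theorem theorem3 :
    -- the machine is a (48, 2)-UTM
    CivVI.IsUTM 48 2 CivVI.State CivVI.Symbol
      CivVI.rogozhin.flaggedStep CivVI.rogozhin.flaggedInitial ∧
    -- and the game carries it; the constant depends only on the growth rule of the game
    ∃ C : (ℕ → ℕ) → ℕ, ∀ (w : CivVI.World) (g₀ : CivVI.Game) (disasters : ℕ → Finset CivVI.Hex),
      w.HasStrip → g₀.Setup w → (∀ t, g₀.turn ≤ t → disasters t = ∅) →
      -- every configuration can be set up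
      (∀ κ, CivVI.rogozhin.FlaggedValid κ →
        ∃ t g, CivVI.Game.Play w disasters g₀ t g ∧ g.HasStateTiles w ∧ g.Displays w κ) ∧
      -- every instruction can be carried out, with at most linear delay
      (∀ t₀ g κ κ', CivVI.Game.Play w disasters g₀ t₀ g → g.HasStateTiles w → g.Displays w κ →
        CivVI.rogozhin.flaggedStep κ = some κ' →
        ∃ t g', CivVI.Game.Play w disasters g t g' ∧ g'.HasStateTiles w ∧ g'.Displays w κ' ∧
          (κ.1.2 = .b → t = 1) ∧
          (κ.1.2 = .n → 0 < t ∧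
            t ≤ C w.growth + (15 * CivVI.tapeLength κ + 50 + 30 * g.stateCities.card) + 3)) := by
  -- The new City grows from two to four and a lone old one from three back to four, with one extra
  -- turn allowed for each of these three growths.
  refine ⟨CivVI.isUTM_rogozhin, fun G => G 2 + 2 * G 3 + 3,
    fun w g₀ disasters hw hsetup hd => ⟨fun κ hκ => ?_, fun t₀ g κ κ' hplay hst hdisp hstep => ?_⟩⟩
  · obtain ⟨t, g, p, h⟩ := hsetup.exists_displays hw hκ
    exact ⟨t, g, p.play hd, h⟩
  · obtain ⟨t, g', p, h⟩ := CivVI.Game.exists_path_of_flaggedStep hw hst hdisp hstep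
    exact ⟨t, g', p.play fun s hs => hd s (hplay.turn_le.trans hs), h⟩
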